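/- A graph is finite, simple and undirected, and it is subcubic if its maximum degree is at most $3$. For a graph $G$, a set $M\subseteq E(G)$ is an induced matching in $G$ if no two distinct edges in $M$ share a vertex or are joined by an edge of $G$; the induced matching number $\nu_s(G)$ is the maximum cardinality of an induced matching in $G$. For a vertex $u$ let $\delta_G(u)$ be the set of edges of $G$ incident with $u$, and for an edge $uv$ let $\delta_G(uv)=\delta_G(u)\cup\delta_G(v)$. Consider the linear program $$(D)\qquad \min \sum_{e\in E(G)} y_e\quad\text{subject to}\quad \sum_{f\in\delta_G(e)}y_f\ge 1\ \text{ and }\ y_e\ge 0\ \text{ for all } e\in E(G),$$ which is the dual of the natural linear programming relaxation of the maximum induced matching problem. **Theorem.** There is a polynomial-time algorithm that, for a given subcubic graph $G$, produces an induced matching $M$ in $G$ as well as a feasible solution $(y_e)_{e\in E(G)}$ of $(D)$ (with rational values, output as fractions) such that $$|M|\ \ge\ \frac37\sum_{e\in E(G)}y_e .$$ Moreover, $\nu_s(G)\le \frac73|M|$ for the induced matching $M$ produced, so that this is a $\frac73$-approximation algorithm for the maximum induced matching problem in subcubic graphs. -/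

import Mathlib

/-! ### Induced matchings and the dual linear program -/

namespace InducedMatching

section Graph

variable {V : Type*} [Fintype V] [DecidableEq V]

/-- A set `M` of edges of `G` is an induced matching if no two distinct edges of `M` share a
vertex or are joined by an edge of `G`. -/
def IsInducedMatching (G : SimpleGraph V) (M : Finset (Sym2 V)) : Prop :=
  (∀ e ∈ M, e ∈ G.edgeSet) ∧
    ∀ e ∈ M, ∀ f ∈ M, e ≠ f → ∀ u ∈ e, ∀ v ∈ f, u ≠ v ∧ ¬ G.Adj u v

/-- The induced matching number `ν_s(G)`: the maximum cardinality of an induced matching. -/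
noncomputable def inducedMatchingNumber (G : SimpleGraph V) : ℕ :=
  sSup {k : ℕ | ∃ M : Finset (Sym2 V), IsInducedMatching G M ∧ M.card = k}

/-- `δ_G(uv) = δ_G(u) ∪ δ_G(v)`, where `δ_G(u)` is the set of edges incident with `u`. -/
def edgeDelta (G : SimpleGraph V) [DecidableRel G.Adj] (e : Sym2 V) : Finset (Sym2 V) :=
  e.toFinset.biUnion fun u => G.incidenceFinset u

/-- Feasible solutions of the dual linear program `(D)`:
`y(δ_G(e)) ≥ 1` and `y_e ≥ 0` for every edge `e` of `G`.
Only the values of `y` on edges of `G` matter. -/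
def IsDualFeasible (G : SimpleGraph V) [DecidableRel G.Adj] (y : Sym2 V → ℝ) : Prop :=
  ∀ e ∈ G.edgeFinset, 1 ≤ ∑ f ∈ edgeDelta G e, y f ∧ 0 ≤ y e

end Graph

end InducedMatching

/-! ### A random access machine with a step count

Structured programs over natural-number variables `x₀, x₁, …` and two-dimensional tables
`A₀, A₁, …` of natural numbers with indirect addressing. A program mentions finitely many
variables and tables. The arithmetic operations are addition and truncated subtraction, and
every operation, memory access, assignment and test costs one step. There is no multiplication:
one step increases the bit length of the largest stored number by at most one, so that
polynomially many steps on this machine can be carried out by a Turing machine in polynomial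
time, and vice versa. -/

namespace RAM

/-- The memory of the machine. -/
structure Memory where
  var : ℕ → ℕ
  table : ℕ → ℕ → ℕ → ℕ

inductive Expr where
  | lit (c : ℕ)
  | var (i : ℕ)
  | entry (k : ℕ) (a b : Expr)
  | add (a b : Expr)
  | sub (a b : Expr)

namespace Expr

/-- The value of an expression; `entry k a b` is the entry of table `k` at the position given by
the values of `a` and `b`. -/
def eval (s : Memory) : Expr → ℕ
  | lit c => c
  | var i => s.var i
  | entry k a b => s.table k (a.eval s) (b.eval s)
  | add a b => a.eval s + b.eval s
  | sub a b => a.eval s - b.eval s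

/-- The number of steps needed to evaluate an expression: one for each of its nodes. -/
def cost : Expr → ℕ
  | lit _ => 1
  | var _ => 1
  | entry _ a b => a.cost + b.cost + 1
  | add a b => a.cost + b.cost + 1
  | sub a b => a.cost + b.cost + 1

end Expr

inductive Program where
  | skip
  | assign (i : ℕ) (a : Expr)
  | store (k : ℕ) (a b c : Expr)
  | seq (p q : Program)
  | ite (a : Expr) (p q : Program)
  | while (a : Expr) (p : Program)

/-- The memory after `x_i := c`. -/
def Memory.setVar (s : Memory) (i c : ℕ) : Memory :=
  { s with var := Function.update s.var i c }

/-- The memory after `A_k[a, b] := c`. -/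
def Memory.setEntry (s : Memory) (k a b c : ℕ) : Memory :=
  { s with table := fun k' a' b' => if k' = k ∧ a' = a ∧ b' = b then c else s.table k' a' b' }

/-- `Runs p s s' t`: started in memory `s`, the program `p` halts after exactly `t` steps in
memory `s'`. A test succeeds if the value of the tested expression is nonzero. -/
inductive Runs : Program → Memory → Memory → ℕ → Prop
  | skip (s : Memory) : Runs .skip s s 1
  | assign (i : ℕ) (a : Expr) (s : Memory) :
      Runs (.assign i a) s (s.setVar i (a.eval s)) (a.cost + 1)
  | store (k : ℕ) (a b c : Expr) (s : Memory) :
      Runs (.store k a b c) s (s.setEntry k (a.eval s) (b.eval s) (c.eval s))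
        (a.cost + b.cost + c.cost + 1)
  | seq {p q : Program} {s s' s'' : Memory} {t t' : ℕ} :
      Runs p s s' t → Runs q s' s'' t' → Runs (.seq p q) s s'' (t + t')
  | ite_true {a : Expr} {p q : Program} {s s' : Memory} {t : ℕ} :
      a.eval s ≠ 0 → Runs p s s' t → Runs (.ite a p q) s s' (a.cost + 1 + t)
  | ite_false {a : Expr} {p q : Program} {s s' : Memory} {t : ℕ} :
      a.eval s = 0 → Runs q s s' t → Runs (.ite a p q) s s' (a.cost + 1 + t)
  | while_true {a : Expr} {p : Program} {s s' s'' : Memory} {t t' : ℕ} :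
      a.eval s ≠ 0 → Runs p s s' t → Runs (.while a p) s' s'' t' →
        Runs (.while a p) s s'' (a.cost + 1 + t + t')
  | while_false {a : Expr} {p : Program} {s : Memory} :
      a.eval s = 0 → Runs (.while a p) s s (a.cost + 1)

/-- The input encoding of a graph with vertices `0, …, n - 1`: the variable `x₀` holds `n`, the
table `A₀` holds the adjacency matrix, and everything else is zero. -/
def graphInput {n : ℕ} (G : SimpleGraph (Fin n)) [DecidableRel G.Adj] : Memory where
  var i := if i = 0 then n else 0
  table k a b :=
    if h : a < n ∧ b < n then
      if k = 0 ∧ G.Adj ⟨a, h.1⟩ ⟨b, h.2⟩ then 1 else 0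
    else 0

/-- The memory `s` holds the set `M` of edges: the table `A₁` is the 0/1 matrix of the
relation `uv ∈ M`. -/
def OutputsEdgeSet {n : ℕ} (s : Memory) (M : Finset (Sym2 (Fin n))) : Prop :=
  ∀ u v : Fin n, s.table 1 u v = if s(u, v) ∈ M then 1 else 0

/-- The memory `s` holds the values `y_e` of the edges `e = uv` of `G` as fractions: the numerator
is in the table `A₂` and the (positive) denominator in the table `A₃`, at position `(u, v)`. -/
def OutputsEdgeWeights {n : ℕ} (s : Memory) (G : SimpleGraph (Fin n))
    (y : Sym2 (Fin n) → ℝ) : Prop :=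
  ∀ u v : Fin n, G.Adj u v →
    0 < s.table 3 u v ∧ y s(u, v) = (s.table 2 u v : ℝ) / (s.table 3 u v : ℝ)

end RAM

set_option linter.unusedSectionVars false

namespace SubcubicMatching

open Finset

variable {V : Type*} [Fintype V] [DecidableEq V] (G : SimpleGraph V) [DecidableRel G.Adj]

/-! ### Vertex sets inducing a matching, and local search -/

/-! The matching comes from local search, and the dual solution is read off from the local optimum,
so that the ratio 7/3 becomes a finite analysis around single matching edges. An induced matching is
represented by its vertex set `S`, which induces a 1-regular graph. Exchanges delete at most two
vertices and insert at most four. They aim at a larger set, then at a smaller degree sum, then at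
fewer remote vertices, that is, vertices without neighbours in `S`.

In a local optimum, remote vertices are pairwise nonadjacent. Weights are measured in units of 1/24,
so a constraint reads: the weights at the two ends of an edge, minus the weight of the edge, are at
least 24. Every non-remote vertex outside `S` carries at least 12, and at least 24 if it has two
neighbours in `S`; edges between such vertices then need no weight. A remote vertex typically
receives 12, split evenly over its edges. A matching edge gets what is still missing for itself and
for the edges meeting it. The exception is a `Closed` remote vertex: raising its total to 18 or 16
allows the edges from its neighbours to `S` to become much cheaper. Feasibility is
`LocalOpt.edgeWeight_feasible`.

For the value, the weight around an outer vertex is charged to the matching edges at it (`share`),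
and by `LocalOpt.sum_vertexWeight_le` it suffices that each matching edge `uv` is charged at most 56
= 24 · 7/3 (`LocalOpt.matchingCost_le`). The cases are `d(u) + d(v)` at most 4, equal to 5, and
equal to 6. Maximal size means that two independent edges cannot replace `uv` (`LocalOpt.conflict`).
The degree criterion makes nearby remote vertices have large degree and hence small weight per edge
(`LocalOpt.degree_le`). The count of remote vertices excludes the last configurations for degree sum
6 (`LocalOpt.no_swap`). The bound on the induced matching number is weak duality.

For the running time, the algorithm is written in a language with bounded loops only, every
statement of which compiles to a polynomial-time program (`Stmt.runs_compile`). A potential below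
`16 * n ^ 3` grows with each improvement, so `16 * n ^ 3` passes over all exchanges reach a local
optimum without any termination test. -/

/-- The number of neighbours of `x` in `S`. -/
def nbrCount (S : Finset V) (x : V) : ℕ := #{z ∈ G.neighborFinset x | z ∈ S}

/-- The set `S` induces a 1-regular subgraph. -/
def Good (S : Finset V) : Prop := ∀ u ∈ S, nbrCount G S u = 1

def degSum (S : Finset V) : ℕ := ∑ u ∈ S, G.degree u

/-- The vertices without neighbours in `S`. -/
def remote (S : Finset V) : Finset V := {x | nbrCount G S x = 0}

/-- The preference order of the local search. -/
def Better (S' S : Finset V) : Prop :=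
  #S < #S' ∨ (#S = #S' ∧ (degSum G S' < degSum G S ∨
    (degSum G S' = degSum G S ∧ #(remote G S') < #(remote G S))))

/-- Arguments may coincide, so this one operation covers adding an edge, swapping an edge for
another and replacing one edge by two. The fixed number of arguments lets six nested loops enumerate
all exchanges. -/
def exchange (S : Finset V) (a b c d e f : V) : Finset V := (S \ {a, b}) ∪ {c, d, e, f}

def LocalOpt (S : Finset V) : Prop :=
  Good G S ∧ ∀ a b c d e f, Good G (exchange S a b c d e f) →
    ¬ Better G (exchange S a b c d e f) S

variable {G} {S : Finset V}

lemma nbrCount_eq_zero {x : V} : nbrCount G S x = 0 ↔ ∀ z ∈ S, ¬ G.Adj x z := by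
  simp only [nbrCount, card_eq_zero, filter_eq_empty_iff, SimpleGraph.mem_neighborFinset]
  exact ⟨fun h z hz hx => h hx hz, fun h z hx hz => h z hz hx⟩

lemma nbrCount_eq_one {x : V} :
    nbrCount G S x = 1 ↔ ∃ z ∈ S, G.Adj x z ∧ ∀ w ∈ S, G.Adj x w → w = z := by
  rw [nbrCount, card_eq_one]
  constructor
  · rintro ⟨z, hz⟩
    have h := fun w => congrArg (w ∈ ·) hz
    simp only [mem_filter, SimpleGraph.mem_neighborFinset, mem_singleton, eq_iff_iff] at h
    exact ⟨z, ((h z).2 rfl).2, ((h z).2 rfl).1, fun w hw hxw => (h w).1 ⟨hxw, hw⟩⟩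
  · rintro ⟨z, hz, hxz, h⟩
    refine ⟨z, ?_⟩
    ext w
    simp only [mem_filter, SimpleGraph.mem_neighborFinset, mem_singleton]
    exact ⟨fun hw => h w hw.2 hw.1, fun hw => hw ▸ ⟨hxz, hz⟩⟩

lemma good_iff : Good G S ↔ ∀ u ∈ S, ∃ z ∈ S, G.Adj u z ∧ ∀ w ∈ S, G.Adj u w → w = z := by
  simp only [Good, nbrCount_eq_one]

lemma Good.eq (h : Good G S) {u v w : V} (hu : u ∈ S) (hv : v ∈ S) (hw : w ∈ S)
    (huv : G.Adj u v) (huw : G.Adj u w) : v = w := by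
  obtain ⟨z, -, -, hz⟩ := good_iff.1 h u hu
  rw [hz v hv huv, hz w hw huw]

lemma mem_remote {x : V} : x ∈ remote G S ↔ ∀ z ∈ S, ¬ G.Adj x z := by
  simp [remote, nbrCount_eq_zero]

lemma Good.not_mem_remote (h : Good G S) {u : V} (hu : u ∈ S) : u ∉ remote G S := by
  rw [mem_remote]
  obtain ⟨z, hz, huz, -⟩ := good_iff.1 h u hu
  exact fun h => h z hz huz

variable (G S) in
/-- The vertex `z` is neither in `S ∖ {u, v}` nor adjacent to a vertex of that set. -/
def Free (u v z : V) : Prop := ∀ s ∈ S, s ≠ u → s ≠ v → s ≠ z ∧ ¬ G.Adj z s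

/-- Since `u` and `v` are partners of each other, every other vertex of `S` keeps its partner, and
freeness rules out edges between the old part and `A`. -/
lemma good_sdiff_union (h : Good G S) {u v : V} (hu : u ∈ S) (hv : v ∈ S) (huv : G.Adj u v)
    {A : Finset V} (hA : Good G A) (hfree : ∀ z ∈ A, Free G S u v z) :
    Good G ((S \ {u, v}) ∪ A) := by
  rw [good_iff] at hA ⊢
  intro x hx
  simp only [mem_union, mem_sdiff, mem_insert, mem_singleton, not_or] at hx ⊢
  rcases hx with ⟨hxS, hxu, hxv⟩ | hx
  · obtain ⟨z, hz, hxz, hz'⟩ := good_iff.1 h x hxS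
    refine ⟨z, Or.inl ⟨hz, ?_, ?_⟩, hxz, ?_⟩
    · rintro rfl
      exact hxv (h.eq hz hxS hv hxz.symm huv)
    · rintro rfl
      exact hxu (h.eq hz hxS hu hxz.symm huv.symm)
    · rintro w (⟨hw, -⟩ | hw) hxw
      · exact hz' w hw hxw
      · exact absurd hxw.symm (hfree w hw x hxS hxu hxv).2
  · obtain ⟨z, hz, hxz, hz'⟩ := hA x hx
    refine ⟨z, Or.inr hz, hxz, ?_⟩
    rintro w (⟨hw, hwu, hwv⟩ | hw) hxw
    · exact absurd hxw (hfree x hx w hw hwu hwv).2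
    · exact hz' w hw hxw

lemma disjoint_sdiff_of_free {u v : V} {A : Finset V} (hfree : ∀ z ∈ A, Free G S u v z) :
    Disjoint (S \ {u, v}) A := by
  rw [disjoint_left]
  intro x hx hxA
  simp only [mem_sdiff, mem_insert, mem_singleton, not_or] at hx
  exact (hfree x hxA x hx.1 hx.2.1 hx.2.2).1 rfl

lemma good_pair {p q : V} (h : G.Adj p q) : Good G {p, q} := by
  rw [good_iff]
  intro x hx
  simp only [mem_insert, mem_singleton] at hx
  rcases hx with rfl | rfl
  · exact ⟨q, by simp, h, by simp⟩
  · exact ⟨p, by simp, h.symm, by simp⟩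

lemma good_two_pairs {p q p' q' : V} (h : G.Adj p q) (h' : G.Adj p' q')
    (h1 : ¬ G.Adj p p') (h2 : ¬ G.Adj p q') (h3 : ¬ G.Adj q p') (h4 : ¬ G.Adj q q') :
    Good G {p, q, p', q'} := by
  rw [good_iff]
  have e1 := fun h => h1 (SimpleGraph.Adj.symm h)
  have e2 := fun h => h2 (SimpleGraph.Adj.symm h)
  have e3 := fun h => h3 (SimpleGraph.Adj.symm h)
  have e4 := fun h => h4 (SimpleGraph.Adj.symm h)
  intro x hx
  simp only [mem_insert, mem_singleton] at hx
  rcases hx with rfl | rfl | rfl | rfl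
  · exact ⟨q, by simp, h, by simp [*]⟩
  · exact ⟨p, by simp, h.symm, by simp [*]⟩
  · exact ⟨q', by simp, h', by simp; tauto⟩
  · exact ⟨p', by simp, h'.symm, by simp; tauto⟩

lemma card_pair_sdiff {u v : V} (hu : u ∈ S) (hv : v ∈ S) (huv : u ≠ v) :
    #(S \ {u, v}) + 2 = #S := by
  have h : ({u, v} : Finset V) ⊆ S := by
    intro x; simp only [mem_insert, mem_singleton]; rintro (rfl | rfl) <;> assumption
  have := card_sdiff_add_card_eq_card h
  rwa [card_pair huv] at this

lemma degSum_pair_sdiff {u v : V} (hu : u ∈ S) (hv : v ∈ S) (huv : u ≠ v) :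
    degSum G (S \ {u, v}) + (G.degree u + G.degree v) = degSum G S := by
  have h : ({u, v} : Finset V) ⊆ S := by
    intro x; simp only [mem_insert, mem_singleton]; rintro (rfl | rfl) <;> assumption
  have := sum_sdiff (f := fun x => G.degree x) h
  rwa [sum_pair huv] at this

/-- Edges within the free vertices of an edge of the matching are pairwise in conflict. -/
lemma LocalOpt.conflict (h : LocalOpt G S) {u v p q p' q' : V} (hu : u ∈ S) (hv : v ∈ S)
    (huv : G.Adj u v) (hp : Free G S u v p) (hq : Free G S u v q) (hp' : Free G S u v p')
    (hq' : Free G S u v q') (hpq : G.Adj p q) (hpq' : G.Adj p' q') :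
    p = p' ∨ p = q' ∨ q = p' ∨ q = q' ∨
      G.Adj p p' ∨ G.Adj p q' ∨ G.Adj q p' ∨ G.Adj q q' := by
  by_contra! hc
  obtain ⟨n1, n2, n3, n4, a1, a2, a3, a4⟩ := hc
  have hfree : ∀ z ∈ ({p, q, p', q'} : Finset V), Free G S u v z := by
    simp only [mem_insert, mem_singleton]
    rintro z (rfl | rfl | rfl | rfl) <;> assumption
  refine h.2 u v p q p' q' (good_sdiff_union h.1 hu hv huv
    (good_two_pairs hpq hpq' a1 a2 a3 a4) hfree) (Or.inl ?_)
  have hcard : #({p, q, p', q'} : Finset V) = 4 := by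
    have := hpq.ne
    have := hpq'.ne
    rw [card_insert_of_notMem, card_insert_of_notMem, card_pair] <;> simp [*]
  rw [exchange, card_union_of_disjoint (disjoint_sdiff_of_free hfree), hcard]
  have := card_pair_sdiff hu hv huv.ne
  omega

/-- Replacing `uv` by `pq` preserves the size of the set, so only the second and third criteria can
decide, in this order. -/
lemma LocalOpt.swap (h : LocalOpt G S) {u v p q : V} (hu : u ∈ S) (hv : v ∈ S)
    (huv : G.Adj u v) (hp : Free G S u v p) (hq : Free G S u v q) (hpq : G.Adj p q) :
    G.degree u + G.degree v ≤ G.degree p + G.degree q ∧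
      (G.degree u + G.degree v = G.degree p + G.degree q →
        #(remote G S) ≤ #(remote G ((S \ {u, v}) ∪ {p, q}))) := by
  have hfree : ∀ z ∈ ({p, q} : Finset V), Free G S u v z := by
    simp only [mem_insert, mem_singleton]
    rintro z (rfl | rfl) <;> assumption
  have hex : exchange S u v p q p q = (S \ {u, v}) ∪ {p, q} := by
    ext; simp [exchange]
  have hb := h.2 u v p q p q
  rw [hex] at hb
  replace hb := hb (good_sdiff_union h.1 hu hv huv (good_pair hpq) hfree)
  have hd := disjoint_sdiff_of_free hfree
  have hcard : #((S \ {u, v}) ∪ {p, q}) = #S := by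
    rw [card_union_of_disjoint hd, card_pair hpq.ne, card_pair_sdiff hu hv huv.ne]
  have hdeg : degSum G ((S \ {u, v}) ∪ {p, q}) + (G.degree u + G.degree v) =
      degSum G S + (G.degree p + G.degree q) := by
    rw [← degSum_pair_sdiff (G := G) hu hv huv.ne, degSum, sum_union hd, sum_pair hpq.ne]
    simp only [degSum]; ring
  unfold Better at hb
  rw [hcard] at hb
  omega

lemma LocalOpt.remote_not_adj (h : LocalOpt G S) {x y : V} (hx : x ∈ remote G S)
    (hy : y ∈ remote G S) : ¬ G.Adj x y := by
  intro hxy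
  have hxS : x ∉ S := fun hs => h.1.not_mem_remote hs hx
  have hyS : y ∉ S := fun hs => h.1.not_mem_remote hs hy
  rw [mem_remote] at hx hy
  -- As `x` lies outside `S`, nothing is really deleted: this exchange enlarges the matching by the
  -- edge `xy`.
  have hex : exchange S x x x y x y = S ∪ {x, y} := by
    ext z; simp only [exchange, mem_union, mem_sdiff, mem_insert, mem_singleton]
    by_cases hz : z = x <;> simp [hz]
  refine h.2 x x x y x y ?_ (Or.inl ?_) <;> rw [hex]
  · rw [good_iff]
    intro z hz
    simp only [mem_union, mem_insert, mem_singleton] at hz ⊢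
    rcases hz with hz | rfl | rfl
    · obtain ⟨w, hw, hzw, hw'⟩ := good_iff.1 h.1 z hz
      refine ⟨w, Or.inl hw, hzw, ?_⟩
      rintro t (ht | rfl | rfl) hzt
      · exact hw' t ht hzt
      · exact absurd hzt.symm (hx z hz)
      · exact absurd hzt.symm (hy z hz)
    · refine ⟨y, by simp, hxy, ?_⟩
      rintro t (ht | rfl | rfl) hzt
      · exact absurd hzt (hx t ht)
      · exact absurd hzt (SimpleGraph.irrefl G)
      · rfl
    · refine ⟨x, by simp, hxy.symm, ?_⟩
      rintro t (ht | rfl | rfl) hzt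
      · exact absurd hzt (hy t ht)
      · rfl
      · exact absurd hzt (SimpleGraph.irrefl G)
  · rw [card_union_of_disjoint, card_pair hxy.ne]
    · omega
    · rw [disjoint_left]; intro z hz; simp only [mem_insert, mem_singleton]
      rintro (rfl | rfl) <;> contradiction

end SubcubicMatching

namespace SubcubicMatching

open Finset

/-! ### The dual solution -/

section Weights

variable {V : Type*} [Fintype V] [DecidableEq V] (G : SimpleGraph V) [DecidableRel G.Adj]
  (S : Finset V)

/-- The remote neighbours of `x`. -/
def remoteNbrs (x : V) : Finset V := {r ∈ G.neighborFinset x | nbrCount G S r = 0}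

/-- The neighbours of `u` outside `S`. -/
def outerNbrs (u : V) : Finset V := {x ∈ G.neighborFinset u | x ∉ S}

/-- All neighbours of the remote vertex `r` belong to the same matching edge and have no other
remote neighbour. -/
def Closed (r : V) : Prop :=
  2 ≤ G.degree r ∧ (∀ x, G.Adj r x → nbrCount G S x = 1 ∧ #(remoteNbrs G S x) = 1) ∧
    ∃ u ∈ S, ∃ v ∈ S, G.Adj u v ∧ ∀ x, G.Adj r x → G.Adj x u ∨ G.Adj x v

instance (r : V) : Decidable (Closed G S r) := by unfold Closed; infer_instance

/-- The weight of the edge between `x` and its remote neighbour `r`, in units of `1/24`. -/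
def remoteWeight (x r : V) : ℕ :=
  if Closed G S r then if G.degree r = 3 then 6 else 8
  else if G.degree r = 1 then if nbrCount G S x = 1 then 12 else 0
  else if G.degree r = 2 then 6 else 4

/-- The weight of all edges between `x` and its remote neighbours. -/
def toRemote (x : V) : ℕ := ∑ r ∈ remoteNbrs G S x, remoteWeight G S x r

/-- The weight of all edges at the remote vertex `r`. -/
def atRemote (r : V) : ℕ := ∑ x ∈ G.neighborFinset r, remoteWeight G S x r

/-- The weight of each edge between `x ∉ S` and `S`. -/
def toMatched (x : V) : ℕ :=
  if nbrCount G S x = 1 then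
    max (12 - toRemote G S x) ((remoteNbrs G S x).sup fun r =>
      24 + remoteWeight G S x r - (toRemote G S x + atRemote G S r))
  else 12 - (if toRemote G S x = 4 then 2 else if toRemote G S x = 6 then 3 else 0)

/-- The weight of all edges between `u ∈ S` and vertices outside `S`. -/
def matchedLoad (u : V) : ℕ := ∑ x ∈ outerNbrs G S u, toMatched G S x

/-- The weight which the matching edge at `u` needs for the other edges at `u`. -/
def matchedNeed (u : V) : ℕ :=
  {x ∈ outerNbrs G S u | nbrCount G S x = 1}.sup fun x =>
    24 - (matchedLoad G S u + toRemote G S x)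

/-- The weight of the matching edge `uv`. -/
def matchingWeight (u v : V) : ℕ :=
  max (24 - (matchedLoad G S u + matchedLoad G S v)) (max (matchedNeed G S u) (matchedNeed G S v))

/-- The weight of the edge `uv`. -/
def edgeWeight (u v : V) : ℕ :=
  if u ∈ S then if v ∈ S then matchingWeight G S u v else toMatched G S v
  else if v ∈ S then toMatched G S u
  else if nbrCount G S u = 0 then if nbrCount G S v = 0 then 0 else remoteWeight G S v u
  else if nbrCount G S v = 0 then remoteWeight G S u v else 0

/-- The weight of all edges at `u`. -/
def vertexWeight (u : V) : ℕ := ∑ z ∈ G.neighborFinset u, edgeWeight G S u z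

lemma matchingWeight_comm (u v : V) : matchingWeight G S u v = matchingWeight G S v u := by
  simp only [matchingWeight, add_comm (matchedLoad G S u), max_comm (matchedNeed G S u)]

lemma edgeWeight_comm (u v : V) : edgeWeight G S u v = edgeWeight G S v u := by
  unfold edgeWeight
  rw [matchingWeight_comm]
  split_ifs <;> rfl

end Weights

/-! ### Weights at the vertices and feasibility of the dual solution -/

variable {V : Type*} [Fintype V] [DecidableEq V] {G : SimpleGraph V} [DecidableRel G.Adj]
  {S : Finset V}

lemma mem_remoteNbrs {x r : V} :
    r ∈ remoteNbrs G S x ↔ G.Adj x r ∧ nbrCount G S r = 0 := by simp [remoteNbrs]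

lemma mem_outerNbrs {u x : V} : x ∈ outerNbrs G S u ↔ G.Adj u x ∧ x ∉ S := by simp [outerNbrs]

lemma nbrCount_add_card_remoteNbrs_le (h : Good G S) (x : V) :
    nbrCount G S x + #(remoteNbrs G S x) ≤ G.degree x := by
  rw [nbrCount, remoteNbrs, ← card_union_of_disjoint, ← SimpleGraph.card_neighborFinset_eq_degree]
  · apply card_le_card
    intro z; simp only [mem_union, mem_filter]; tauto
  · rw [disjoint_left]
    intro z hz hz'
    simp only [mem_filter] at hz hz'
    have := h z hz.2
    omega

lemma vertexWeight_of_mem (h : Good G S) {u v : V} (hu : u ∈ S) (hv : v ∈ S) (huv : G.Adj u v) :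
    vertexWeight G S u = matchingWeight G S u v + matchedLoad G S u := by
  rw [vertexWeight, ← sum_filter_add_sum_filter_not _ (· ∈ S)]
  congr 1
  · have : {z ∈ G.neighborFinset u | z ∈ S} = {v} := by
      ext z
      simp only [mem_filter, SimpleGraph.mem_neighborFinset, mem_singleton]
      exact ⟨fun hz => h.eq hu hz.2 hv hz.1 huv, by rintro rfl; exact ⟨huv, hv⟩⟩
    rw [this, sum_singleton]
    simp [edgeWeight, hu, hv]
  · apply sum_congr rfl
    intro x hx
    simp only [mem_filter] at hx
    simp [edgeWeight, hu, hx.2]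

lemma vertexWeight_of_outer (h : Good G S) {x : V} (hx : x ∉ S) (hk : nbrCount G S x ≠ 0) :
    vertexWeight G S x = nbrCount G S x * toMatched G S x + toRemote G S x := by
  rw [vertexWeight, ← sum_filter_add_sum_filter_not _ (· ∈ S)]
  congr 1
  · rw [nbrCount, ← smul_eq_mul, ← sum_const]
    apply sum_congr rfl
    intro z hz
    simp only [mem_filter] at hz
    simp [edgeWeight, hx, hz.2]
  · rw [← sum_filter_add_sum_filter_not _ (fun z => nbrCount G S z = 0), ← add_zero (toRemote _ _ _)]
    congr 1
    · rw [toRemote]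
      have : {z ∈ {z ∈ G.neighborFinset x | z ∉ S} | nbrCount G S z = 0} = remoteNbrs G S x := by
        ext z
        simp only [mem_filter, remoteNbrs]
        refine ⟨by tauto, fun hz => ⟨⟨hz.1, fun hzS => ?_⟩, hz.2⟩⟩
        have := h z hzS
        omega
      rw [this]
      apply sum_congr rfl
      intro z hz
      have hz' := (mem_remoteNbrs.1 hz).2
      have : z ∉ S := fun hzS => by have := h z hzS; omega
      simp [edgeWeight, hx, hk, hz', this]
    · apply sum_eq_zero
      intro z hz
      simp only [mem_filter] at hz
      simp [edgeWeight, hx, hk, hz.2, hz.1.2]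

lemma LocalOpt.nbrCount_of_adj_remote (h : LocalOpt G S) {r x : V} (hr : nbrCount G S r = 0)
    (hrx : G.Adj r x) : x ∉ S ∧ nbrCount G S x ≠ 0 :=
  ⟨fun hx => nbrCount_eq_zero.1 hr x hx hrx, fun hx =>
    h.remote_not_adj (by simpa [remote]) (by simpa [remote]) hrx⟩

lemma vertexWeight_of_remote (h : LocalOpt G S) {r : V} (hr : nbrCount G S r = 0) :
    vertexWeight G S r = atRemote G S r := by
  have hrS : r ∉ S := fun hrS => by have := h.1 r hrS; omega
  apply sum_congr rfl
  intro x hx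
  obtain ⟨h1, h2⟩ := h.nbrCount_of_adj_remote hr (by simpa using hx)
  simp [edgeWeight, hrS, hr, h1, h2]

lemma not_closed_of_adj {x r : V} (hxr : G.Adj x r) (hx : nbrCount G S x ≠ 1) :
    ¬ Closed G S r := fun h => hx (h.2.1 x hxr.symm).1

/-- A vertex with at least two neighbours in `S` has sufficient weight. -/
lemma toMatched_spec_of_two_le (h : Good G S) {x : V} (hd : G.degree x ≤ 3)
    (hx : 2 ≤ nbrCount G S x) :
    nbrCount G S x * toMatched G S x + toRemote G S x = 12 * nbrCount G S x ∧
      toMatched G S x ≤ 12 ∧ 9 ≤ toMatched G S x ∧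
      (toRemote G S x = 0 → toMatched G S x = 12) := by
  have hle := nbrCount_add_card_remoteNbrs_le h x
  -- Beside two neighbours in `S` there is room for at most one remote neighbour; it is not closed,
  -- and if it is a leaf then its edge has weight 0.
  have hT : toRemote G S x = 0 ∨
      (nbrCount G S x = 2 ∧ (toRemote G S x = 4 ∨ toRemote G S x = 6)) := by
    rcases Nat.eq_zero_or_pos #(remoteNbrs G S x) with h0 | h0
    · left
      rw [toRemote, card_eq_zero.1 h0, sum_empty]
    · obtain ⟨r, hr⟩ := card_eq_one.1 (by omega : #(remoteNbrs G S x) = 1)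
      have hxr : G.Adj x r := (mem_remoteNbrs.1 (by rw [hr]; simp : r ∈ remoteNbrs G S x)).1
      rw [toRemote, hr, sum_singleton, remoteWeight, if_neg (not_closed_of_adj hxr (by omega))]
      have h2 : nbrCount G S x = 2 := by rw [hr, card_singleton] at hle; omega
      rw [h2]
      split_ifs <;> simp_all
  unfold toMatched
  rw [if_neg (by omega)]
  have h3 : nbrCount G S x = 2 ∨ nbrCount G S x = 3 := by omega
  rcases hT with h0 | ⟨h2, h4 | h6⟩
  · simp [h0, mul_comm]
  · simp [h2, h4]
  · simp [h2, h6]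

lemma toMatched_add_toRemote {x r : V} (hx : nbrCount G S x = 1) (hr : r ∈ remoteNbrs G S x) :
    24 + remoteWeight G S x r ≤ toMatched G S x + toRemote G S x + atRemote G S r := by
  rw [toMatched, if_pos hx]
  have := le_sup (f := fun r =>
      24 + remoteWeight G S x r - (toRemote G S x + atRemote G S r)) hr
  omega

/-- The bound 12 settles the weightless edges between two non-remote vertices outside `S`. The bound
24 settles every edge at a vertex with several neighbours in `S`, since the other end carries at
least the weight of the edge. -/
lemma twelve_le_vertexWeight (h : Good G S) (hd : ∀ v, G.degree v ≤ 3) {x : V} (hx : x ∉ S)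
    (hk : nbrCount G S x ≠ 0) :
    12 ≤ vertexWeight G S x ∧ (nbrCount G S x ≠ 1 → 24 ≤ vertexWeight G S x) := by
  rw [vertexWeight_of_outer h hx hk]
  by_cases h1 : nbrCount G S x = 1
  · refine ⟨?_, fun h => absurd h1 h⟩
    rw [h1, toMatched, if_pos h1]
    omega
  · have := (toMatched_spec_of_two_le h (hd x) (by omega)).1
    omega

/-- The edge weights are feasible for the dual linear program. -/
theorem LocalOpt.edgeWeight_feasible (h : LocalOpt G S) (hd : ∀ v, G.degree v ≤ 3) {u v : V}
    (huv : G.Adj u v) :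
    24 + edgeWeight G S u v ≤ vertexWeight G S u + vertexWeight G S v := by
  -- an edge between a vertex of the matching and a vertex outside
  have key1 : ∀ u x, u ∈ S → x ∉ S → G.Adj u x →
      24 + edgeWeight G S u x ≤ vertexWeight G S u + vertexWeight G S x := by
    intro u x hu hx hux
    have hk : nbrCount G S x ≠ 0 := fun h0 => nbrCount_eq_zero.1 h0 u hu hux.symm
    obtain ⟨v, hv, huv, -⟩ := good_iff.1 h.1 u hu
    have hle : edgeWeight G S u x ≤ vertexWeight G S u := by
      apply single_le_sum (f := fun z => edgeWeight G S u z) (fun _ _ => Nat.zero_le _)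
      simpa using hux
    by_cases h1 : nbrCount G S x = 1
    · rw [vertexWeight_of_mem h.1 hu hv huv, vertexWeight_of_outer h.1 hx hk, h1]
      have he : edgeWeight G S u x = toMatched G S x := by simp [edgeWeight, hu, hx]
      have hx' : x ∈ {x ∈ outerNbrs G S u | nbrCount G S x = 1} := by
        simp [mem_outerNbrs, hux, hx, h1]
      -- The weight of `ux` is contained in the weights of both `u` and `x`. After cancelling one
      -- copy, the matching edge, the load of `u` and the remote edges at `x` must add up to 24,
      -- which is what `matchedNeed` provides.
      have := le_sup (f := fun x => 24 - (matchedLoad G S u + toRemote G S x)) hx'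
      have h3 : matchedNeed G S u ≤ matchingWeight G S u v :=
        (le_max_left _ _).trans (le_max_right _ _)
      unfold matchedNeed at h3
      omega
    · have := (twelve_le_vertexWeight h.1 hd hx hk).2 h1
      omega
  -- an edge between a remote vertex and a vertex outside
  have key2 : ∀ x r, x ∉ S → r ∉ S → nbrCount G S r = 0 → nbrCount G S x ≠ 0 → G.Adj x r →
      24 + edgeWeight G S x r ≤ vertexWeight G S x + vertexWeight G S r := by
    intro x r hx hr hr0 hx0 hxr
    have hle : edgeWeight G S r x ≤ vertexWeight G S r := by
      apply single_le_sum (f := fun z => edgeWeight G S r z) (fun _ _ => Nat.zero_le _)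
      simpa using hxr.symm
    rw [edgeWeight_comm] at hle
    by_cases h1 : nbrCount G S x = 1
    · have he : edgeWeight G S x r = remoteWeight G S x r := by simp [edgeWeight, hx, hr, hr0, hx0]
      rw [he, vertexWeight_of_outer h.1 hx hx0, vertexWeight_of_remote h hr0, h1, one_mul]
      exact toMatched_add_toRemote h1 (mem_remoteNbrs.2 ⟨hxr, hr0⟩)
    · have := (twelve_le_vertexWeight h.1 hd hx hx0).2 h1
      omega
  by_cases hu : u ∈ S <;> by_cases hv : v ∈ S
  · rw [vertexWeight_of_mem h.1 hu hv huv, vertexWeight_of_mem h.1 hv hu huv.symm,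
      matchingWeight_comm G S v u]
    have he : edgeWeight G S u v = matchingWeight G S u v := by simp [edgeWeight, hu, hv]
    have : 24 - (matchedLoad G S u + matchedLoad G S v) ≤ matchingWeight G S u v :=
      le_max_left _ _
    omega
  · exact key1 u v hu hv huv
  · rw [edgeWeight_comm, add_comm (vertexWeight G S u)]
    exact key1 v u hv hu huv.symm
  · by_cases hu0 : nbrCount G S u = 0 <;> by_cases hv0 : nbrCount G S v = 0
    · exact absurd huv (h.remote_not_adj (by simpa [remote]) (by simpa [remote]))
    · rw [edgeWeight_comm, add_comm (vertexWeight G S u)]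
      exact key2 v u hv hu hu0 hv0 huv.symm
    · exact key2 u v hu hv hv0 hu0 huv
    · have he : edgeWeight G S u v = 0 := by simp [edgeWeight, hu, hv, hu0, hv0]
      have := (twelve_le_vertexWeight h.1 hd hu hu0).1
      have := (twelve_le_vertexWeight h.1 hd hv hv0).1
      omega

/-! ### Charging the total weight to the matching edges -/

/-- The part of the weight charged to each matching edge at `x`. -/
def share (G : SimpleGraph V) [DecidableRel G.Adj] (S : Finset V) (x : V) : ℕ :=
  if nbrCount G S x = 1 then toMatched G S x + toRemote G S x else 12

lemma outer_weight_eq (h : Good G S) (hd : ∀ v, G.degree v ≤ 3) {x : V}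
    (hk : nbrCount G S x ≠ 0) :
    nbrCount G S x * toMatched G S x + toRemote G S x = nbrCount G S x * share G S x := by
  unfold share
  split_ifs with h1
  · rw [h1]; ring
  · rw [(toMatched_spec_of_two_le h (hd x) (by omega)).1]; ring

/-- Double counting of the edges between `S` and its complement. -/
lemma sum_outerNbrs (f : V → ℕ) :
    ∑ u ∈ S, ∑ x ∈ outerNbrs G S u, f x = ∑ x ∈ univ \ S, nbrCount G S x * f x := by
  have h1 : ∀ u, ∑ x ∈ outerNbrs G S u, f x =
      ∑ x ∈ univ \ S, if G.Adj u x then f x else 0 := by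
    intro u
    rw [← sum_filter]
    apply sum_congr _ fun _ _ => rfl
    ext x; simp [mem_outerNbrs, and_comm]
  simp_rw [h1]
  rw [sum_comm]
  apply sum_congr rfl
  intro x _
  rw [nbrCount, ← smul_eq_mul, ← sum_const, ← sum_filter]
  apply sum_congr _ fun _ _ => rfl
  ext u; simp [G.adj_comm, and_comm]

lemma LocalOpt.sum_atRemote (h : LocalOpt G S) :
    ∑ r ∈ remote G S, atRemote G S r = ∑ x ∈ {x | x ∉ S ∧ nbrCount G S x ≠ 0}, toRemote G S x := by
  have h1 : ∀ r ∈ remote G S, atRemote G S r = ∑ x ∈ {x | x ∉ S ∧ nbrCount G S x ≠ 0},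
      if G.Adj x r then remoteWeight G S x r else 0 := by
    intro r hr
    rw [atRemote, ← sum_filter]
    apply sum_congr _ fun _ _ => rfl
    ext x
    simp only [SimpleGraph.mem_neighborFinset, mem_filter, mem_univ, true_and]
    exact ⟨fun hx => ⟨h.nbrCount_of_adj_remote (by simpa [remote] using hr) hx, hx.symm⟩,
      fun hx => hx.2.symm⟩
  rw [sum_congr rfl h1, sum_comm]
  apply sum_congr rfl
  intro x _
  rw [toRemote, ← sum_filter]
  apply sum_congr _ fun _ _ => rfl
  ext r
  simp [remote, mem_remoteNbrs, and_comm]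

/-- If the weight charged to each matching edge is at most `c`, then the total weight is at most
`c` times the number of matching edges; each side is counted twice. -/
theorem LocalOpt.sum_vertexWeight_le (h : LocalOpt G S) (hd : ∀ v, G.degree v ≤ 3) {c : ℕ}
    (hc : ∀ u ∈ S, ∀ v ∈ S, G.Adj u v → matchingWeight G S u v +
      ∑ x ∈ outerNbrs G S u, share G S x + ∑ x ∈ outerNbrs G S v, share G S x ≤ c) :
    ∑ u, vertexWeight G S u ≤ c * #S := by
  have hpart : ∀ f : V → ℕ, ∑ u, f u = ∑ u ∈ S, f u +
      (∑ x ∈ {x | x ∉ S ∧ nbrCount G S x ≠ 0}, f x + ∑ r ∈ remote G S, f r) := by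
    intro f
    rw [← sum_union, ← sum_union]
    · apply sum_congr _ fun _ _ => rfl
      ext x
      simp only [mem_univ, mem_union, mem_filter, true_and, remote]
      tauto
    · rw [disjoint_left]
      intro x hx
      simp only [mem_union, mem_filter, mem_univ, true_and, not_or, remote]
      have := h.1 x hx
      exact ⟨fun hx' => hx'.1 hx, by omega⟩
    · rw [disjoint_left]
      intro x
      simp only [mem_filter, mem_univ, true_and, remote]
      tauto
  -- The partner map `p` is an involution of `S`; it makes the two ends of a matching edge
  -- interchangeable in sums.
  choose! p hp hp' using fun u hu => (good_iff.1 h.1 u hu)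
  have hpp : ∀ u ∈ S, p (p u) = u := fun u hu =>
    h.1.eq (hp u hu) (hp _ (hp u hu)) hu (hp' _ (hp u hu)).1 (hp' u hu).1.symm
  have hswap : ∀ f : V → ℕ, ∑ u ∈ S, f (p u) = ∑ u ∈ S, f u := fun f =>
    sum_bij' (fun u _ => p u) (fun u _ => p u) hp hp hpp hpp (fun _ _ => rfl)
  have hres : ∀ f : V → ℕ, ∑ x ∈ univ \ S, nbrCount G S x * f x =
      ∑ x ∈ {x | x ∉ S ∧ nbrCount G S x ≠ 0}, nbrCount G S x * f x := by
    intro f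
    symm
    apply sum_subset
    · intro x; simp; tauto
    · intro x hx hx'
      simp only [mem_sdiff, mem_univ, true_and, mem_filter, not_and, not_not] at hx hx'
      simp [hx' hx]
  have hload : ∑ u ∈ S, matchedLoad G S u + ∑ x ∈ {x | x ∉ S ∧ nbrCount G S x ≠ 0},
      toRemote G S x = ∑ u ∈ S, ∑ x ∈ outerNbrs G S u, share G S x := by
    unfold matchedLoad
    rw [sum_outerNbrs, sum_outerNbrs, hres, hres, ← sum_add_distrib]
    apply sum_congr rfl
    intro x hx
    exact outer_weight_eq h.1 hd (by simpa using (mem_filter.1 hx).2.2)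
  -- Edges leaving `S` and edges at remote vertices are counted once from each end. Loads plus the
  -- weight at remote vertices give one copy of the sum of all shares (`hload`); the weights at the
  -- outer vertices give the other (`h2`).
  have h1 : ∑ u, vertexWeight G S u = ∑ u ∈ S, (matchingWeight G S u (p u) + matchedLoad G S u) +
      (∑ x ∈ {x | x ∉ S ∧ nbrCount G S x ≠ 0},
        (nbrCount G S x * toMatched G S x + toRemote G S x) +
        ∑ x ∈ {x | x ∉ S ∧ nbrCount G S x ≠ 0}, toRemote G S x) := by
    rw [hpart, ← h.sum_atRemote]
    congr 1
    · exact sum_congr rfl fun u hu => vertexWeight_of_mem h.1 hu (hp u hu) (hp' u hu).1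
    congr 1
    · apply sum_congr rfl
      intro x hx
      simp only [mem_filter] at hx
      exact vertexWeight_of_outer h.1 hx.2.1 hx.2.2
    · apply sum_congr rfl
      intro x hx
      exact vertexWeight_of_remote h (by simpa [remote] using hx)
  have h2 : ∑ x ∈ {x | x ∉ S ∧ nbrCount G S x ≠ 0},
      (nbrCount G S x * toMatched G S x + toRemote G S x) =
      ∑ u ∈ S, ∑ x ∈ outerNbrs G S u, share G S x := by
    rw [sum_outerNbrs, hres]
    apply sum_congr rfl
    intro x hx
    exact outer_weight_eq h.1 hd (mem_filter.1 hx).2.2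
  have h3 : ∑ u ∈ S, (matchingWeight G S u (p u) + ∑ x ∈ outerNbrs G S u, share G S x +
      ∑ x ∈ outerNbrs G S (p u), share G S x) ≤ ∑ _u ∈ S, c :=
    sum_le_sum fun u hu => hc u hu (p u) (hp u hu) (hp' u hu).1
  rw [sum_add_distrib, sum_add_distrib, hswap (fun u => ∑ x ∈ outerNbrs G S u, share G S x),
    sum_const, smul_eq_mul, mul_comm] at h3
  rw [h1, h2, sum_add_distrib]
  omega

end SubcubicMatching

namespace SubcubicMatching

open Finset

variable {V : Type*} [Fintype V] [DecidableEq V] {G : SimpleGraph V} [DecidableRel G.Adj]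
  {S : Finset V}

/-! ### The values of the weights at a vertex with exactly one neighbour in `S` -/

lemma eq_of_adj_of_degree_le_three {x a b c z : V} (hd : G.degree x ≤ 3) (ha : G.Adj x a)
    (hb : G.Adj x b) (hc : G.Adj x c) (hab : a ≠ b) (hac : a ≠ c) (hbc : b ≠ c)
    (hz : G.Adj x z) : z = a ∨ z = b ∨ z = c := by
  have hsub : ({a, b, c} : Finset V) ⊆ G.neighborFinset x := by
    intro w; simp only [mem_insert, mem_singleton, SimpleGraph.mem_neighborFinset]
    rintro (rfl | rfl | rfl) <;> assumption
  have := eq_of_subset_of_card_le hsub (by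
    rw [SimpleGraph.card_neighborFinset_eq_degree, card_insert_of_notMem (by simp [hab, hac]),
      card_pair hbc]
    exact hd)
  have hz' : z ∈ G.neighborFinset x := by simpa
  rw [← this] at hz'
  simpa using hz'

lemma eq_of_adj_of_degree_le_two {x a b z : V} (hd : G.degree x ≤ 2) (ha : G.Adj x a)
    (hb : G.Adj x b) (hab : a ≠ b) (hz : G.Adj x z) : z = a ∨ z = b := by
  have hsub : ({a, b} : Finset V) ⊆ G.neighborFinset x := by
    intro w; simp only [mem_insert, mem_singleton, SimpleGraph.mem_neighborFinset]
    rintro (rfl | rfl) <;> assumption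
  have := eq_of_subset_of_card_le hsub (by
    rw [SimpleGraph.card_neighborFinset_eq_degree, card_pair hab]
    exact hd)
  have hz' : z ∈ G.neighborFinset x := by simpa
  rw [← this] at hz'
  simpa using hz'

lemma eq_of_adj_of_degree_le_one {x a z : V} (hd : G.degree x ≤ 1) (ha : G.Adj x a)
    (hz : G.Adj x z) : z = a := by
  rw [← SimpleGraph.card_neighborFinset_eq_degree, card_le_one] at hd
  exact hd z (by simpa) a (by simpa)

lemma atRemote_of_closed {r : V} (hd : G.degree r ≤ 3) (h : Closed G S r) :
    (G.degree r = 3 ∧ atRemote G S r = 18) ∨ (G.degree r = 2 ∧ atRemote G S r = 16) := by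
  unfold atRemote remoteWeight
  simp only [h, if_true, sum_const, SimpleGraph.card_neighborFinset_eq_degree, smul_eq_mul]
  have := h.1
  have h23 : G.degree r = 3 ∨ G.degree r = 2 := by omega
  rcases h23 with h3 | h2
  · simp [h3]
  · simp [h2]

lemma atRemote_of_not_closed {r x : V} (hd : G.degree r ≤ 3) (hrx : G.Adj r x)
    (hx : nbrCount G S x = 1) (h : ¬ Closed G S r) : atRemote G S r = 12 := by
  unfold atRemote remoteWeight
  simp only [h, if_false]
  have hpos : 0 < G.degree r := (G.degree_pos_iff_exists_adj r).2 ⟨x, hrx⟩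
  have h123 : G.degree r = 1 ∨ G.degree r = 2 ∨ G.degree r = 3 := by omega
  rcases h123 with h1 | h2 | h3
  · obtain ⟨z, hz⟩ := card_eq_one.1 ((G.card_neighborFinset_eq_degree r).trans h1)
    have : x = z := by
      have : x ∈ G.neighborFinset r := by simpa
      rw [hz] at this; simpa using this
    subst this
    rw [hz, sum_singleton]
    simp [h1, hx]
  · simp [h2]
  · simp [h3]

/-- The degree of `r` determines the weight `w` of the edge from a private vertex to `r`. -/
def StdWeight (G : SimpleGraph V) [DecidableRel G.Adj] (r : V) (w : ℕ) : Prop :=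
  (G.degree r = 1 ∧ w = 12) ∨ (G.degree r = 2 ∧ w = 6) ∨ (G.degree r = 3 ∧ w = 4)

lemma remoteWeight_of_not_closed {r x : V} (hd : G.degree r ≤ 3) (hrx : G.Adj r x)
    (hx : nbrCount G S x = 1) (h : ¬ Closed G S r) : StdWeight G r (remoteWeight G S x r) := by
  unfold remoteWeight StdWeight
  simp only [h, if_false, hx, if_true]
  have hpos : 0 < G.degree r := (G.degree_pos_iff_exists_adj r).2 ⟨x, hrx⟩
  have h123 : G.degree r = 1 ∨ G.degree r = 2 ∨ G.degree r = 3 := by omega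
  rcases h123 with h1 | h2 | h3
  · simp [h1]
  · simp [h2]
  · simp [h3]

lemma weights_of_remoteNbrs_empty {x : V} (hx : nbrCount G S x = 1) (hR : remoteNbrs G S x = ∅) :
    toRemote G S x = 0 ∧ toMatched G S x = 12 := by
  have : toRemote G S x = 0 := by simp [toRemote, hR]
  simp [toMatched, hx, hR, this]

/-- For the edge `xr`, the weight from `x` to `S` and the total at `r` must add up to 24. A total of
12 at a non-closed `r` forces 12 towards `S`; the totals 18 and 16 at a closed one lower this to 6
and 8. -/
lemma weights_of_remoteNbrs_single {x r : V} (hd : ∀ v, G.degree v ≤ 3)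
    (hx : nbrCount G S x = 1) (hR : remoteNbrs G S x = {r}) :
    (Closed G S r ∧ ((G.degree r = 3 ∧ toRemote G S x = 6 ∧ toMatched G S x = 6) ∨
      (G.degree r = 2 ∧ toRemote G S x = 8 ∧ toMatched G S x = 8))) ∨
    (¬ Closed G S r ∧ StdWeight G r (toRemote G S x) ∧ toMatched G S x = 12) := by
  have hxr : G.Adj r x := ((mem_remoteNbrs (S := S)).1 (by rw [hR]; simp)).1.symm
  have hT : toRemote G S x = remoteWeight G S x r := by rw [toRemote, hR, sum_singleton]
  have ha : toMatched G S x = max (12 - toRemote G S x)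
      (24 + remoteWeight G S x r - (toRemote G S x + atRemote G S r)) := by
    rw [toMatched, if_pos hx, hR, sup_singleton]
  by_cases hc : Closed G S r
  · left
    refine ⟨hc, ?_⟩
    have hw : remoteWeight G S x r = if G.degree r = 3 then 6 else 8 := by
      rw [remoteWeight, if_pos hc]
    rcases atRemote_of_closed (hd r) hc with ⟨h1, h2⟩ | ⟨h1, h2⟩ <;>
      simp only [h1, if_true] at hw <;> simp [ha, hT, hw, h1, h2]
  · right
    refine ⟨hc, hT ▸ remoteWeight_of_not_closed (hd r) hxr hx hc, ?_⟩
    rw [ha, hT, atRemote_of_not_closed (hd r) hxr hx hc]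
    omega

/-- Closedness would require `x` to have a single remote neighbour. With totals 12 at `r` and `r'`,
the edge `xr` needs `12 - w'` towards `S` and `xr'` needs `12 - w`. -/
lemma weights_of_remoteNbrs_pair {x r r' : V} (hd : ∀ v, G.degree v ≤ 3)
    (hx : nbrCount G S x = 1) (hr : r ≠ r') (hR : remoteNbrs G S x = {r, r'}) :
    ∃ w w', StdWeight G r w ∧ StdWeight G r' w' ∧ toRemote G S x = w + w' ∧
      toMatched G S x = 12 - min w w' := by
  have hxr : G.Adj r x := ((mem_remoteNbrs (S := S)).1 (by rw [hR]; simp)).1.symm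
  have hxr' : G.Adj r' x := ((mem_remoteNbrs (S := S)).1 (by rw [hR]; simp)).1.symm
  have hc : ∀ r, G.Adj r x → ¬ Closed G S r := fun r hrx h => by
    have := (h.2.1 x hrx).2
    rw [hR, card_pair hr] at this
    omega
  refine ⟨_, _, remoteWeight_of_not_closed (hd r) hxr hx (hc r hxr),
    remoteWeight_of_not_closed (hd r') hxr' hx (hc r' hxr'), ?_, ?_⟩
  · rw [toRemote, hR, sum_pair hr]
  · have := remoteWeight_of_not_closed (hd r) hxr hx (hc r hxr)
    have := remoteWeight_of_not_closed (hd r') hxr' hx (hc r' hxr')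
    rw [toMatched, if_pos hx, toRemote, hR, sum_pair hr, sup_insert, sup_singleton,
      atRemote_of_not_closed (hd r) hxr hx (hc r hxr),
      atRemote_of_not_closed (hd r') hxr' hx (hc r' hxr')]
    unfold StdWeight at *
    omega

/-! ### Consequences of local optimality around a matching edge -/

lemma Free.symm {u v z : V} (h : Free G S u v z) : Free G S v u z :=
  fun s hs hv hu => h s hs hu hv

lemma free_left (h : Good G S) {u v : V} (hu : u ∈ S) (hv : v ∈ S) (huv : G.Adj u v) :
    Free G S u v u :=
  fun _ hs h1 h2 => ⟨h1, fun hus => h2 (h.eq hu hs hv hus huv)⟩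

lemma free_right (h : Good G S) {u v : V} (hu : u ∈ S) (hv : v ∈ S) (huv : G.Adj u v) :
    Free G S u v v := (free_left h hv hu huv.symm).symm

lemma free_of_remote (h : Good G S) {u v r : V} (hr : nbrCount G S r = 0) : Free G S u v r :=
  fun s hs _ _ => ⟨fun hsr => by have := h s hs; rw [hsr] at this; omega,
    nbrCount_eq_zero.1 hr s hs⟩

lemma eq_of_nbrCount_eq_one {x u s : V} (hk : nbrCount G S x = 1) (hu : u ∈ S) (hxu : G.Adj x u)
    (hs : s ∈ S) (hxs : G.Adj x s) : s = u := by
  obtain ⟨z, -, -, hz⟩ := nbrCount_eq_one.1 hk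
  rw [hz s hs hxs, hz u hu hxu]

lemma free_of_private {u v x : V} (hx : x ∉ S) (hk : nbrCount G S x = 1) (hu : u ∈ S)
    (hxu : G.Adj x u) : Free G S u v x :=
  fun _ hs h1 _ => ⟨fun hsx => hx (hsx ▸ hs),
    fun hxs => h1 (eq_of_nbrCount_eq_one hk hu hxu hs hxs)⟩

/-- The vertex `x` is outside `S`, and its only neighbour in `S` is `u`. -/
structure Private (G : SimpleGraph V) [DecidableRel G.Adj] (S : Finset V) (u x : V) : Prop where
  notMem : x ∉ S
  count : nbrCount G S x = 1
  mem : u ∈ S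
  adj : G.Adj x u

lemma Private.free {u v x : V} (h : Private G S u x) : Free G S u v x :=
  free_of_private h.notMem h.count h.mem h.adj

lemma Private.free' {u v x : V} (h : Private G S v x) : Free G S u v x :=
  (free_of_private h.notMem h.count h.mem h.adj).symm

lemma Private.eq {u x s : V} (h : Private G S u x) (hs : s ∈ S) (hxs : G.Adj x s) : s = u :=
  eq_of_nbrCount_eq_one h.count h.mem h.adj hs hxs

lemma Private.ne_of_remote {u x r : V} (h : Private G S u x) (hr : nbrCount G S r = 0) :
    x ≠ r := by
  rintro rfl
  have := h.count
  omega

/-- A private vertex at one end of a matching edge dominates each edge between a private vertex at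
the other end and a remote vertex. -/
lemma LocalOpt.opposite (h : LocalOpt G S) {u v x r c : V} (huv : G.Adj u v)
    (hx : Private G S u x) (hr : r ∈ remoteNbrs G S x) (hc : Private G S v c) :
    G.Adj c x ∨ G.Adj c r := by
  obtain ⟨hxr, hr0⟩ := mem_remoteNbrs.1 hr
  have hu := hx.mem
  have hv := hc.mem
  have hrv := nbrCount_eq_zero.1 hr0 v hv
  have hrS : r ∉ S := fun hrS => by have := h.1 r hrS; omega
  rcases h.conflict hu hv huv hx.free (free_of_remote h.1 hr0) (free_right h.1 hu hv huv)
    hc.free' hxr hc.adj.symm with e | e | e | e | e | e | e | e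
  · exact absurd (e ▸ hv) hx.notMem
  · exact absurd (hx.eq hv (e ▸ hc.adj)) huv.ne'
  · exact absurd (e ▸ hv) hrS
  · exact absurd e.symm (hc.ne_of_remote hr0)
  · exact absurd (hx.eq hv e) huv.ne'
  · exact Or.inl e.symm
  · exact absurd e hrv
  · exact Or.inr e.symm

/-- The edges between private vertices of a matching edge and remote vertices are in conflict. -/
lemma LocalOpt.private_conflict (h : LocalOpt G S) {u v x y r q : V} (hu : u ∈ S) (hv : v ∈ S)
    (huv : G.Adj u v) (hx : Private G S u x ∨ Private G S v x)
    (hy : Private G S u y ∨ Private G S v y) (hxy : x ≠ y)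
    (hr : r ∈ remoteNbrs G S x) (hq : q ∈ remoteNbrs G S y) :
    G.Adj x y ∨ r = q ∨ G.Adj x q ∨ G.Adj y r := by
  obtain ⟨hxr, hr0⟩ := mem_remoteNbrs.1 hr
  obtain ⟨hyq, hq0⟩ := mem_remoteNbrs.1 hq
  have fx : Free G S u v x := hx.elim (·.free) (·.free')
  have fy : Free G S u v y := hy.elim (·.free) (·.free')
  have nx := fun r => hx.elim (fun h => h.ne_of_remote (r := r)) (·.ne_of_remote)
  have ny := fun r => hy.elim (fun h => h.ne_of_remote (r := r)) (·.ne_of_remote)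
  rcases h.conflict hu hv huv fx (free_of_remote h.1 hr0) fy
    (free_of_remote h.1 hq0) hxr hyq with e | e | e | e | e | e | e | e
  · exact absurd e hxy
  · exact absurd e (nx q hq0)
  · exact absurd e.symm (ny r hr0)
  · exact Or.inr (Or.inl e)
  · exact Or.inl e
  · exact Or.inr (Or.inr (Or.inl e))
  · exact Or.inr (Or.inr (Or.inr e.symm))
  · exact absurd e (h.remote_not_adj (by simpa [remote]) (by simpa [remote]))

/-- The edge `xr` is a possible replacement for `uv`, so it cannot have smaller degree sum. -/
lemma LocalOpt.degree_le (h : LocalOpt G S) {u v x r : V} (hu : u ∈ S) (hv : v ∈ S)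
    (huv : G.Adj u v) (hx : Private G S u x ∨ Private G S v x) (hr : r ∈ remoteNbrs G S x) :
    G.degree u + G.degree v ≤ G.degree x + G.degree r := by
  obtain ⟨hxr, hr0⟩ := mem_remoteNbrs.1 hr
  exact (h.swap hu hv huv (hx.elim (·.free) (·.free')) (free_of_remote h.1 hr0) hxr).1

/-! ### The weight charged to a matching edge -/

/-- The matching weight is a maximum of truncated differences, and each alternative, including 0,
yields one linear inequality. As `share = toMatched + toRemote` for private `x`, the last two
hypotheses do not depend on the weights at `x` itself. -/
lemma matchingCost_le {u v : V} {c : ℕ}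
    (h0 : ∑ x ∈ outerNbrs G S u, share G S x + ∑ x ∈ outerNbrs G S v, share G S x ≤ c)
    (h1 : ∑ x ∈ outerNbrs G S u, share G S x + ∑ x ∈ outerNbrs G S v, share G S x + 24 ≤
      c + (matchedLoad G S u + matchedLoad G S v))
    (hu : ∀ x ∈ outerNbrs G S u, nbrCount G S x = 1 →
      ∑ x ∈ outerNbrs G S u, share G S x + ∑ x ∈ outerNbrs G S v, share G S x + 24 ≤
      c + (matchedLoad G S u + toRemote G S x))
    (hv : ∀ x ∈ outerNbrs G S v, nbrCount G S x = 1 →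
      ∑ x ∈ outerNbrs G S u, share G S x + ∑ x ∈ outerNbrs G S v, share G S x + 24 ≤
      c + (matchedLoad G S v + toRemote G S x)) :
    matchingWeight G S u v +
      ∑ x ∈ outerNbrs G S u, share G S x + ∑ x ∈ outerNbrs G S v, share G S x ≤ c := by
  have key : ∀ a b c : ℕ, b ≤ c → a ≤ c - b → a + b ≤ c := by omega
  rw [add_assoc]
  apply key _ _ _ h0
  apply max_le (by omega) (max_le _ _) <;> refine Finset.sup_le fun x hx => ?_ <;>
    simp only [mem_filter] at hx
  · have := hu x hx.1 hx.2; omega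
  · have := hv x hx.1 hx.2; omega

lemma private_of_mem_outerNbrs {u x : V} (hu : u ∈ S) (hx : x ∈ outerNbrs G S u)
    (hk : nbrCount G S x = 1) : Private G S u x :=
  ⟨(mem_outerNbrs.1 hx).2, hk, hu, (mem_outerNbrs.1 hx).1.symm⟩

lemma card_outerNbrs (h : Good G S) {u : V} (hu : u ∈ S) :
    #(outerNbrs G S u) + 1 = G.degree u := by
  have := h u hu
  rw [nbrCount] at this
  rw [← this, ← SimpleGraph.card_neighborFinset_eq_degree, outerNbrs, add_comm]
  exact card_filter_add_card_filter_not _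

lemma nbrCount_ne_zero_of_mem_outerNbrs {u x : V} (hu : u ∈ S) (hx : x ∈ outerNbrs G S u) :
    nbrCount G S x ≠ 0 := fun h0 =>
  nbrCount_eq_zero.1 h0 u hu (mem_outerNbrs.1 hx).1.symm

lemma card_remoteNbrs_le_two (h : Good G S) (hd : ∀ v, G.degree v ≤ 3) {x : V}
    (hk : nbrCount G S x ≠ 0) : #(remoteNbrs G S x) ≤ 2 := by
  have := nbrCount_add_card_remoteNbrs_le h x
  have := hd x
  omega

lemma remoteNbrs_cases (h : Good G S) (hd : ∀ v, G.degree v ≤ 3) {x : V}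
    (hk : nbrCount G S x ≠ 0) : remoteNbrs G S x = ∅ ∨ (∃ r, remoteNbrs G S x = {r}) ∨
      ∃ r r', r ≠ r' ∧ remoteNbrs G S x = {r, r'} := by
  have := card_remoteNbrs_le_two h hd hk
  have h3 : #(remoteNbrs G S x) = 0 ∨ #(remoteNbrs G S x) = 1 ∨ #(remoteNbrs G S x) = 2 := by
    omega
  rcases h3 with h0 | h1 | h2
  · exact Or.inl (card_eq_zero.1 h0)
  · exact Or.inr (Or.inl (card_eq_one.1 h1))
  · exact Or.inr (Or.inr (card_eq_two.1 h2))

lemma share_of_private {u x : V} (hx : Private G S u x) :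
    share G S x = toMatched G S x + toRemote G S x := if_pos hx.count

lemma share_of_two_le (h : Good G S) (hd : ∀ v, G.degree v ≤ 3) {x : V}
    (hk : nbrCount G S x ≠ 0) (hx : nbrCount G S x ≠ 1) :
    share G S x = 12 ∧ 9 ≤ toMatched G S x ∧ toMatched G S x ≤ 12 ∧
      (toRemote G S x = 0 → toMatched G S x = 12) := by
  have := toMatched_spec_of_two_le h (hd x) (x := x) (by omega)
  exact ⟨if_neg hx, this.2.2.1, this.2.1, this.2.2.2⟩

lemma Private.share_le (h : Good G S) (hd : ∀ v, G.degree v ≤ 3) {u x : V}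
    (hx : Private G S u x) : toMatched G S x + toRemote G S x ≤ 24 := by
  have := hx.count
  rcases remoteNbrs_cases h hd (x := x) (by omega) with hR | ⟨r, hR⟩ | ⟨r, r', hr, hR⟩
  · have := weights_of_remoteNbrs_empty hx.count hR
    omega
  · have := weights_of_remoteNbrs_single hd hx.count hR
    unfold StdWeight at this
    omega
  · obtain ⟨w, w', h1, h2, h3, h4⟩ := weights_of_remoteNbrs_pair hd hx.count hr hR
    unfold StdWeight at h1 h2
    omega

/-- If `x` has a large weight towards remote vertices, then one of them is a leaf. -/
lemma LocalOpt.toRemote_add_le_of_large (h : LocalOpt G S) (hd : ∀ v, G.degree v ≤ 3)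
    {u v x c : V}
    (hu : u ∈ S) (hv : v ∈ S) (huv : G.Adj u v) (hx : Private G S u x ∨ Private G S v x)
    (hc : Private G S u c ∨ Private G S v c) (hxc : x ≠ c) (hT : 17 ≤ toRemote G S x) :
    toRemote G S x + toRemote G S c ≤ 32 := by
  have hx1 : nbrCount G S x = 1 := hx.elim (·.count) (·.count)
  have hc1 : nbrCount G S c = 1 := hc.elim (·.count) (·.count)
  obtain ⟨s, hxs, hs⟩ : ∃ s, G.Adj x s ∧ s ∈ S := hx.elim (fun h => ⟨u, h.adj, hu⟩)
    (fun h => ⟨v, h.adj, hv⟩)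
  have hcS : c ∉ S := hc.elim (·.notMem) (·.notMem)
  -- one of the two remote neighbours of `x` is a leaf
  obtain ⟨l, r, hlr, hR, hl, w, hw, hT'⟩ : ∃ l r, l ≠ r ∧ remoteNbrs G S x = {l, r} ∧
      G.degree l = 1 ∧ ∃ w, StdWeight G r w ∧ toRemote G S x = 12 + w := by
    rcases remoteNbrs_cases h.1 hd (x := x) (by omega) with hR | ⟨r, hR⟩ | ⟨r, r', hr, hR⟩
    · have := weights_of_remoteNbrs_empty hx1 hR
      omega
    · have := weights_of_remoteNbrs_single hd hx1 hR
      unfold StdWeight at this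
      omega
    · obtain ⟨w, w', h1, h2, h3, -⟩ := weights_of_remoteNbrs_pair hd hx1 hr hR
      by_cases hw : w = 12
      · exact ⟨r, r', hr, hR, by unfold StdWeight at h1; omega, w', h2, by omega⟩
      · have : w' = 12 := by unfold StdWeight at h1 h2; omega
        exact ⟨r', r, hr.symm, by rw [hR, pair_comm], by unfold StdWeight at h2; omega, w, h1,
          by omega⟩
  have hlx : l ∈ remoteNbrs G S x := by rw [hR]; simp
  have hrx : r ∈ remoteNbrs G S x := by rw [hR]; simp
  have hl' := mem_remoteNbrs.1 hlx
  have hr' := mem_remoteNbrs.1 hrx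
  have hsl : ∀ r, nbrCount G S r = 0 → s ≠ r := by
    rintro _ h0 rfl
    have := h.1 s hs
    omega
  have hleaf : ∀ z, G.Adj l z → z = x := fun z hz =>
    eq_of_adj_of_degree_le_one hl.le hl'.1.symm hz
  have hxN : ∀ z, G.Adj x z → z = s ∨ z = l ∨ z = r := fun z hz =>
    eq_of_adj_of_degree_le_three (hd x) hxs hl'.1 hr'.1 (hsl l hl'.2) (hsl r hr'.2) hlr hz
  -- The edge from `x` to its leaf `l` conflicts with every edge `cq`. The neighbourhood of `x` is
  -- already `{s, l, r}` and that of `l` is `{x}`, so only `q = r` is left.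
  have hsub : remoteNbrs G S c ⊆ {r} := by
    intro q hq
    rw [mem_singleton]
    have hq' := mem_remoteNbrs.1 hq
    rcases h.private_conflict hu hv huv hx hc hxc hlx hq with e | e | e | e
    · rcases hxN c e with rfl | rfl | rfl
      · exact absurd hs hcS
      · omega
      · omega
    · exact absurd (hleaf c (e ▸ hq'.1.symm)) hxc.symm
    · rcases hxN q e with rfl | rfl | rfl
      · exact absurd rfl (hsl _ hq'.2)
      · exact absurd (hleaf c hq'.1.symm) hxc.symm
      · rfl
    · exact absurd (hleaf c e.symm) hxc.symm
  rcases subset_singleton_iff.1 hsub with hRc | hRc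
  · have := weights_of_remoteNbrs_empty hc1 hRc
    unfold StdWeight at hw
    omega
  · have hcr : G.Adj c r := (mem_remoteNbrs (S := S).1 (by rw [hRc]; simp)).1
    have hdr : G.degree r ≠ 1 := fun h1 =>
      hxc (eq_of_adj_of_degree_le_one h1.le hcr.symm hr'.1.symm)
    have := weights_of_remoteNbrs_single hd hc1 hRc
    unfold StdWeight at hw this
    omega

/-- The excess of the charged weight over the weight at the matching edge is bounded for each pair
of vertices. -/
lemma LocalOpt.share_add_share_le (h : LocalOpt G S) (hd : ∀ v, G.degree v ≤ 3)
    {u v x c : V} (hu : u ∈ S) (hv : v ∈ S) (huv : G.Adj u v)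
    (hx : x ∈ outerNbrs G S u ∨ x ∈ outerNbrs G S v)
    (hc : c ∈ outerNbrs G S u ∨ c ∈ outerNbrs G S v) (hxc : x ≠ c) :
    share G S x + share G S c ≤ 32 + (toMatched G S x + toMatched G S c) := by
  have key : ∀ x, x ∈ outerNbrs G S u ∨ x ∈ outerNbrs G S v →
      ((Private G S u x ∨ Private G S v x) ∧ share G S x = toMatched G S x + toRemote G S x ∧
        toMatched G S x + toRemote G S x ≤ 24) ∨
      (share G S x = 12 ∧ 9 ≤ toMatched G S x) := by
    intro x hx
    by_cases hx1 : nbrCount G S x = 1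
    · left
      rcases hx with hx | hx
      · have := private_of_mem_outerNbrs hu hx hx1
        exact ⟨Or.inl this, share_of_private this, this.share_le h.1 hd⟩
      · have := private_of_mem_outerNbrs hv hx hx1
        exact ⟨Or.inr this, share_of_private this, this.share_le h.1 hd⟩
    · right
      have h0 : nbrCount G S x ≠ 0 := hx.elim (nbrCount_ne_zero_of_mem_outerNbrs hu)
        (nbrCount_ne_zero_of_mem_outerNbrs hv)
      have := share_of_two_le h.1 hd h0 hx1
      exact ⟨this.1, this.2.1⟩
  rcases key x hx with ⟨px, ex, lx⟩ | ⟨ex, lx⟩ <;> rcases key c hc with ⟨pc, ec, lc⟩ | ⟨ec, lc⟩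
  · by_cases h17 : 17 ≤ toRemote G S x
    · have := h.toRemote_add_le_of_large hd hu hv huv px pc hxc h17
      omega
    by_cases h17' : 17 ≤ toRemote G S c
    · have := h.toRemote_add_le_of_large hd hu hv huv pc px hxc.symm h17'
      omega
    omega
  all_goals omega

end SubcubicMatching

namespace SubcubicMatching

open Finset

variable {V : Type*} [Fintype V] [DecidableEq V] {G : SimpleGraph V} [DecidableRel G.Adj]
  {S : Finset V}

lemma share_cases (h : Good G S) (hd : ∀ v, G.degree v ≤ 3) {u x : V} (hu : u ∈ S)
    (hx : x ∈ outerNbrs G S u) :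
    (Private G S u x ∧ share G S x = toMatched G S x + toRemote G S x ∧
      toMatched G S x + toRemote G S x ≤ 24) ∨
    (nbrCount G S x ≠ 1 ∧ share G S x = 12 ∧ 9 ≤ toMatched G S x ∧ toMatched G S x ≤ 12 ∧
      (toRemote G S x = 0 → toMatched G S x = 12)) := by
  by_cases hx1 : nbrCount G S x = 1
  · have := private_of_mem_outerNbrs hu hx hx1
    exact Or.inl ⟨this, share_of_private this, this.share_le h hd⟩
  · exact Or.inr ⟨hx1, share_of_two_le h hd (nbrCount_ne_zero_of_mem_outerNbrs hu hx) hx1⟩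

lemma matchingCost_comm_le {u v : V} {c : ℕ}
    (h : matchingWeight G S v u +
      ∑ x ∈ outerNbrs G S v, share G S x + ∑ x ∈ outerNbrs G S u, share G S x ≤ c) :
    matchingWeight G S u v +
      ∑ x ∈ outerNbrs G S u, share G S x + ∑ x ∈ outerNbrs G S v, share G S x ≤ c := by
  rw [matchingWeight_comm]; omega

/-! ### Matching edges with at most two further incident edges -/

/-- At most two edges leave `uv`, and no share exceeds 24. The requirement of `uv` itself is the
delicate one; with two leaving edges it follows from `LocalOpt.share_add_share_le`. -/
lemma LocalOpt.matchingCost_le_of_degree_le_four (h : LocalOpt G S) (hd : ∀ v, G.degree v ≤ 3)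
    {u v : V} (hu : u ∈ S) (hv : v ∈ S) (huv : G.Adj u v)
    (hdeg : G.degree u + G.degree v ≤ 4) :
    matchingWeight G S u v +
      ∑ x ∈ outerNbrs G S u, share G S x + ∑ x ∈ outerNbrs G S v, share G S x ≤ 56 := by
  wlog hle : G.degree u ≤ G.degree v generalizing u v
  · exact matchingCost_comm_le (this hv hu huv.symm (by omega) (by omega))
  have hcu := card_outerNbrs h.1 hu
  have hcv := card_outerNbrs h.1 hv
  have hcases : (#(outerNbrs G S u) = 1 ∧ #(outerNbrs G S v) = 1) ∨
      (#(outerNbrs G S u) = 0 ∧ (#(outerNbrs G S v) = 0 ∨ #(outerNbrs G S v) = 1 ∨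
        #(outerNbrs G S v) = 2)) := by omega
  rcases hcases with ⟨h1, h2⟩ | ⟨h1, h2 | h2 | h2⟩
  · obtain ⟨x, hx⟩ := card_eq_one.1 h1
    obtain ⟨c, hc⟩ := card_eq_one.1 h2
    have hxu : x ∈ outerNbrs G S u := by rw [hx]; simp
    have hcv : c ∈ outerNbrs G S v := by rw [hc]; simp
    have kx := share_cases h.1 hd hu hxu
    have kc := share_cases h.1 hd hv hcv
    have hxc : share G S x + share G S c ≤ 32 + (toMatched G S x + toMatched G S c) := by
      -- A common neighbour of `u` and `v` is not private, so its share exceeds its weight towards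
      -- `S` by at most 3.
      by_cases e : x = c
      · subst e
        rcases kx with ⟨px, -⟩ | ⟨-, kx⟩
        · exact absurd (px.eq hv (mem_outerNbrs.1 hcv).1.symm) huv.ne'
        · omega
      · exact h.share_add_share_le hd hu hv huv (Or.inl hxu) (Or.inr hcv) e
    apply matchingCost_le <;> simp only [matchedLoad, hx, hc, sum_singleton, mem_singleton,
      forall_eq] <;> try intro _
    all_goals omega
  · rw [card_eq_zero] at h1 h2
    apply matchingCost_le <;> simp [matchedLoad, h1, h2]
  · rw [card_eq_zero] at h1
    obtain ⟨c, hc⟩ := card_eq_one.1 h2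
    have kc := share_cases h.1 hd hv (x := c) (by rw [hc]; simp)
    apply matchingCost_le <;> simp only [matchedLoad, h1, hc, sum_singleton, mem_singleton,
      forall_eq, sum_empty, notMem_empty, false_imp_iff, implies_true] <;> try intro _
    all_goals omega
  · rw [card_eq_zero] at h1
    obtain ⟨c, d, hcd, hc⟩ := card_eq_two.1 h2
    have hcv : c ∈ outerNbrs G S v := by rw [hc]; simp
    have hdv : d ∈ outerNbrs G S v := by rw [hc]; simp
    have kc := share_cases h.1 hd hv hcv
    have kd := share_cases h.1 hd hv hdv
    have := h.share_add_share_le hd hu hv huv (Or.inr hcv) (Or.inr hdv) hcd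
    apply matchingCost_le <;> simp only [matchedLoad, h1, hc, sum_pair hcd, mem_insert,
      mem_singleton, forall_eq_or_imp, forall_eq, sum_empty, notMem_empty, false_imp_iff,
      implies_true] <;> try refine ⟨fun _ => ?_, fun _ => ?_⟩
    all_goals omega

/-! ### Matching edges with three further incident edges -/

/-- As `d(x) + d(r) ≥ 5`, no remote neighbour `r` is a leaf, which removes the weight 12. The
possible shares are 12, 16 and 18, and 18 occurs only with a non-closed remote neighbour of degree
two. -/
lemma LocalOpt.private_weights_of_five_le (h : LocalOpt G S) (hd : ∀ v, G.degree v ≤ 3)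
    {u v x : V} (hu : u ∈ S) (hv : v ∈ S) (huv : G.Adj u v)
    (hdeg : 5 ≤ G.degree u + G.degree v) (hx : Private G S u x ∨ Private G S v x) :
    (remoteNbrs G S x = ∅ ∧ toRemote G S x = 0 ∧ toMatched G S x = 12) ∨
    (remoteNbrs G S x ≠ ∅ ∧ toMatched G S x + toRemote G S x = 12 ∧ toRemote G S x = 6) ∨
    (remoteNbrs G S x ≠ ∅ ∧ toMatched G S x + toRemote G S x = 16 ∧ toRemote G S x ≤ 8) ∨
    (toMatched G S x + toRemote G S x = 18 ∧ toRemote G S x ≤ 12 ∧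
      ((∃ r, remoteNbrs G S x = {r} ∧ G.degree r = 2 ∧ ¬ Closed G S r) ∨
      ∃ r r', r ≠ r' ∧ remoteNbrs G S x = {r, r'} ∧ G.degree r = 2)) := by
  have hx1 : nbrCount G S x = 1 := hx.elim (·.count) (·.count)
  have hr2 : ∀ r ∈ remoteNbrs G S x, 2 ≤ G.degree r := fun r hr => by
    have := h.degree_le hu hv huv hx hr
    have := hd x
    omega
  rcases remoteNbrs_cases h.1 hd (x := x) (by omega) with hR | ⟨r, hR⟩ | ⟨r, r', hr, hR⟩
  · exact Or.inl ⟨hR, weights_of_remoteNbrs_empty hx1 hR⟩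
  · have hne : remoteNbrs G S x ≠ ∅ := by rw [hR]; simp
    have := hr2 r (by rw [hR]; simp)
    rcases weights_of_remoteNbrs_single hd hx1 hR with ⟨-, hw⟩ | ⟨hc, hw, ha⟩
    · refine Or.inr ?_
      rcases hw with hw | hw
      · exact Or.inl ⟨hne, by omega⟩
      · exact Or.inr (Or.inl ⟨hne, by omega⟩)
    · rcases hw with hw | hw | hw
      · omega
      · exact Or.inr (Or.inr (Or.inr ⟨by omega, by omega, Or.inl ⟨r, hR, hw.1, hc⟩⟩))
      · exact Or.inr (Or.inr (Or.inl ⟨hne, by omega, by omega⟩))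
  · have hne : remoteNbrs G S x ≠ ∅ := by rw [hR]; simp
    have := hr2 r (by rw [hR]; simp)
    have := hr2 r' (by rw [hR]; simp)
    obtain ⟨w, w', h1, h2, h3, h4⟩ := weights_of_remoteNbrs_pair hd hx1 hr hR
    unfold StdWeight at h1 h2
    by_cases e : G.degree r = 2
    · exact Or.inr (Or.inr (Or.inr ⟨by omega, by omega, Or.inr ⟨r, r', hr, hR, e⟩⟩))
    by_cases e' : G.degree r' = 2
    · exact Or.inr (Or.inr (Or.inr ⟨by omega, by omega,
        Or.inr ⟨r', r, hr.symm, by rw [hR, pair_comm], e'⟩⟩))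
    · exact Or.inr (Or.inr (Or.inl ⟨hne, by omega, by omega⟩))

lemma Private.ne_private {u v x y : V} (huv : u ≠ v) (hx : Private G S u x)
    (hy : Private G S v y) : x ≠ y := by
  rintro rfl
  exact huv (hy.eq hx.mem hx.adj)

/-- The key estimate for a matching edge `uv` with `u` of degree two. -/
lemma LocalOpt.no_pair_of_degree_two (h : LocalOpt G S) (hd : ∀ v, G.degree v ≤ 3)
    {u v x c d r q : V} (huv : G.Adj u v) (hx : Private G S u x) (hc : Private G S v c)
    (hd' : Private G S v d) (hcd : c ≠ d) (hr : r ∈ remoteNbrs G S c) (hr2 : G.degree r = 2)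
    (hrc : (remoteNbrs G S c = {r} ∧ ¬ Closed G S r) ∨
      ∃ r', r ≠ r' ∧ remoteNbrs G S c = {r, r'})
    (hq : q ∈ remoteNbrs G S d) : False := by
  have hu := hx.mem
  have hv := hc.mem
  obtain ⟨hcr, hr0⟩ := mem_remoteNbrs.1 hr
  obtain ⟨hdq, hq0⟩ := mem_remoteNbrs.1 hq
  have hxc : x ≠ c := hx.ne_private huv.ne hc
  have hxd : x ≠ d := hx.ne_private huv.ne hd'
  have hne : ∀ s ∈ S, ∀ r, nbrCount G S r = 0 → s ≠ r := by
    rintro s hs _ h0 rfl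
    have := h.1 s hs
    omega
  have hvx : v ≠ x := fun e => hx.notMem (e ▸ hv)
  have hux : u ≠ x := fun e => hx.notMem (e ▸ hu)
  have hud : u ≠ d := fun e => hd'.notMem (e ▸ hu)
  have hvd : v ≠ d := fun e => hd'.notMem (e ▸ hv)
  have hvc : v ≠ c := fun e => hc.notMem (e ▸ hv)
  rcases hrc with ⟨hR, hncl⟩ | ⟨r', hrr', hR⟩
  · have hcR : ∀ q, nbrCount G S q = 0 → G.Adj c q → q = r := fun q h0 hcq => by
      have : q ∈ remoteNbrs G S c := mem_remoteNbrs.2 ⟨hcq, h0⟩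
      rw [hR] at this
      simpa using this
    -- If `x` is adjacent to `r`, then `r` has no neighbours but `c` and `x`, and the conflicts
    -- force `d` to have the four neighbours `v`, `x`, `q`, `c`. Otherwise they force `r` to have
    -- exactly the neighbours `c` and `d`, and `r` would be closed.
    by_cases hxr : G.Adj x r
    · have hrN : ∀ z, G.Adj r z → z = c ∨ z = x := fun z =>
        eq_of_adj_of_degree_le_two hr2.le hcr.symm hxr.symm hxc.symm
      have hdr : ¬ G.Adj d r := fun e => by
        rcases hrN d e.symm with e | e
        · exact hcd e.symm
        · exact hxd e.symm
      have hdx : G.Adj d x := (h.opposite huv hx (mem_remoteNbrs.2 ⟨hxr, hr0⟩) hd').resolve_right hdr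
      have hcd' : G.Adj c d := by
        rcases h.private_conflict hu hv huv (Or.inr hc) (Or.inr hd') hcd hr hq with e | e | e | e
        · exact e
        · exact absurd (e ▸ hdq) hdr
        · exact absurd (hcR q hq0 e ▸ hdq) hdr
        · exact absurd e hdr
      rcases eq_of_adj_of_degree_le_three (hd d) hd'.adj hdx hdq hvx (hne v hv q hq0)
        (hx.ne_of_remote hq0) hcd'.symm with e | e | e
      · exact hvc e.symm
      · exact hxc e.symm
      · exact hc.ne_of_remote hq0 e
    · have hxc' : G.Adj x c := (h.opposite huv.symm hc hr hx).resolve_right hxr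
      have hcN : ∀ z, G.Adj c z → z = v ∨ z = r ∨ z = x := fun z =>
        eq_of_adj_of_degree_le_three (hd c) hc.adj hcr hxc'.symm (hne v hv r hr0) hvx
          (hx.ne_of_remote hr0).symm
      have hdr : G.Adj d r := by
        rcases h.private_conflict hu hv huv (Or.inr hc) (Or.inr hd') hcd hr hq with e | e | e | e
        · rcases hcN d e with e | e | e
          · exact absurd e.symm hvd
          · exact absurd e (hd'.ne_of_remote hr0)
          · exact absurd e.symm hxd
        · exact e ▸ hdq
        · exact hcR q hq0 e ▸ hdq
        · exact e
      have hrd : r ∈ remoteNbrs G S d := mem_remoteNbrs.2 ⟨hdr, hr0⟩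
      have hxd' : G.Adj x d := (h.opposite huv.symm hd' hrd hx).resolve_right hxr
      have hdN : ∀ z, G.Adj d z → z = v ∨ z = r ∨ z = x := fun z =>
        eq_of_adj_of_degree_le_three (hd d) hd'.adj hdr hxd'.symm (hne v hv r hr0) hvx
          (hx.ne_of_remote hr0).symm
      have hRd : remoteNbrs G S d = {r} := by
        ext z
        rw [mem_singleton]
        refine ⟨fun hz => ?_, fun hz => hz ▸ hrd⟩
        obtain ⟨hdz, hz0⟩ := mem_remoteNbrs.1 hz
        rcases hdN z hdz with e | e | e
        · exact absurd e.symm (hne v hv z hz0)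
        · exact e
        · exact absurd e.symm (hx.ne_of_remote hz0)
      have hrN : ∀ z, G.Adj r z → z = c ∨ z = d := fun z =>
        eq_of_adj_of_degree_le_two hr2.le hcr.symm hdr.symm hcd
      refine hncl ⟨hr2.ge, fun z hz => ?_, u, hu, v, hv, huv, fun z hz => ?_⟩
      · rcases hrN z hz with rfl | rfl
        · exact ⟨hc.count, by rw [hR, card_singleton]⟩
        · exact ⟨hd'.count, by rw [hRd, card_singleton]⟩
      · rcases hrN z hz with rfl | rfl
        · exact Or.inr hc.adj
        · exact Or.inr hd'.adj
  · have hr' : r' ∈ remoteNbrs G S c := by rw [hR]; simp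
    obtain ⟨hcr', hr0'⟩ := mem_remoteNbrs.1 hr'
    -- Here `c` has no room beside `v`, `r`, `r'`, so `x` must be adjacent to both `r` and `r'`.
    -- Then neither `x` nor `r` has room for `d`, contrary to `LocalOpt.opposite`.
    have hxc' : ¬ G.Adj x c := fun e => by
      rcases eq_of_adj_of_degree_le_three (hd c) hc.adj hcr hcr' (hne v hv r hr0)
        (hne v hv r' hr0') hrr' e.symm with e | e | e
      · exact hvx e.symm
      · exact hx.ne_of_remote hr0 e
      · exact hx.ne_of_remote hr0' e
    have hxr := (h.opposite huv.symm hc hr hx).resolve_left hxc'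
    have hxr' := (h.opposite huv.symm hc hr' hx).resolve_left hxc'
    rcases h.opposite huv hx (mem_remoteNbrs.2 ⟨hxr, hr0⟩) hd' with e | e
    · rcases eq_of_adj_of_degree_le_three (hd x) hx.adj hxr hxr' (hne u hu r hr0)
        (hne u hu r' hr0') hrr' e.symm with e | e | e
      · exact hud e.symm
      · exact hd'.ne_of_remote hr0 e
      · exact hd'.ne_of_remote hr0' e
    · rcases eq_of_adj_of_degree_le_two hr2.le hcr.symm hxr.symm hxc.symm e.symm with e | e
      · exact hcd e.symm
      · exact hxd e.symm

/-- Only a share of 18 can violate the bound. It comes with a remote neighbour of degree two, and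
then `LocalOpt.no_pair_of_degree_two` keeps the other share at 12. -/
lemma LocalOpt.share_pair_le_of_degree_two (h : LocalOpt G S) (hd : ∀ v, G.degree v ≤ 3)
    {u v x c d : V} (huv : G.Adj u v) (hdeg : 5 ≤ G.degree u + G.degree v)
    (hx : Private G S u x) (hc : c ∈ outerNbrs G S v) (hd' : d ∈ outerNbrs G S v)
    (hcd : c ≠ d) (hv : v ∈ S) : share G S c + share G S d ≤ 32 := by
  have key : ∀ c ∈ outerNbrs G S v, ∀ d ∈ outerNbrs G S v, c ≠ d → share G S c = 18 →
      Private G S v c → Private G S v d → share G S d ≤ 14 := by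
    intro c _ d _ hcd hc18 hc hd'
    by_contra! hlt
    rw [share_of_private hc] at hc18
    rw [share_of_private hd'] at hlt
    obtain ⟨q, hq⟩ : (remoteNbrs G S d).Nonempty := by
      rcases h.private_weights_of_five_le hd hx.mem hv huv hdeg (Or.inr hd') with
        k | k | k | ⟨-, -, ⟨r, hR, -⟩ | ⟨r, r', -, hR, -⟩⟩
      · omega
      · exact nonempty_iff_ne_empty.2 k.1
      · exact nonempty_iff_ne_empty.2 k.1
      · rw [hR]; simp
      · rw [hR]; simp
    rcases h.private_weights_of_five_le hd hx.mem hv huv hdeg (Or.inr hc) with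
        k | k | k | ⟨-, -, ⟨r, hR, hr2, hcl⟩ | ⟨r, r', hne, hR, hr2⟩⟩
    · omega
    · omega
    · omega
    · exact h.no_pair_of_degree_two hd huv hx hc hd' hcd (by rw [hR]; simp) hr2
        (Or.inl ⟨hR, hcl⟩) hq
    · exact h.no_pair_of_degree_two hd huv hx hc hd' hcd (by rw [hR]; simp) hr2
        (Or.inr ⟨r', hne, hR⟩) hq
  have key' : ∀ c, Private G S v c → share G S c ≤ 16 ∨ share G S c = 18 := by
    intro c hc
    rw [share_of_private hc]
    have := h.private_weights_of_five_le hd hx.mem hv huv hdeg (Or.inr hc)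
    omega
  rcases share_cases h.1 hd hv hc with ⟨pc, -⟩ | ⟨-, kc⟩ <;>
    rcases share_cases h.1 hd hv hd' with ⟨pd, -⟩ | ⟨-, kd⟩
  · have := key c hc d hd' hcd
    have := key d hd' c hc hcd.symm
    have := key' c pc
    have := key' d pd
    simp only [pc, pd, true_imp_iff] at *
    omega
  · have := key' c pc; omega
  · have := key' d pd; omega
  · omega

lemma LocalOpt.matchingCost_le_of_degree_eq_five (h : LocalOpt G S) (hd : ∀ v, G.degree v ≤ 3)
    {u v : V} (hu : u ∈ S) (hv : v ∈ S) (huv : G.Adj u v)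
    (hdu : G.degree u = 2) (hdv : G.degree v = 3) :
    matchingWeight G S u v +
      ∑ x ∈ outerNbrs G S u, share G S x + ∑ x ∈ outerNbrs G S v, share G S x ≤ 56 := by
  have hcu := card_outerNbrs h.1 hu
  have hcv := card_outerNbrs h.1 hv
  obtain ⟨x, hx⟩ := card_eq_one.1 (by omega : #(outerNbrs G S u) = 1)
  obtain ⟨c, d, hcd, hc⟩ := card_eq_two.1 (by omega : #(outerNbrs G S v) = 2)
  have hxu : x ∈ outerNbrs G S u := by rw [hx]; simp
  have hcv : c ∈ outerNbrs G S v := by rw [hc]; simp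
  have hdv : d ∈ outerNbrs G S v := by rw [hc]; simp
  -- The excess of the share over the weight towards `S` enters the requirement of `uv`. It is at
  -- most 12, and it shrinks to 8 and 6 as the share drops to 16 and below.
  have key : ∀ y, y ∈ outerNbrs G S u ∨ y ∈ outerNbrs G S v →
      share G S y ≤ 18 ∧ share G S y ≤ 12 + toMatched G S y ∧
      (share G S y ≤ 16 → share G S y ≤ 8 + toMatched G S y) ∧
      (share G S y < 16 → share G S y ≤ 6 + toMatched G S y) ∧
      (nbrCount G S y = 1 → share G S y = toMatched G S y + toRemote G S y) ∧
      (nbrCount G S y ≠ 1 → share G S y ≤ 3 + toMatched G S y) := by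
    have aux : ∀ y, Private G S u y ∨ Private G S v y → share G S y ≤ 18 ∧
        share G S y ≤ 12 + toMatched G S y ∧
        (share G S y ≤ 16 → share G S y ≤ 8 + toMatched G S y) ∧
        (share G S y < 16 → share G S y ≤ 6 + toMatched G S y) ∧
        (nbrCount G S y = 1 → share G S y = toMatched G S y + toRemote G S y) ∧
        (nbrCount G S y ≠ 1 → share G S y ≤ 3 + toMatched G S y) := by
      intro y py
      have e1 : share G S y = toMatched G S y + toRemote G S y :=
        py.elim share_of_private share_of_private
      have e2 : nbrCount G S y = 1 := py.elim (·.count) (·.count)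
      rcases h.private_weights_of_five_le hd hu hv huv (by omega) py with k | k | k | ⟨k, k', -⟩
      all_goals omega
    rintro y (hy | hy)
    · rcases share_cases h.1 hd hu hy with ⟨py, e⟩ | ⟨n, e⟩
      · exact aux y (Or.inl py)
      · omega
    · rcases share_cases h.1 hd hv hy with ⟨py, e⟩ | ⟨n, e⟩
      · exact aux y (Or.inr py)
      · omega
  have kx := key x (Or.inl hxu)
  have kc := key c (Or.inr hcv)
  have kd := key d (Or.inr hdv)
  have hp : nbrCount G S x = 1 → share G S c + share G S d ≤ 32 := fun hx1 =>
    h.share_pair_le_of_degree_two hd huv (by omega) (private_of_mem_outerNbrs hu hxu hx1) hcv hdv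
      hcd hv
  apply matchingCost_le <;> simp only [matchedLoad, hx, hc, sum_singleton, sum_pair hcd,
    mem_insert, mem_singleton, forall_eq_or_imp, forall_eq] <;>
    try first | refine ⟨fun _ => ?_, fun _ => ?_⟩ | refine fun _ => ?_
  all_goals omega

end SubcubicMatching

namespace SubcubicMatching

open Finset

variable {V : Type*} [Fintype V] [DecidableEq V] {G : SimpleGraph V} [DecidableRel G.Adj]
  {S : Finset V}

/-! ### Matching edges with four further incident edges -/

/-- Replacing `uv` by another edge `pq` does not decrease the number of remote vertices. -/
lemma LocalOpt.no_swap (h : LocalOpt G S) {u v p q : V} (hu : u ∈ S) (hv : v ∈ S)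
    (huv : G.Adj u v) (hp : Free G S u v p) (hq : Free G S u v q) (hpq : G.Adj p q)
    (hdeg : G.degree p + G.degree q ≤ G.degree u + G.degree v) {D W : Finset V}
    (hD : ∀ r ∈ D, nbrCount G S r = 0 ∧ (G.Adj r p ∨ G.Adj r q)) (hcard : #W < #D)
    (hW : ∀ z, G.Adj z u ∨ G.Adj z v → z ∈ W ∨ G.Adj z p ∨ G.Adj z q ∨
      ∃ s ∈ S, s ≠ u ∧ s ≠ v ∧ G.Adj z s) : False := by
  obtain ⟨h1, h2⟩ := h.swap hu hv huv hp hq hpq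
  have hle := h2 (by omega)
  -- Only neighbours of `u` or `v` can become remote, and by `hW` these lie in `W`; the vertices of
  -- `D` stop being remote.
  have hsub : remote G ((S \ {u, v}) ∪ {p, q}) ⊆ (remote G S \ D) ∪ W := by
    intro z hz
    rw [mem_remote] at hz
    have hzp : ¬ G.Adj z p := hz p (by simp)
    have hzq : ¬ G.Adj z q := hz q (by simp)
    have hzs : ∀ s ∈ S, s ≠ u → s ≠ v → ¬ G.Adj z s := fun s hs h1 h2 =>
      hz s (by simp [hs, h1, h2])
    simp only [mem_union, mem_sdiff]
    by_cases hzuv : G.Adj z u ∨ G.Adj z v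
    · rcases hW z hzuv with e | e | e | ⟨s, hs, h1, h2, e⟩
      · exact Or.inr e
      · exact absurd e hzp
      · exact absurd e hzq
      · exact absurd e (hzs s hs h1 h2)
    · push Not at hzuv
      refine Or.inl ⟨mem_remote.2 fun s hs => ?_, fun hzD => ?_⟩
      · by_cases h1 : s = u
        · rw [h1]; exact hzuv.1
        by_cases h2 : s = v
        · rw [h2]; exact hzuv.2
        exact hzs s hs h1 h2
      · exact (hD z hzD).2.elim hzp hzq
  have hDR : D ⊆ remote G S := fun r hr => by simpa [remote] using (hD r hr).1
  have h3 := (card_le_card hsub).trans (card_union_le _ _)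
  rw [card_sdiff_of_subset hDR] at h3
  have := card_le_card hDR
  omega

/-- Such a `b` stays non-remote when `uv` is removed, as `LocalOpt.no_swap` requires of the vertices
outside `W`. -/
lemma exists_other_of_not_private {u v b c d : V} (hu : u ∈ S)
    (hY : outerNbrs G S v = {c, d}) (hb : b ∈ outerNbrs G S u) (hb1 : nbrCount G S b ≠ 1)
    (hbc : b ≠ c) (hbd : b ≠ d) : ∃ s ∈ S, s ≠ u ∧ s ≠ v ∧ G.Adj b s := by
  by_contra! hcon
  apply hb1
  obtain ⟨hub, hbS⟩ := mem_outerNbrs.1 hb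
  refine nbrCount_eq_one.2 ⟨u, hu, hub.symm, fun s hs hbs => ?_⟩
  by_contra hsu
  by_cases hsv : s = v
  · have : b ∈ outerNbrs G S v := mem_outerNbrs.2 ⟨hsv ▸ hbs.symm, hbS⟩
    rw [hY] at this
    simp only [mem_insert, mem_singleton] at this
    exact this.elim hbc hbd
  · exact hcon s hs hsu hsv hbs

/-- The possible weights at a private vertex of a matching edge between vertices of degree three. -/
lemma LocalOpt.private_weights_of_six (h : LocalOpt G S) (hd : ∀ v, G.degree v ≤ 3)
    {u v x : V} (hu : u ∈ S) (hv : v ∈ S) (huv : G.Adj u v)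
    (hdeg : G.degree u + G.degree v = 6) (hx : Private G S u x ∨ Private G S v x) :
    (toRemote G S x = 0 ∧ share G S x = 12 ∧ toMatched G S x = 12 ∧ remoteNbrs G S x = ∅) ∨
    (∃ r, remoteNbrs G S x = {r} ∧ Closed G S r ∧ share G S x = 12 ∧ toMatched G S x = 6) ∨
    (∃ r, remoteNbrs G S x = {r} ∧ ¬ Closed G S r ∧ share G S x = 16 ∧ toMatched G S x = 12) ∨
    (∃ r r', r ≠ r' ∧ remoteNbrs G S x = {r, r'} ∧ share G S x = 16 ∧ toMatched G S x = 8) := by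
  have hx1 : nbrCount G S x = 1 := hx.elim (·.count) (·.count)
  have e : share G S x = toMatched G S x + toRemote G S x :=
    hx.elim share_of_private share_of_private
  -- Now `d(x) + d(r) ≥ 6`, and no degree exceeds 3.
  have hr3 : ∀ r ∈ remoteNbrs G S x, G.degree r = 3 := fun r hr => by
    have := h.degree_le hu hv huv hx hr
    have := hd x
    have := hd r
    omega
  rcases remoteNbrs_cases h.1 hd (x := x) (by omega) with hR | ⟨r, hR⟩ | ⟨r, r', hr, hR⟩
  · have := weights_of_remoteNbrs_empty hx1 hR
    exact Or.inl ⟨by omega, by omega, by omega, hR⟩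
  · have := hr3 r (by rw [hR]; simp)
    rcases weights_of_remoteNbrs_single hd hx1 hR with ⟨hc, hw⟩ | ⟨hc, hw, ha⟩
    · exact Or.inr (Or.inl ⟨r, hR, hc, by omega, by omega⟩)
    · unfold StdWeight at hw
      exact Or.inr (Or.inr (Or.inl ⟨r, hR, hc, by omega, by omega⟩))
  · have := hr3 r (by rw [hR]; simp)
    have := hr3 r' (by rw [hR]; simp)
    obtain ⟨w, w', h1, h2, h3, h4⟩ := weights_of_remoteNbrs_pair hd hx1 hr hR
    unfold StdWeight at h1 h2
    exact Or.inr (Or.inr (Or.inr ⟨r, r', hr, hR, by omega, by omega⟩))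

/-- Three private vertices of a matching edge with one remote neighbour each have the same remote
neighbour. -/
lemma LocalOpt.closed_of_three (h : LocalOpt G S) (hd : ∀ v, G.degree v ≤ 3)
    {u v p q s r₁ r₂ r₃ : V} (hu : u ∈ S) (hv : v ∈ S) (huv : G.Adj u v)
    (hdeg : G.degree u + G.degree v = 6) (hp : Private G S u p ∨ Private G S v p)
    (hq : Private G S u q ∨ Private G S v q) (hs : Private G S u s ∨ Private G S v s)
    (hpq : p ≠ q) (hps : p ≠ s) (hqs : q ≠ s) (hRp : remoteNbrs G S p = {r₁})
    (hRq : remoteNbrs G S q = {r₂}) (hRs : remoteNbrs G S s = {r₃}) :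
    r₁ = r₂ ∧ r₁ = r₃ ∧ Closed G S r₁ := by
  have pair : ∀ x y r r', (Private G S u x ∨ Private G S v x) →
      (Private G S u y ∨ Private G S v y) → x ≠ y → remoteNbrs G S x = {r} →
      remoteNbrs G S y = {r'} → G.Adj x y ∨ r = r' := by
    intro x y r r' hx hy hxy hRx hRy
    have hr : r ∈ remoteNbrs G S x := by rw [hRx]; simp
    have hr' : r' ∈ remoteNbrs G S y := by rw [hRy]; simp
    rcases h.private_conflict hu hv huv hx hy hxy hr hr' with e | e | e | e
    · exact Or.inl e
    · exact Or.inr e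
    · have : r' ∈ remoteNbrs G S x := mem_remoteNbrs.2 ⟨e, (mem_remoteNbrs.1 hr').2⟩
      rw [hRx, mem_singleton] at this
      exact Or.inr this.symm
    · have : r ∈ remoteNbrs G S y := mem_remoteNbrs.2 ⟨e, (mem_remoteNbrs.1 hr).2⟩
      rw [hRy, mem_singleton] at this
      exact Or.inr this
  -- a vertex is adjacent to at most one of the other two
  have one : ∀ x y z r, (Private G S u x ∨ Private G S v x) →
      (Private G S u y ∨ Private G S v y) → (Private G S u z ∨ Private G S v z) →
      remoteNbrs G S x = {r} → y ≠ z → G.Adj x y → ¬ G.Adj x z := by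
    intro x y z r hx hy hz hRx hyz hxy hxz
    obtain ⟨hxr, hr0⟩ := (mem_remoteNbrs (S := S)).1 (by rw [hRx]; simp : r ∈ remoteNbrs G S x)
    obtain ⟨w, hw, hxw⟩ : ∃ w ∈ S, G.Adj x w := hx.elim (fun e => ⟨u, hu, e.adj⟩)
      (fun e => ⟨v, hv, e.adj⟩)
    have hwr : w ≠ r := by rintro rfl; have := h.1 w hw; omega
    have hyr : y ≠ r := hy.elim (·.ne_of_remote hr0) (·.ne_of_remote hr0)
    have hzr : z ≠ r := hz.elim (·.ne_of_remote hr0) (·.ne_of_remote hr0)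
    have hyS : y ∉ S := hy.elim (·.notMem) (·.notMem)
    have hzS : z ∉ S := hz.elim (·.notMem) (·.notMem)
    rcases eq_of_adj_of_degree_le_three (hd x) hxw hxr hxy hwr (fun e => hyS (e ▸ hw)) hyr.symm
      hxz with e | e | e
    · exact hzS (e ▸ hw)
    · exact hzr e
    · exact hyz e.symm
  -- If two of the three vertices are adjacent, neither is adjacent to the third. Hence both share
  -- their remote neighbour with the third, and all three agree.
  have e12 : r₁ = r₂ := by
    rcases pair p q r₁ r₂ hp hq hpq hRp hRq with e | e
    · have h1 := (pair p s r₁ r₃ hp hs hps hRp hRs).resolve_left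
        (one p q s r₁ hp hq hs hRp hqs e)
      have h2 := (pair q s r₂ r₃ hq hs hqs hRq hRs).resolve_left
        (one q p s r₂ hq hp hs hRq hps e.symm)
      rw [h1, h2]
    · exact e
  have e13 : r₁ = r₃ := by
    rcases pair p s r₁ r₃ hp hs hps hRp hRs with e | e
    · have h2 := (pair q s r₂ r₃ hq hs hqs hRq hRs).resolve_left
        (fun e' => one s p q r₃ hs hp hq hRs hpq e.symm e'.symm)
      rw [e12, h2]
    · exact e
  refine ⟨e12, e13, ?_⟩
  subst e12 e13
  have hr1 : r₁ ∈ remoteNbrs G S p := by rw [hRp]; simp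
  have hpr := (mem_remoteNbrs.1 hr1).1
  have hqr := (mem_remoteNbrs (S := S).1 (by rw [hRq]; simp : r₁ ∈ remoteNbrs G S q)).1
  have hsr := (mem_remoteNbrs (S := S).1 (by rw [hRs]; simp : r₁ ∈ remoteNbrs G S s)).1
  have hdr : 2 ≤ G.degree r₁ := by
    have := h.degree_le hu hv huv hp hr1
    have := hd p
    omega
  have hN : ∀ z, G.Adj r₁ z → z = p ∨ z = q ∨ z = s := fun z =>
    eq_of_adj_of_degree_le_three (hd r₁) hpr.symm hqr.symm hsr.symm hpq hps hqs
  have adj : ∀ z, (Private G S u z ∨ Private G S v z) → G.Adj z u ∨ G.Adj z v := fun z hz =>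
    hz.imp (·.adj) (·.adj)
  have cnt : ∀ z, (Private G S u z ∨ Private G S v z) → nbrCount G S z = 1 := fun z hz =>
    hz.elim (·.count) (·.count)
  refine ⟨hdr, fun z hz => ?_, u, hu, v, hv, huv, fun z hz => ?_⟩
  · rcases hN z hz with rfl | rfl | rfl
    · exact ⟨cnt _ hp, by rw [hRp, card_singleton]⟩
    · exact ⟨cnt _ hq, by rw [hRq, card_singleton]⟩
    · exact ⟨cnt _ hs, by rw [hRs, card_singleton]⟩
  · rcases hN z hz with rfl | rfl | rfl
    · exact adj _ hp
    · exact adj _ hq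
    · exact adj _ hs

/-- Around a matching edge, there is not both a closed remote vertex and a further private vertex
whose only remote neighbour is not closed. -/
lemma LocalOpt.no_closed_and_not_closed (h : LocalOpt G S) (hd : ∀ v, G.degree v ≤ 3)
    {u v x c r r' : V} (hu : u ∈ S) (hv : v ∈ S) (huv : G.Adj u v)
    (hdeg : G.degree u + G.degree v = 6) (hx : Private G S u x) (hc : Private G S v c)
    (hRx : remoteNbrs G S x = {r}) (hr : Closed G S r) (hRc : remoteNbrs G S c = {r'})
    (hr' : ¬ Closed G S r') : False := by
  have hrx : r ∈ remoteNbrs G S x := by rw [hRx]; simp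
  have hxr := (mem_remoteNbrs.1 hrx).1
  have hr0 := (mem_remoteNbrs.1 hrx).2
  have hne : r ≠ r' := fun e => hr' (e ▸ hr)
  obtain ⟨h2, hk, a, ha, b, hb, hab, hcov⟩ := hr
  have hpriv : ∀ z, G.Adj r z → Private G S u z ∨ Private G S v z := by
    intro z hz
    have hzS := (h.nbrCount_of_adj_remote hr0 hz).1
    have hz1 := (hk z hz).1
    rcases hcov x hxr.symm with e | e
    · obtain rfl := hx.eq ha e
      obtain rfl := h.1.eq hx.mem hb hv hab huv
      exact (hcov z hz).imp (fun e => ⟨hzS, hz1, hu, e⟩) (fun e => ⟨hzS, hz1, hv, e⟩)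
    · obtain rfl := hx.eq hb e
      obtain rfl := h.1.eq hx.mem ha hv hab.symm huv
      exact (hcov z hz).symm.imp (fun e => ⟨hzS, hz1, hu, e⟩) (fun e => ⟨hzS, hz1, hv, e⟩)
  have hRz : ∀ z, G.Adj r z → remoteNbrs G S z = {r} := by
    intro z hz
    obtain ⟨w, hw⟩ := card_eq_one.1 (hk z hz).2
    have : r ∈ remoteNbrs G S z := mem_remoteNbrs.2 ⟨hz.symm, hr0⟩
    rw [hw, mem_singleton] at this
    rw [hw, this]
  have hcr : ¬ G.Adj r c := fun e => by
    have := hRz c e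
    rw [hRc, singleton_inj] at this
    exact hne this.symm
  -- The closed vertex `r` has degree at least two; `LocalOpt.closed_of_three` applied to `x`, `z`,
  -- `c` then gives `r = r'`.
  obtain ⟨z, hz, hzx⟩ : ∃ z, G.Adj r z ∧ z ≠ x := by
    by_contra! hcon
    have : G.degree r ≤ 1 := by
      rw [← SimpleGraph.card_neighborFinset_eq_degree, card_le_one]
      intro a ha b hb
      rw [hcon a (by simpa using ha), hcon b (by simpa using hb)]
    omega
  exact hne (h.closed_of_three hd hu hv huv hdeg (Or.inl hx) (hpriv z hz) (Or.inr hc) hzx.symm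
    (hx.ne_private huv.ne hc) (fun e => hcr (e ▸ hz)) hRx (hRz z hz) hRc).2.1

/-! ### Excluded configurations around a matching edge with four further incident edges -/

section Local

variable (h : LocalOpt G S) (hd : ∀ v, G.degree v ≤ 3) {u v x b c d : V} (hu : u ∈ S)
  (hv : v ∈ S) (huv : G.Adj u v) (hdeg : G.degree u + G.degree v = 6)

include h hd huv

/-- A private vertex opposite to a private vertex with two remote neighbours has the same remote
neighbours. -/
lemma LocalOpt.double_opposite (hx : Private G S u x) (hc : Private G S v c) {r r' : V}
    (hr : r ≠ r') (hRx : remoteNbrs G S x = {r, r'}) :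
    G.Adj c r ∧ G.Adj c r' ∧ remoteNbrs G S c = {r, r'} := by
  have hrx : r ∈ remoteNbrs G S x := by rw [hRx]; simp
  have hrx' : r' ∈ remoteNbrs G S x := by rw [hRx]; simp
  have hcx : ¬ G.Adj c x := fun e => by
    have hne : ∀ q, nbrCount G S q = 0 → u ≠ q := by
      rintro _ h0 rfl
      have := h.1 u hx.mem
      omega
    rcases eq_of_adj_of_degree_le_three (hd x) hx.adj (mem_remoteNbrs.1 hrx).1
      (mem_remoteNbrs.1 hrx').1 (hne r (mem_remoteNbrs.1 hrx).2)
      (hne r' (mem_remoteNbrs.1 hrx').2) hr e.symm with e | e | e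
    · exact hc.notMem (e ▸ hx.mem)
    · exact hc.ne_of_remote (mem_remoteNbrs.1 hrx).2 e
    · exact hc.ne_of_remote (mem_remoteNbrs.1 hrx').2 e
  have e1 := (h.opposite huv hx hrx hc).resolve_left hcx
  have e2 := (h.opposite huv hx hrx' hc).resolve_left hcx
  refine ⟨e1, e2, (eq_of_subset_of_card_le ?_ ?_).symm⟩
  · intro q
    simp only [mem_insert, mem_singleton]
    rintro (rfl | rfl)
    · exact mem_remoteNbrs.2 ⟨e1, (mem_remoteNbrs.1 hrx).2⟩
    · exact mem_remoteNbrs.2 ⟨e2, (mem_remoteNbrs.1 hrx').2⟩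
  · rw [card_pair hr]
    exact card_remoteNbrs_le_two h.1 hd (by rw [hc.count]; omega)

include hdeg

/-- Three private vertices with two common remote neighbours are impossible, if one of them is the
only private vertex at its end of the matching edge. -/
lemma LocalOpt.no_triple_double (hX : outerNbrs G S u = {x, b}) (hY : outerNbrs G S v = {c, d})
    (hx : Private G S u x) (hb : nbrCount G S b ≠ 1) (hc : Private G S v c)
    (hd' : Private G S v d) {r r' : V} (hr : r ≠ r') (hRx : remoteNbrs G S x = {r, r'}) :
    False := by
  have hrx : r ∈ remoteNbrs G S x := by rw [hRx]; simp
  have hrx' : r' ∈ remoteNbrs G S x := by rw [hRx]; simp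
  have hcr := (h.double_opposite hd huv hx hc hr hRx).1
  have hdr := (h.double_opposite hd huv hx hd' hr hRx).1
  obtain ⟨s, hs, hsu, hsv, hbs⟩ := exists_other_of_not_private hx.mem hY
    (b := b) (by rw [hX]; simp) hb (fun e => hb (e ▸ hc.count)) (fun e => hb (e ▸ hd'.count))
  -- Swap `uv` for `xr`: both `r` and `r'` gain the neighbour `x` in the new set, and at most `v`
  -- becomes remote. The vertices `c` and `d` are covered by `r`, and `b` has another neighbour in
  -- `S`.
  refine h.no_swap hx.mem hc.mem huv hx.free (free_of_remote h.1 (mem_remoteNbrs.1 hrx).2)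
    (mem_remoteNbrs.1 hrx).1 (by have := hd x; have := hd r; omega) (D := {r, r'}) (W := {v})
    ?_ (by rw [card_pair hr, card_singleton]; omega) ?_
  · intro q hq
    have : q ∈ remoteNbrs G S x := by rw [hRx]; exact hq
    exact ⟨(mem_remoteNbrs.1 this).2, Or.inl (mem_remoteNbrs.1 this).1.symm⟩
  · rintro z (hz | hz)
    · by_cases hzS : z ∈ S
      · left
        rw [mem_singleton]
        exact h.1.eq hx.mem hzS hc.mem hz.symm huv
      · have : z ∈ outerNbrs G S u := mem_outerNbrs.2 ⟨hz.symm, hzS⟩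
        rw [hX, mem_insert, mem_singleton] at this
        rcases this with rfl | rfl
        · exact Or.inr (Or.inr (Or.inl (mem_remoteNbrs.1 hrx).1))
        · exact Or.inr (Or.inr (Or.inr ⟨s, hs, hsu, hsv, hbs⟩))
    · by_cases hzS : z ∈ S
      · obtain rfl := h.1.eq hc.mem hzS hx.mem hz.symm huv.symm
        exact Or.inr (Or.inl hx.adj.symm)
      · have : z ∈ outerNbrs G S v := mem_outerNbrs.2 ⟨hz.symm, hzS⟩
        rw [hY, mem_insert, mem_singleton] at this
        rcases this with rfl | rfl
        · exact Or.inr (Or.inr (Or.inl hcr))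
        · exact Or.inr (Or.inr (Or.inl hdr))

/-- All three of a private vertex with two remote neighbours, and the two private vertices
opposite to it. -/
lemma LocalOpt.no_double_of_two_opposite (hX : outerNbrs G S u = {x, b})
    (hY : outerNbrs G S v = {c, d}) (hxb : x ≠ b) (hcd : c ≠ d)
    (hx : Private G S u x) (hc : Private G S v c)
    (hd' : Private G S v d) {r r' : V} (hr : r ≠ r') (hRx : remoteNbrs G S x = {r, r'}) :
    False := by
  by_cases hb : nbrCount G S b = 1
  · have pb : Private G S u b := private_of_mem_outerNbrs hx.mem (by rw [hX]; simp) hb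
    have hrx : r ∈ remoteNbrs G S x := by rw [hRx]; simp
    obtain ⟨hcr, -, hRc⟩ := h.double_opposite hd huv hx hc hr hRx
    have hdr := (h.double_opposite hd huv hx hd' hr hRx).1
    have hbr := (h.double_opposite hd huv.symm hc pb hr hRc).1
    have hxc := hx.ne_private huv.ne hc
    have hxd := hx.ne_private huv.ne hd'
    -- The vertex `r` would have the four neighbours `x`, `c`, `d`, `b`.
    rcases eq_of_adj_of_degree_le_three (hd r) (mem_remoteNbrs.1 hrx).1.symm hcr.symm hdr.symm
      hxc hxd hcd hbr.symm with e | e | e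
    · exact hxb e.symm
    · exact pb.ne_private huv.ne hc e
    · exact pb.ne_private huv.ne hd' e
  · exact h.no_triple_double hd huv hdeg hX hY hx hb hc hd' hr hRx

/-- If both vertices at one end have a large share, then those at the other end are cheap. -/
lemma LocalOpt.opposite_of_large (hX : outerNbrs G S u = {x, b})
    (hY : outerNbrs G S v = {c, d}) (hxb : x ≠ b) (hcd : c ≠ d)
    (hx : Private G S u x) (hc : Private G S v c) (hd' : Private G S v d)
    (hc16 : share G S c = 16) (hd16 : share G S d = 16) :
    remoteNbrs G S x = ∅ ∧ share G S x = 12 := by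
  have hu := hx.mem
  have hv := hc.mem
  have hnd : ∀ r r', r ≠ r' → remoteNbrs G S x ≠ {r, r'} := fun r r' hr hRx =>
    h.no_double_of_two_opposite hd huv hdeg hX hY hxb hcd hx hc hd' hr hRx
  rcases h.private_weights_of_six hd hu hv huv hdeg (Or.inl hx) with
    k | ⟨r, hR, -⟩ | ⟨r, hR, -⟩ | ⟨r, r', hr, hR, -⟩
  · exact ⟨k.2.2.2, k.2.1⟩
  all_goals exfalso
  rotate_left 2
  · exact hnd r r' hr hR
  all_goals
    -- What remains is that `x` has a single remote neighbour. If `c` or `d` had two, so would `x`;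
    -- if each has one, the three agree in a closed vertex, and `c` would have share 12.
    rcases h.private_weights_of_six hd hu hv huv hdeg (Or.inr hc) with
      k | ⟨r₁, -, -, k, -⟩ | ⟨r₁, hR₁, hcl, -⟩ | ⟨r₁, r₁', hr₁, hR₁, -⟩
    · omega
    · omega
    · rcases h.private_weights_of_six hd hu hv huv hdeg (Or.inr hd') with
        k | ⟨r₂, -, -, k, -⟩ | ⟨r₂, hR₂, -⟩ | ⟨r₂, r₂', hr₂, hR₂, -⟩
      · omega
      · omega
      · have := h.closed_of_three hd hu hv huv hdeg (Or.inl hx) (Or.inr hc) (Or.inr hd')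
          (hx.ne_private huv.ne hc) (hx.ne_private huv.ne hd') hcd hR hR₁ hR₂
        exact hcl (this.1 ▸ this.2.2)
      · exact hnd _ _ hr₂ (h.double_opposite hd huv.symm hd' hx hr₂ hR₂).2.2
    · exact hnd _ _ hr₁ (h.double_opposite hd huv.symm hc hx hr₁ hR₁).2.2

/-- Without remote neighbours, `x` must be adjacent to both `c` and `d`. Swapping `uv` for `xc` then
covers `r` and creates no new remote vertex: `x` or `c` covers `u`, `v`, `x`, `c`, `d`, and `b` has
another neighbour in `S`. -/
lemma LocalOpt.no_swap_of_shared (hX : outerNbrs G S u = {x, b})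
    (hY : outerNbrs G S v = {c, d}) (hcd : c ≠ d)
    (hx : Private G S u x) (hRx : remoteNbrs G S x = ∅) (hb : nbrCount G S b ≠ 1)
    (hc : Private G S v c) (hd' : Private G S v d) {r r' : V} (hRc : r ∈ remoteNbrs G S c)
    (hRd : r' ∈ remoteNbrs G S d) : False := by
  have hu := hx.mem
  have hv := hc.mem
  have hnr : ∀ q, nbrCount G S q = 0 → ¬ G.Adj x q := fun q h0 hq => by
    have : q ∈ remoteNbrs G S x := mem_remoteNbrs.2 ⟨hq, h0⟩
    rw [hRx] at this
    simp at this
  obtain ⟨hcr, hr0⟩ := mem_remoteNbrs.1 hRc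
  have hxc : G.Adj x c := (h.opposite huv.symm hc hRc hx).resolve_right (hnr r hr0)
  have hxd : G.Adj x d := (h.opposite huv.symm hd' hRd hx).resolve_right
    (hnr r' (mem_remoteNbrs.1 hRd).2)
  obtain ⟨s, hs, hsu, hsv, hbs⟩ := exists_other_of_not_private hu hY
    (b := b) (by rw [hX]; simp) hb (fun e => hb (e ▸ hc.count)) (fun e => hb (e ▸ hd'.count))
  refine h.no_swap hu hv huv hx.free hc.free' hxc (by have := hd x; have := hd c; omega)
    (D := {r}) (W := ∅) ?_ (by simp) ?_
  · intro q hq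
    rw [mem_singleton] at hq
    subst hq
    exact ⟨hr0, Or.inr hcr.symm⟩
  · rintro z (hz | hz)
    · by_cases hzS : z ∈ S
      · obtain rfl := h.1.eq hu hzS hv hz.symm huv
        exact Or.inr (Or.inr (Or.inl hc.adj.symm))
      · have : z ∈ outerNbrs G S u := mem_outerNbrs.2 ⟨hz.symm, hzS⟩
        rw [hX, mem_insert, mem_singleton] at this
        rcases this with rfl | rfl
        · exact Or.inr (Or.inr (Or.inl hxc))
        · exact Or.inr (Or.inr (Or.inr ⟨s, hs, hsu, hsv, hbs⟩))
    · by_cases hzS : z ∈ S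
      · obtain rfl := h.1.eq hv hzS hu hz.symm huv.symm
        exact Or.inr (Or.inl hx.adj.symm)
      · have : z ∈ outerNbrs G S v := mem_outerNbrs.2 ⟨hz.symm, hzS⟩
        rw [hY, mem_insert, mem_singleton] at this
        rcases this with rfl | rfl
        · exact Or.inr (Or.inl hxc.symm)
        · exact Or.inr (Or.inl hxd.symm)

end Local

end SubcubicMatching

/-! ### The estimate for degree sum six, and the bound for all matching edges -/

namespace SubcubicMatching

open Finset

variable {V : Type*} [Fintype V] [DecidableEq V] {G : SimpleGraph V} [DecidableRel G.Adj]
  {S : Finset V}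

lemma LocalOpt.share_eq_or (h : LocalOpt G S) (hd : ∀ v, G.degree v ≤ 3) {u v x : V}
    (hu : u ∈ S) (hv : v ∈ S) (huv : G.Adj u v) (hdeg : G.degree u + G.degree v = 6)
    (hx : x ∈ outerNbrs G S u) :
    (share G S x = 12 ∧ share G S x ≤ 6 + toMatched G S x) ∨
      (Private G S u x ∧ share G S x = 16 ∧ (remoteNbrs G S x).Nonempty ∧
        share G S x ≤ 8 + toMatched G S x) := by
  rcases share_cases h.1 hd hu hx with ⟨px, -⟩ | ⟨-, kx⟩
  · rcases h.private_weights_of_six hd hu hv huv hdeg (Or.inl px) with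
      k | ⟨r, -, -, k⟩ | ⟨r, hR, -, k⟩ | ⟨r, r', -, hR, k⟩
    · exact Or.inl (by omega)
    · exact Or.inl (by omega)
    · exact Or.inr ⟨px, k.1, by rw [hR]; simp, by omega⟩
    · exact Or.inr ⟨px, k.1, by rw [hR]; simp, by omega⟩
  · exact Or.inl (by omega)

/-- The requirement of the edge between `u` and its private neighbour `x`. -/
lemma LocalOpt.need_le_of_degree_eq_six (h : LocalOpt G S) (hd : ∀ v, G.degree v ≤ 3)
    {u v x b c d : V} (hv : v ∈ S) (huv : G.Adj u v) (hdeg : G.degree u + G.degree v = 6)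
    (hX : outerNbrs G S u = {x, b}) (hY : outerNbrs G S v = {c, d}) (hxb : x ≠ b) (hcd : c ≠ d)
    (hx : Private G S u x) :
    share G S b + share G S c + share G S d ≤ 32 + toMatched G S b := by
  have hu := hx.mem
  have hb : b ∈ outerNbrs G S u := by rw [hX]; simp
  have hc : c ∈ outerNbrs G S v := by rw [hY]; simp
  have hd' : d ∈ outerNbrs G S v := by rw [hY]; simp
  have hdeg' : G.degree v + G.degree u = 6 := by omega
  -- one large share opposite to `b`
  have key : ∀ c d, outerNbrs G S v = {c, d} → c ≠ d → Private G S v c → share G S c = 16 →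
      share G S b ≤ 4 + toMatched G S b := by
    intro c d hY hcd pc hc16
    rcases share_cases h.1 hd hu hb with ⟨pb, -⟩ | ⟨-, kb⟩
    · have hnd : ∀ r r', r ≠ r' → remoteNbrs G S c ≠ {r, r'} := fun r r' hr hR =>
        h.no_double_of_two_opposite hd huv.symm hdeg' hY hX hcd hxb pc hx pb hr hR
      rcases h.private_weights_of_six hd hu hv huv hdeg (Or.inl pb) with
        k | ⟨r, hR, hcl, -⟩ | ⟨r, hR, -, k⟩ | ⟨r, r', hr, hR, k⟩
      · omega
      · exfalso
        rcases h.private_weights_of_six hd hu hv huv hdeg (Or.inr pc) with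
          k | ⟨r₁, -, -, k, -⟩ | ⟨r₁, hR₁, hcl₁, -⟩ | ⟨r₁, r₁', hr₁, hR₁, -⟩
        · omega
        · omega
        · exact h.no_closed_and_not_closed hd hu hv huv hdeg pb pc hR hcl hR₁ hcl₁
        · exact hnd _ _ hr₁ hR₁
      · omega
      · exact absurd (h.double_opposite hd huv pb pc hr hR).2.2 (hnd _ _ hr)
    · omega
  have kb := h.share_eq_or hd hu hv huv hdeg hb
  rcases h.share_eq_or hd hv hu huv.symm hdeg' hc with kc | ⟨pc, hc16, hcR, kc⟩ <;>
    rcases h.share_eq_or hd hv hu huv.symm hdeg' hd' with kd | ⟨pd, hd16, hdR, kd⟩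
  · omega
  · have := key d c (by rw [hY, pair_comm]) hcd.symm pd hd16
    rcases kb with kb | ⟨-, kb, -⟩ <;> omega
  · have := key c d hY hcd pc hc16
    rcases kb with kb | ⟨-, kb, -⟩ <;> omega
  · have hRx := (h.opposite_of_large hd huv hdeg hX hY hxb hcd hx pc pd hc16 hd16).1
    rcases share_cases h.1 hd hu hb with ⟨pb, -⟩ | ⟨nb, -⟩
    · have := h.opposite_of_large hd huv hdeg (by rw [hX, pair_comm]) hY hxb.symm hcd pb pc pd
        hc16 hd16
      have := weights_of_remoteNbrs_empty pb.count this.1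
      omega
    · obtain ⟨r, hr⟩ := hcR
      obtain ⟨r', hr'⟩ := hdR
      exact (h.no_swap_of_shared hd huv hdeg hX hY hcd hx hRx nb pc pd hr hr').elim

lemma LocalOpt.matchingCost_le_of_degree_eq_six (h : LocalOpt G S) (hd : ∀ v, G.degree v ≤ 3)
    {u v : V} (hu : u ∈ S) (hv : v ∈ S) (huv : G.Adj u v)
    (hdeg : G.degree u + G.degree v = 6) :
    matchingWeight G S u v +
      ∑ x ∈ outerNbrs G S u, share G S x + ∑ x ∈ outerNbrs G S v, share G S x ≤ 56 := by
  have hcu := card_outerNbrs h.1 hu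
  have hcv := card_outerNbrs h.1 hv
  have := hd u
  have := hd v
  have hdeg' : G.degree v + G.degree u = 6 := by omega
  obtain ⟨x, b, hxb, hX⟩ := card_eq_two.1 (by omega : #(outerNbrs G S u) = 2)
  obtain ⟨c, d, hcd, hY⟩ := card_eq_two.1 (by omega : #(outerNbrs G S v) = 2)
  have hX' : outerNbrs G S u = {b, x} := by rw [hX, pair_comm]
  have hY' : outerNbrs G S v = {d, c} := by rw [hY, pair_comm]
  have mx : x ∈ outerNbrs G S u := by rw [hX]; simp
  have mb : b ∈ outerNbrs G S u := by rw [hX]; simp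
  have mc : c ∈ outerNbrs G S v := by rw [hY]; simp
  have md : d ∈ outerNbrs G S v := by rw [hY]; simp
  have kx := h.share_eq_or hd hu hv huv hdeg mx
  have kb := h.share_eq_or hd hu hv huv hdeg mb
  have kc := h.share_eq_or hd hv hu huv.symm hdeg' mc
  have kd := h.share_eq_or hd hv hu huv.symm hdeg' md
  -- Each share is 12 or 16, so the claim is that at most two of the four are 16. Three of them
  -- would include both at one end and one at the other.
  have htotal : share G S x + share G S b + (share G S c + share G S d) ≤ 56 := by
    have three : ∀ {u v x b c d : V}, G.Adj u v → G.degree u + G.degree v = 6 →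
        outerNbrs G S u = {x, b} → outerNbrs G S v = {c, d} → x ≠ b → c ≠ d →
        Private G S u x → share G S x = 16 → Private G S v c → Private G S v d →
        share G S c = 16 → share G S d = 16 → False := by
      intro u v x b c d huv hdeg hX hY hxb hcd px ex pc pd ec ed
      have := (h.opposite_of_large hd huv hdeg hX hY hxb hcd px pc pd ec ed).2
      omega
    rcases kx with kx | ⟨px, ex, -⟩ <;> rcases kb with kb | ⟨pb, eb, -⟩ <;>
      rcases kc with kc | ⟨pc, ec, -⟩ <;> rcases kd with kd | ⟨pd, ed, -⟩ <;> try omega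
    · exact (three huv hdeg hX' hY hxb.symm hcd pb eb pc pd ec ed).elim
    · exact (three huv hdeg hX hY hxb hcd px ex pc pd ec ed).elim
    · exact (three huv.symm hdeg' hY' hX hcd.symm hxb pd ed px pb ex eb).elim
    · exact (three huv.symm hdeg' hY hX hcd hxb pc ec px pb ex eb).elim
    · exact (three huv hdeg hX hY hxb hcd px ex pc pd ec ed).elim
  have nx : nbrCount G S x = 1 → _ := fun hk =>
    h.need_le_of_degree_eq_six hd hv huv hdeg hX hY hxb hcd (private_of_mem_outerNbrs hu mx hk)
  have nb : nbrCount G S b = 1 → _ := fun hk =>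
    h.need_le_of_degree_eq_six hd hv huv hdeg hX' hY hxb.symm hcd
      (private_of_mem_outerNbrs hu mb hk)
  have nc : nbrCount G S c = 1 → _ := fun hk =>
    h.need_le_of_degree_eq_six hd hu huv.symm hdeg' hY hX hcd hxb
      (private_of_mem_outerNbrs hv mc hk)
  have nd : nbrCount G S d = 1 → _ := fun hk =>
    h.need_le_of_degree_eq_six hd hu huv.symm hdeg' hY' hX hcd.symm hxb
      (private_of_mem_outerNbrs hv md hk)
  have ex : nbrCount G S x = 1 → share G S x = _ := fun hk => if_pos hk
  have eb : nbrCount G S b = 1 → share G S b = _ := fun hk => if_pos hk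
  have ec : nbrCount G S c = 1 → share G S c = _ := fun hk => if_pos hk
  have ed : nbrCount G S d = 1 → share G S d = _ := fun hk => if_pos hk
  have lx : share G S x ≤ 8 + toMatched G S x := by
    rcases kx with kx | ⟨-, -, -, kx⟩ <;> omega
  have lb : share G S b ≤ 8 + toMatched G S b := by
    rcases kb with kb | ⟨-, -, -, kb⟩ <;> omega
  have lc : share G S c ≤ 8 + toMatched G S c := by
    rcases kc with kc | ⟨-, -, -, kc⟩ <;> omega
  have ld : share G S d ≤ 8 + toMatched G S d := by
    rcases kd with kd | ⟨-, -, -, kd⟩ <;> omega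
  clear kx kb kc kd
  apply matchingCost_le <;> simp only [matchedLoad, hX, hY, sum_pair hxb, sum_pair hcd,
    mem_insert, mem_singleton, forall_eq_or_imp, forall_eq]
  · exact htotal
  · omega
  · refine ⟨fun hk => ?_, fun hk => ?_⟩
    · have := nx hk; have := ex hk; omega
    · have := nb hk; have := eb hk; omega
  · refine ⟨fun hk => ?_, fun hk => ?_⟩
    · have := nc hk; have := ec hk; omega
    · have := nd hk; have := ed hk; omega

/-- The weight charged to a matching edge is at most `56/24`. -/
theorem LocalOpt.matchingCost_le (h : LocalOpt G S) (hd : ∀ v, G.degree v ≤ 3)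
    {u v : V} (hu : u ∈ S) (hv : v ∈ S) (huv : G.Adj u v) :
    matchingWeight G S u v +
      ∑ x ∈ outerNbrs G S u, share G S x + ∑ x ∈ outerNbrs G S v, share G S x ≤ 56 := by
  have := hd u
  have := hd v
  by_cases h4 : G.degree u + G.degree v ≤ 4
  · exact h.matchingCost_le_of_degree_le_four hd hu hv huv h4
  by_cases h6 : G.degree u + G.degree v = 6
  · exact h.matchingCost_le_of_degree_eq_six hd hu hv huv h6
  rcases (by omega : (G.degree u = 2 ∧ G.degree v = 3) ∨ (G.degree v = 2 ∧ G.degree u = 3)) with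
    ⟨h2, h3⟩ | ⟨h2, h3⟩
  · exact h.matchingCost_le_of_degree_eq_five hd hu hv huv h2 h3
  · exact matchingCost_comm_le (h.matchingCost_le_of_degree_eq_five hd hv hu huv.symm h2 h3)

/-- The total weight of the edges, each counted twice, is at most `56/24` per matching edge. -/
theorem LocalOpt.sum_vertexWeight_le_card (h : LocalOpt G S) (hd : ∀ v, G.degree v ≤ 3) :
    ∑ u, vertexWeight G S u ≤ 56 * #S :=
  h.sum_vertexWeight_le hd fun _ hu _ hv huv => h.matchingCost_le hd hu hv huv

end SubcubicMatching

namespace SubcubicMatching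

open Finset InducedMatching

variable {V : Type*} [Fintype V] [DecidableEq V] {G : SimpleGraph V} [DecidableRel G.Adj]
  {S : Finset V}

/-! ### The induced matching and the dual solution of a local optimum -/

variable (G S) in
/-- The edges of `G` within `S`. -/
def edgesWithin : Finset (Sym2 V) := {e ∈ G.edgeFinset | ∀ v ∈ e, v ∈ S}

variable (G S) in
/-- The dual solution. -/
noncomputable def dualValue (e : Sym2 V) : ℝ :=
  Sym2.lift ⟨fun u v => (edgeWeight G S u v : ℝ) / 24,
    fun u v => by simp only [edgeWeight_comm G S u v]⟩ e

lemma dualValue_mk (u v : V) : dualValue G S s(u, v) = (edgeWeight G S u v : ℝ) / 24 := rfl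

lemma mem_edgesWithin {u v : V} : s(u, v) ∈ edgesWithin G S ↔ G.Adj u v ∧ u ∈ S ∧ v ∈ S := by
  simp [edgesWithin]

lemma dualValue_nonneg (e : Sym2 V) : 0 ≤ dualValue G S e := by
  induction e with
  | _ u v => rw [dualValue_mk]; positivity

lemma sum_incidenceFinset (F : Sym2 V → ℝ) (u : V) :
    ∑ e ∈ G.incidenceFinset u, F e = ∑ z ∈ G.neighborFinset u, F s(u, z) := by
  symm
  apply sum_bij (fun z _ => s(u, z))
  · intro z hz
    simpa [SimpleGraph.mem_incidenceFinset, SimpleGraph.incidenceSet] using hz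
  · intro a _ b _ hab
    exact Sym2.congr_right.1 hab
  · intro e he
    rw [SimpleGraph.mem_incidenceFinset] at he
    obtain ⟨h1, h2⟩ := he
    obtain ⟨z, rfl⟩ := Sym2.mem_iff_exists.1 h2
    exact ⟨z, by simpa using h1, rfl⟩
  · intro _ _
    rfl

lemma sum_sum_neighborFinset (F : Sym2 V → ℝ) :
    ∑ u, ∑ z ∈ G.neighborFinset u, F s(u, z) = 2 * ∑ e ∈ G.edgeFinset, F e := by
  have h1 : ∀ u, ∑ z ∈ G.neighborFinset u, F s(u, z) =
      ∑ e ∈ G.edgeFinset, if u ∈ e then F e else 0 := by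
    intro u
    rw [← sum_incidenceFinset, ← sum_filter]
    apply sum_congr _ fun _ _ => rfl
    ext e
    simp [SimpleGraph.mem_incidenceFinset, SimpleGraph.incidenceSet]
  simp_rw [h1]
  rw [sum_comm, mul_sum]
  apply sum_congr rfl
  intro e he
  have h2 : ({u | u ∈ e} : Finset V) = e.toFinset := by ext; simp
  rw [← sum_filter, sum_const, h2,
    Sym2.card_toFinset_of_not_isDiag e (G.not_isDiag_of_mem_edgeSet (by simpa using he))]
  simp

lemma Good.two_mul_card_edgesWithin (h : Good G S) : 2 * #(edgesWithin G S) = #S := by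
  have h1 := sum_sum_neighborFinset (G := G) fun e => if ∀ v ∈ e, v ∈ S then 1 else 0
  rw [← sum_filter, sum_const, nsmul_eq_mul, mul_one] at h1
  have h2 : ∀ u, (∑ z ∈ G.neighborFinset u, if ∀ v ∈ s(u, z), v ∈ S then (1 : ℝ) else 0) =
      if u ∈ S then 1 else 0 := by
    intro u
    by_cases hu : u ∈ S
    · have := h u hu
      simp only [Sym2.mem_iff, forall_eq_or_imp, forall_eq, hu, true_and, if_true]
      rw [← sum_filter, sum_const, ← nbrCount, this]
      simp
    · simp [hu]
  simp_rw [h2] at h1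
  rw [← sum_filter, sum_const, nsmul_eq_mul, mul_one, filter_mem_eq_inter, univ_inter] at h1
  unfold edgesWithin
  exact_mod_cast h1.symm

lemma Good.isInducedMatching (h : Good G S) : IsInducedMatching G (edgesWithin G S) := by
  refine ⟨fun e he => by simpa using (mem_filter.1 he).1, ?_⟩
  intro e he f hf hef u hu v hv
  obtain ⟨u', rfl⟩ := Sym2.mem_iff_exists.1 hu
  obtain ⟨v', rfl⟩ := Sym2.mem_iff_exists.1 hv
  rw [mem_edgesWithin] at he hf
  constructor
  · rintro rfl
    exact hef (by rw [h.eq he.2.1 he.2.2 hf.2.2 he.1 hf.1])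
  · intro huv
    obtain rfl := h.eq he.2.1 he.2.2 hf.2.1 he.1 huv
    obtain rfl := h.eq hf.2.1 he.2.1 hf.2.2 he.1.symm hf.1
    exact hef Sym2.eq_swap

/-- The edge `uv` is the only one incident with both ends, so adding it once more gives the full
sums at `u` and at `v`. -/
lemma sum_edgeDelta (F : Sym2 V → ℝ) {u v : V} (huv : G.Adj u v) :
    ∑ f ∈ edgeDelta G s(u, v), F f + F s(u, v) =
      ∑ z ∈ G.neighborFinset u, F s(u, z) + ∑ z ∈ G.neighborFinset v, F s(v, z) := by
  have h1 : edgeDelta G s(u, v) = G.incidenceFinset u ∪ G.incidenceFinset v := by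
    ext e; simp [edgeDelta, Sym2.mem_toFinset]
  have h2 : G.incidenceFinset u ∩ G.incidenceFinset v = {s(u, v)} := by
    ext e
    have := G.incidenceSet_inter_incidenceSet_of_adj huv
    have := congrArg (e ∈ ·) this
    simpa [SimpleGraph.mem_incidenceFinset] using this
  rw [← sum_incidenceFinset, ← sum_incidenceFinset, ← sum_union_inter, ← h1, h2, sum_singleton]

lemma sum_neighborFinset_dualValue (u : V) :
    ∑ z ∈ G.neighborFinset u, dualValue G S s(u, z) = (vertexWeight G S u : ℝ) / 24 := by
  simp_rw [dualValue_mk]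
  rw [← sum_div, vertexWeight, Nat.cast_sum]

lemma LocalOpt.isDualFeasible (h : LocalOpt G S) (hd : ∀ v, G.degree v ≤ 3) :
    IsDualFeasible G (dualValue G S) := by
  intro e he
  refine ⟨?_, dualValue_nonneg e⟩
  induction e with
  | _ u v =>
    have huv : G.Adj u v := by simpa using he
    have h1 := sum_edgeDelta (dualValue G S) huv
    rw [sum_neighborFinset_dualValue, sum_neighborFinset_dualValue, dualValue_mk] at h1
    have h2 : (24 : ℝ) + edgeWeight G S u v ≤ vertexWeight G S u + vertexWeight G S v := by
      exact_mod_cast h.edgeWeight_feasible hd huv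
    linarith

lemma LocalOpt.sum_dualValue_le (h : LocalOpt G S) (hd : ∀ v, G.degree v ≤ 3) :
    ∑ e ∈ G.edgeFinset, dualValue G S e ≤ 7 / 3 * (#(edgesWithin G S) : ℝ) := by
  have h1 := sum_sum_neighborFinset (G := G) (dualValue G S)
  simp_rw [sum_neighborFinset_dualValue] at h1
  rw [← sum_div, ← Nat.cast_sum] at h1
  have h2 : ((∑ u, vertexWeight G S u : ℕ) : ℝ) ≤ 56 * (2 * #(edgesWithin G S)) := by
    have := h.sum_vertexWeight_le_card hd
    rw [← h.1.two_mul_card_edgesWithin] at this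
    exact_mod_cast this
  linarith

/-- Weak duality. -/
lemma card_le_sum_of_isDualFeasible {M : Finset (Sym2 V)} (hM : IsInducedMatching G M)
    {y : Sym2 V → ℝ} (hy : IsDualFeasible G y) : (#M : ℝ) ≤ ∑ e ∈ G.edgeFinset, y e := by
  have hMe : ∀ e ∈ M, e ∈ G.edgeFinset := fun e he => by simpa using hM.1 e he
  -- An edge in two of these sets would make two matching edges share a vertex or be joined.
  have hdisj : (M : Set (Sym2 V)).PairwiseDisjoint (edgeDelta G) := by
    intro e he f hf hef
    rw [Function.onFun, disjoint_left]
    intro g hg hg'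
    simp only [edgeDelta, mem_biUnion, Sym2.mem_toFinset, SimpleGraph.mem_incidenceFinset] at hg hg'
    obtain ⟨u, hu, hgu⟩ := hg
    obtain ⟨v, hv, hgv⟩ := hg'
    obtain ⟨h1, h2⟩ := hM.2 e he f hf hef u hu v hv
    obtain ⟨w, rfl⟩ := Sym2.mem_iff_exists.1 hgu.2
    rcases Sym2.mem_iff.1 hgv.2 with rfl | rfl
    · exact h1 rfl
    · exact h2 (by simpa using hgu.1)
  calc (#M : ℝ) = ∑ e ∈ M, 1 := by simp
    _ ≤ ∑ e ∈ M, ∑ f ∈ edgeDelta G e, y f := sum_le_sum fun e he => (hy e (hMe e he)).1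
    _ = ∑ f ∈ M.biUnion (edgeDelta G), y f := (sum_biUnion hdisj).symm
    _ ≤ ∑ e ∈ G.edgeFinset, y e := by
      apply sum_le_sum_of_subset_of_nonneg
      · intro f hf
        simp only [edgeDelta, mem_biUnion, SimpleGraph.mem_incidenceFinset] at hf
        obtain ⟨_, _, _, _, hf⟩ := hf
        simpa using hf.1
      · exact fun e he _ => (hy e he).2

lemma inducedMatchingNumber_le {y : Sym2 V → ℝ} (hy : IsDualFeasible G y) :
    (inducedMatchingNumber G : ℝ) ≤ ∑ e ∈ G.edgeFinset, y e := by
  have hmem : inducedMatchingNumber G ∈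
      {k : ℕ | ∃ M : Finset (Sym2 V), IsInducedMatching G M ∧ M.card = k} := by
    apply Nat.sSup_mem
    · exact ⟨0, ∅, ⟨by simp, by simp⟩, rfl⟩
    · exact ⟨#(univ : Finset (Sym2 V)), by rintro _ ⟨M, -, rfl⟩; exact card_le_card (subset_univ M)⟩
  obtain ⟨M, hM, hMk⟩ := hmem
  rw [← hMk]
  exact card_le_sum_of_isDualFeasible hM hy

end SubcubicMatching

namespace RAM

/-! ### A small language with bounded loops, compiled to the random access machine -/

/-- Terms with bounded sums and suprema over `0, …, n - 1`, where `n` is the content of the variable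
`x₀` of the machine. The bound variables are named by natural numbers. -/
inductive Term where
  | lit (c : ℕ)
  | var (i : ℕ)
  | entry (k : ℕ) (a b : Term)
  | add (a b : Term)
  | sub (a b : Term)
  | ite (c a b : Term)
  | sum (i : ℕ) (a : Term)
  | sup (i : ℕ) (a : Term)

/-- Statements with bounded loops. -/
inductive Stmt where
  | store (k : ℕ) (a b c : Term)
  | seq (p q : Stmt)
  | ite (c : Term) (p : Stmt)
  | loop (i : ℕ) (p : Stmt)

abbrev Tables := ℕ → ℕ → ℕ → ℕ

namespace Term

def eval (n : ℕ) (T : Tables) : Term → (ℕ → ℕ) → ℕ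
  | lit c, _ => c
  | var i, env => env i
  | entry k a b, env => T k (a.eval n T env) (b.eval n T env)
  | add a b, env => a.eval n T env + b.eval n T env
  | sub a b, env => a.eval n T env - b.eval n T env
  | ite c a b, env => if c.eval n T env ≠ 0 then a.eval n T env else b.eval n T env
  | sum i a, env => ∑ j ∈ Finset.range n, a.eval n T (Function.update env i j)
  | sup i a, env => (Finset.range n).sup fun j => a.eval n T (Function.update env i j)

/-- The program which stores the value of a term in `x_d`, using only variables from `x_d` on. The
bound variable `i` of the term is found in `x_{ρ i}`. -/
def compile : Term → (ℕ → ℕ) → ℕ → Program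
  | lit c, _, d => .assign d (.lit c)
  | var i, ρ, d => .assign d (.var (ρ i))
  | entry k a b, ρ, d => .seq (a.compile ρ d) (.seq (b.compile ρ (d + 1))
      (.assign d (.entry k (.var d) (.var (d + 1)))))
  | add a b, ρ, d => .seq (a.compile ρ d) (.seq (b.compile ρ (d + 1))
      (.assign d (.add (.var d) (.var (d + 1)))))
  | sub a b, ρ, d => .seq (a.compile ρ d) (.seq (b.compile ρ (d + 1))
      (.assign d (.sub (.var d) (.var (d + 1)))))
  | ite c a b, ρ, d => .seq (c.compile ρ d) (.ite (.var d) (a.compile ρ d) (b.compile ρ d))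
  | sum i a, ρ, d => .seq (.assign d (.lit 0)) (.seq (.assign (d + 1) (.lit 0))
      (.while (.sub (.var 0) (.var (d + 1)))
        (.seq (a.compile (Function.update ρ i (d + 1)) (d + 2))
          (.seq (.assign d (.add (.var d) (.var (d + 2))))
            (.assign (d + 1) (.add (.var (d + 1)) (.lit 1)))))))
  | sup i a, ρ, d => .seq (.assign d (.lit 0)) (.seq (.assign (d + 1) (.lit 0))
      (.while (.sub (.var 0) (.var (d + 1)))
        (.seq (a.compile (Function.update ρ i (d + 1)) (d + 2))
          (.seq (.assign d (.add (.var d) (.sub (.var (d + 2)) (.var d))))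
            (.assign (d + 1) (.add (.var (d + 1)) (.lit 1)))))))

end Term

/-! ### Correctness and polynomial running time of compiled terms and statements -/

lemma runs_while {n c : ℕ} {body : Program} {B : ℕ} (Inv : ℕ → Memory → Prop)
    (hbody : ∀ j < n, ∀ s, Inv j s → s.var 0 = n → s.var c = j →
      ∃ s' t, Runs body s s' t ∧ t ≤ B ∧ Inv (j + 1) s' ∧ s'.var 0 = n ∧ s'.var c = j + 1)
    (s : Memory) (h0 : Inv 0 s) (hn : s.var 0 = n) (hc : s.var c = 0) :
    ∃ s' t, Runs (.while (.sub (.var 0) (.var c)) body) s s' t ∧ t ≤ n * (B + 4) + 4 ∧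
      Inv n s' ∧ s'.var 0 = n := by
  have key : ∀ m j s, j + m = n → Inv j s → s.var 0 = n → s.var c = j →
      ∃ s' t, Runs (.while (.sub (.var 0) (.var c)) body) s s' t ∧ t ≤ m * (B + 4) + 4 ∧
        Inv n s' ∧ s'.var 0 = n := by
    intro m
    induction m with
    | zero =>
      intro j s hj hi h0 hc
      refine ⟨s, _, Runs.while_false ?_, ?_, ?_, h0⟩
      · simp only [Expr.eval]; omega
      · simp [Expr.cost]
      · rwa [← hj, add_zero]
    | succ m ih =>
      intro j s hj hi h0 hc
      obtain ⟨s₁, t₁, r₁, b₁, i₁, n₁, c₁⟩ := hbody j (by omega) s hi h0 hc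
      obtain ⟨s₂, t₂, r₂, b₂, i₂, n₂⟩ := ih (j + 1) s₁ (by omega) i₁ n₁ c₁
      refine ⟨s₂, _, Runs.while_true ?_ r₁ r₂, ?_, i₂, n₂⟩
      · simp only [Expr.eval]; omega
      · simp only [Expr.cost]
        have : (m + 1) * (B + 4) = m * (B + 4) + (B + 4) := by ring
        omega
  exact key n 0 s (by omega) h0 hn hc

/-- Started in `s`, the program computes `val` in `x_d` within `B` steps. -/
def Computes (P : Program) (d B : ℕ) (s : Memory) (val : ℕ) : Prop :=
  ∃ s' t, Runs P s s' t ∧ t ≤ B ∧ s'.table = s.table ∧ (∀ i < d, s'.var i = s.var i) ∧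
    s'.var d = val

lemma computes_binary {P Q : Program} {d B C : ℕ} {s : Memory} {x y z : ℕ} {e : Expr}
    (hP : Computes P d B s x)
    (hQ : ∀ s' : Memory, s'.table = s.table → (∀ i < d, s'.var i = s.var i) →
      Computes Q (d + 1) C s' y)
    (he : ∀ s' : Memory, s'.table = s.table → s'.var d = x → s'.var (d + 1) = y → e.eval s' = z) :
    Computes (.seq P (.seq Q (.assign d e))) d (B + C + (e.cost + 1)) s z := by
  obtain ⟨s₁, t₁, r₁, b₁, e₁, v₁, x₁⟩ := hP
  obtain ⟨s₂, t₂, r₂, b₂, e₂, v₂, x₂⟩ := hQ s₁ e₁ v₁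
  refine ⟨_, _, r₁.seq (r₂.seq (Runs.assign d e s₂)), by omega, ?_, ?_, ?_⟩
  · simp [Memory.setVar, e₂, e₁]
  · intro i hi
    simp only [Memory.setVar, Function.update_of_ne hi.ne]
    rw [v₂ i (by omega), v₁ i hi]
  · simp only [Memory.setVar, Function.update_self]
    exact he s₂ (e₂.trans e₁) ((v₂ d (by omega)).trans x₁) x₂

/-- Sums and suprema are the same loop with different accumulation steps `e`: accumulator in `x_d`,
counter in `x_(d+1)`, current value in `x_(d+2)`. Each round pays 4 for the test and `e.cost + 5`
for the two assignments. -/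
lemma computes_fold {P : Program} {d B n : ℕ} {s : Memory} {e : Expr} (f : ℕ → ℕ → ℕ)
    (g : ℕ → ℕ) (hd : 0 < d) (hn : s.var 0 = n)
    (hP : ∀ j < n, ∀ s' : Memory, s'.table = s.table → (∀ i < d, s'.var i = s.var i) →
      s'.var (d + 1) = j → Computes P (d + 2) B s' (g j))
    (he : ∀ s' : Memory, e.eval s' = f (s'.var d) (s'.var (d + 2))) :
    Computes (.seq (.assign d (.lit 0)) (.seq (.assign (d + 1) (.lit 0))
      (.while (.sub (.var 0) (.var (d + 1)))
        (.seq P (.seq (.assign d e) (.assign (d + 1) (.add (.var (d + 1)) (.lit 1)))))))) d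
      (n * (B + e.cost + 9) + 8) s (Nat.rec 0 (fun j x => f x (g j)) n) := by
  let F : ℕ → ℕ := fun m => Nat.rec 0 (fun j x => f x (g j)) m
  obtain ⟨s', t, r, b, ⟨i1, i2, i3⟩, -⟩ := runs_while (n := n) (c := d + 1)
    (B := B + e.cost + 5)
    (body := .seq P (.seq (.assign d e) (.assign (d + 1) (.add (.var (d + 1)) (.lit 1)))))
    (fun j s' => s'.table = s.table ∧ (∀ i < d, s'.var i = s.var i) ∧ s'.var d = F j) (by
      rintro j hj s' ⟨h1, h2, h3⟩ h4 h5
      obtain ⟨s₁, t₁, r₁, b₁, e₁, v₁, x₁⟩ := hP j hj s' h1 h2 h5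
      refine ⟨_, _, r₁.seq (Runs.seq (Runs.assign d e s₁) (Runs.assign _ _ _)), ?_,
        ⟨?_, ?_, ?_⟩, ?_, ?_⟩
      · simp only [Expr.cost]; omega
      · simp [Memory.setVar, e₁, h1]
      · intro i hi
        simp only [Memory.setVar]
        rw [Function.update_of_ne (by omega), Function.update_of_ne (by omega), v₁ i (by omega),
          h2 i hi]
      · simp only [Memory.setVar]
        rw [Function.update_of_ne (by omega), Function.update_self, he, v₁ d (by omega), h3, x₁]
      · simp only [Memory.setVar]
        rw [Function.update_of_ne (by omega), Function.update_of_ne (by omega), v₁ 0 (by omega), h4]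
      · simp only [Memory.setVar, Function.update_self, Expr.eval]
        rw [Function.update_of_ne (by omega), v₁ _ (by omega), h5])
    ((s.setVar d 0).setVar (d + 1) 0) ⟨rfl, by
      intro i hi
      simp only [Memory.setVar]
      rw [Function.update_of_ne (by omega), Function.update_of_ne (by omega)], by
      simp only [Memory.setVar]
      rw [Function.update_of_ne (by omega), Function.update_self]
      rfl⟩ (by
      simp only [Memory.setVar]
      rw [Function.update_of_ne (by omega), Function.update_of_ne (by omega), hn])
    (by simp [Memory.setVar])
  refine ⟨s', _, (Runs.assign d (.lit 0) s).seq ((Runs.assign (d + 1) (.lit 0) _).seq r), ?_,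
    i1, i2, i3⟩
  simp only [Expr.cost]
  have : n * (B + e.cost + 5 + 4) = n * (B + e.cost + 9) := by ring
  omega

lemma invariant_update {s s' : Memory} {ρ env : ℕ → ℕ} {i j d : ℕ} (hρ : ∀ i, ρ i < d)
    (hs : ∀ i, s.var (ρ i) = env i) (hs' : ∀ i < d, s'.var i = s.var i) {c : ℕ}
    (hj : s'.var c = j) (k : ℕ) :
    s'.var (Function.update ρ i c k) = Function.update env i j k := by
  by_cases hk : k = i
  · subst hk; simp [hj]
  · rw [Function.update_of_ne hk, Function.update_of_ne hk, hs' _ (hρ k), hs]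

/-- Bound variables live below `d` and scratch values from `d` on, so a subterm evaluated at `d + 1`
cannot destroy the value in `x_d`. The polynomial depends only on the term, and nesting a loop
multiplies by `X`. -/
theorem Term.computes_compile (e : Term) : ∃ p : Polynomial ℕ, ∀ (ρ : ℕ → ℕ) (d : ℕ) (s : Memory)
    (env : ℕ → ℕ), 0 < d → (∀ i, ρ i < d) → (∀ i, s.var (ρ i) = env i) →
    Computes (e.compile ρ d) d (p.eval (s.var 0)) s (e.eval (s.var 0) s.table env) := by
  induction e with
  | lit c =>
    refine ⟨2, fun ρ d s env hd hρ hs => ⟨_, _, Runs.assign _ _ _, ?_, rfl, ?_, ?_⟩⟩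
    · simp [Expr.cost]
    · intro i hi; simp [Memory.setVar, Function.update_of_ne hi.ne]
    · simp [Memory.setVar, Expr.eval, Term.eval]
  | var i =>
    refine ⟨2, fun ρ d s env hd hρ hs => ⟨_, _, Runs.assign _ _ _, ?_, rfl, ?_, ?_⟩⟩
    · simp [Expr.cost]
    · intro i hi; simp [Memory.setVar, Function.update_of_ne hi.ne]
    · simp [Memory.setVar, Expr.eval, Term.eval, hs]
  | entry k a b iha ihb =>
    obtain ⟨p, hp⟩ := iha
    obtain ⟨q, hq⟩ := ihb
    refine ⟨p + q + 4, fun ρ d s env hd hρ hs => ?_⟩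
    simp only [Polynomial.eval_add, Polynomial.eval_ofNat]
    refine computes_binary (e := .entry k (.var d) (.var (d + 1)))
      (y := b.eval (s.var 0) s.table env) (hp ρ d s env hd hρ hs) (fun s' h1 h2 => ?_) ?_
    · have := hq ρ (d + 1) s' env (by omega) (fun i => (hρ i).trans (by omega))
        (fun i => (h2 _ (hρ i)).trans (hs i))
      rwa [h2 0 hd, h1] at this
    · intro s' h1 h2 h3
      simp [Expr.eval, Term.eval, h1, h2, h3]
  | add a b iha ihb =>
    obtain ⟨p, hp⟩ := iha
    obtain ⟨q, hq⟩ := ihb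
    refine ⟨p + q + 4, fun ρ d s env hd hρ hs => ?_⟩
    simp only [Polynomial.eval_add, Polynomial.eval_ofNat]
    refine computes_binary (e := .add (.var d) (.var (d + 1)))
      (y := b.eval (s.var 0) s.table env) (hp ρ d s env hd hρ hs) (fun s' h1 h2 => ?_) ?_
    · have := hq ρ (d + 1) s' env (by omega) (fun i => (hρ i).trans (by omega))
        (fun i => (h2 _ (hρ i)).trans (hs i))
      rwa [h2 0 hd, h1] at this
    · intro s' h1 h2 h3
      simp [Expr.eval, Term.eval, h2, h3]
  | sub a b iha ihb =>
    obtain ⟨p, hp⟩ := iha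
    obtain ⟨q, hq⟩ := ihb
    refine ⟨p + q + 4, fun ρ d s env hd hρ hs => ?_⟩
    simp only [Polynomial.eval_add, Polynomial.eval_ofNat]
    refine computes_binary (e := .sub (.var d) (.var (d + 1)))
      (y := b.eval (s.var 0) s.table env) (hp ρ d s env hd hρ hs) (fun s' h1 h2 => ?_) ?_
    · have := hq ρ (d + 1) s' env (by omega) (fun i => (hρ i).trans (by omega))
        (fun i => (h2 _ (hρ i)).trans (hs i))
      rwa [h2 0 hd, h1] at this
    · intro s' h1 h2 h3
      simp [Expr.eval, Term.eval, h2, h3]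
  | ite c a b ihc iha ihb =>
    obtain ⟨o, ho⟩ := ihc
    obtain ⟨p, hp⟩ := iha
    obtain ⟨q, hq⟩ := ihb
    refine ⟨o + p + q + 2, fun ρ d s env hd hρ hs => ?_⟩
    simp only [Polynomial.eval_add, Polynomial.eval_ofNat]
    obtain ⟨s₁, t₁, r₁, b₁, e₁, v₁, x₁⟩ := ho ρ d s env hd hρ hs
    have hs₁ : ∀ i, s₁.var (ρ i) = env i := fun i => (v₁ _ (hρ i)).trans (hs i)
    by_cases hc : c.eval (s.var 0) s.table env = 0
    · obtain ⟨s₂, t₂, r₂, b₂, e₂, v₂, x₂⟩ := hq ρ d s₁ env hd hρ hs₁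
      refine ⟨s₂, _, r₁.seq (Runs.ite_false (by simp [Expr.eval, x₁, hc]) r₂), ?_, e₂.trans e₁,
        fun i hi => (v₂ i hi).trans (v₁ i hi), ?_⟩
      · rw [v₁ 0 hd] at b₂
        simp only [Expr.cost]; omega
      · rw [x₂, v₁ 0 hd, e₁]
        simp [Term.eval, hc]
    · obtain ⟨s₂, t₂, r₂, b₂, e₂, v₂, x₂⟩ := hp ρ d s₁ env hd hρ hs₁
      refine ⟨s₂, _, r₁.seq (Runs.ite_true (by simp [Expr.eval, x₁, hc]) r₂), ?_, e₂.trans e₁,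
        fun i hi => (v₂ i hi).trans (v₁ i hi), ?_⟩
      · rw [v₁ 0 hd] at b₂
        simp only [Expr.cost]; omega
      · rw [x₂, v₁ 0 hd, e₁]
        simp [Term.eval, hc]
  | sum i a ih =>
    obtain ⟨p, hp⟩ := ih
    refine ⟨Polynomial.X * (p + 3 + 9) + 8, fun ρ d s env hd hρ hs => ?_⟩
    have h := computes_fold (e := .add (.var d) (.var (d + 2))) (B := p.eval (s.var 0))
      (P := a.compile (Function.update ρ i (d + 1)) (d + 2)) (fun x y => x + y)
      (fun j => a.eval (s.var 0) s.table (Function.update env i j)) hd (s := s) rfl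
      (fun j _ s' h1 h2 h3 => by
        have := hp (Function.update ρ i (d + 1)) (d + 2) s' (Function.update env i j) (by omega)
          (fun k => by
            rw [Function.update_apply]
            have := hρ k
            split_ifs <;> omega)
          (invariant_update hρ hs h2 h3)
        rwa [h2 0 hd, h1] at this) (fun s' => by simp [Expr.eval])
    have hval : ∀ n, (Nat.rec 0 (fun j x => x + a.eval (s.var 0) s.table (Function.update env i j))
        n : ℕ) = ∑ j ∈ Finset.range n, a.eval (s.var 0) s.table (Function.update env i j) := by
      intro n
      induction n with
      | zero => rfl
      | succ n ih => rw [Finset.sum_range_succ, ← ih]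
    rw [hval] at h
    simpa [Term.compile, Term.eval, Expr.cost] using h
  | sup i a ih =>
    obtain ⟨p, hp⟩ := ih
    refine ⟨Polynomial.X * (p + 5 + 9) + 8, fun ρ d s env hd hρ hs => ?_⟩
    have h := computes_fold (e := .add (.var d) (.sub (.var (d + 2)) (.var d)))
      (B := p.eval (s.var 0))
      -- With truncated subtraction, `x + (y - x)` is the maximum.
      (P := a.compile (Function.update ρ i (d + 1)) (d + 2)) (fun x y => x + (y - x))
      (fun j => a.eval (s.var 0) s.table (Function.update env i j)) hd (s := s) rfl
      (fun j _ s' h1 h2 h3 => by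
        have := hp (Function.update ρ i (d + 1)) (d + 2) s' (Function.update env i j) (by omega)
          (fun k => by
            rw [Function.update_apply]
            have := hρ k
            split_ifs <;> omega)
          (invariant_update hρ hs h2 h3)
        rwa [h2 0 hd, h1] at this) (fun s' => by simp [Expr.eval])
    have hval : ∀ n, (Nat.rec 0 (fun j x => x + (a.eval (s.var 0) s.table
        (Function.update env i j) - x)) n : ℕ) =
        (Finset.range n).sup fun j => a.eval (s.var 0) s.table (Function.update env i j) := by
      intro n
      induction n with
      | zero => rfl
      | succ n ih =>
        rw [Finset.range_add_one, Finset.sup_insert, ← ih]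
        simp only
        omega
    rw [hval] at h
    simpa [Term.compile, Term.eval, Expr.cost] using h

namespace Stmt

/-- Iteration of a map that depends on the number of the step. -/
def iter {α : Type*} (f : ℕ → α → α) : ℕ → α → α
  | 0, x => x
  | j + 1, x => f j (iter f j x)

def exec (n : ℕ) : Stmt → (ℕ → ℕ) → Tables → Tables
  | store k a b c, env, T => fun k' x y =>
      if k' = k ∧ x = a.eval n T env ∧ y = b.eval n T env then c.eval n T env else T k' x y
  | seq p q, env, T => q.exec n env (p.exec n env T)
  | ite c p, env, T => if c.eval n T env ≠ 0 then p.exec n env T else T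
  | loop i p, env, T => iter (fun j => p.exec n (Function.update env i j)) n T

def compile : Stmt → (ℕ → ℕ) → ℕ → Program
  | store k a b c, ρ, d => .seq (a.compile ρ d) (.seq (b.compile ρ (d + 1))
      (.seq (c.compile ρ (d + 2)) (.store k (.var d) (.var (d + 1)) (.var (d + 2)))))
  | seq p q, ρ, d => .seq (p.compile ρ d) (q.compile ρ d)
  | ite c p, ρ, d => .seq (c.compile ρ d) (.ite (.var d) (p.compile ρ d) .skip)
  | loop i p, ρ, d => .seq (.assign d (.lit 0)) (.while (.sub (.var 0) (.var d))
      (.seq (p.compile (Function.update ρ i d) (d + 1)) (.assign d (.add (.var d) (.lit 1)))))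

/-- Each statement is executed in polynomial time. -/
theorem runs_compile (P : Stmt) : ∃ p : Polynomial ℕ, ∀ (ρ : ℕ → ℕ) (d : ℕ) (s : Memory)
    (env : ℕ → ℕ), 0 < d → (∀ i, ρ i < d) → (∀ i, s.var (ρ i) = env i) →
    ∃ s' t, Runs (P.compile ρ d) s s' t ∧ t ≤ p.eval (s.var 0) ∧ (∀ i < d, s'.var i = s.var i) ∧
      s'.table = P.exec (s.var 0) env s.table := by
  induction P with
  | store k a b c =>
    obtain ⟨p, hp⟩ := a.computes_compile
    obtain ⟨q, hq⟩ := b.computes_compile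
    obtain ⟨r, hr⟩ := c.computes_compile
    refine ⟨p + q + r + 4, fun ρ d s env hd hρ hs => ?_⟩
    obtain ⟨s₁, t₁, r₁, b₁, e₁, v₁, x₁⟩ := hp ρ d s env hd hρ hs
    obtain ⟨s₂, t₂, r₂, b₂, e₂, v₂, x₂⟩ := hq ρ (d + 1) s₁ env (by omega)
      (fun i => (hρ i).trans (by omega)) (fun i => (v₁ _ (hρ i)).trans (hs i))
    obtain ⟨s₃, t₃, r₃, b₃, e₃, v₃, x₃⟩ := hr ρ (d + 2) s₂ env (by omega)
      (fun i => (hρ i).trans (by omega)) (fun i => by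
        rw [v₂ _ ((hρ i).trans (by omega)), v₁ _ (hρ i), hs])
    have n₁ : s₁.var 0 = s.var 0 := v₁ 0 hd
    have n₂ : s₂.var 0 = s.var 0 := (v₂ 0 (by omega)).trans n₁
    rw [n₁] at b₂ x₂
    rw [n₂] at b₃ x₃
    refine ⟨_, _, r₁.seq (r₂.seq (r₃.seq (Runs.store k _ _ _ s₃))), ?_, ?_, ?_⟩
    · simp only [Polynomial.eval_add, Polynomial.eval_ofNat, Expr.cost]
      omega
    · intro i hi
      simp only [Memory.setEntry]
      rw [v₃ i (by omega), v₂ i (by omega), v₁ i hi]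
    · have y₁ : s₃.var d = a.eval (s.var 0) s.table env := by
        rw [v₃ d (by omega), v₂ d (by omega), x₁]
      have y₂ : s₃.var (d + 1) = b.eval (s.var 0) s.table env := by
        rw [v₃ _ (by omega), x₂, e₁]
      rw [e₂, e₁] at x₃
      simp only [Memory.setEntry, Expr.eval, Stmt.exec, y₁, y₂, x₃, e₃, e₂, e₁]
  | seq P Q ihP ihQ =>
    obtain ⟨p, hp⟩ := ihP
    obtain ⟨q, hq⟩ := ihQ
    refine ⟨p + q, fun ρ d s env hd hρ hs => ?_⟩
    obtain ⟨s₁, t₁, r₁, b₁, v₁, x₁⟩ := hp ρ d s env hd hρ hs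
    obtain ⟨s₂, t₂, r₂, b₂, v₂, x₂⟩ := hq ρ d s₁ env hd hρ
      (fun i => (v₁ _ (hρ i)).trans (hs i))
    rw [v₁ 0 hd] at b₂ x₂
    refine ⟨s₂, _, r₁.seq r₂, ?_, fun i hi => (v₂ i hi).trans (v₁ i hi), ?_⟩
    · rw [Polynomial.eval_add]; omega
    · rw [x₂, x₁]; rfl
  | ite c P ihP =>
    obtain ⟨q, hq⟩ := c.computes_compile
    obtain ⟨p, hp⟩ := ihP
    refine ⟨q + p + 3, fun ρ d s env hd hρ hs => ?_⟩
    obtain ⟨s₁, t₁, r₁, b₁, e₁, v₁, x₁⟩ := hq ρ d s env hd hρ hs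
    obtain ⟨s₂, t₂, r₂, b₂, v₂, x₂⟩ := hp ρ d s₁ env hd hρ
      (fun i => (v₁ _ (hρ i)).trans (hs i))
    rw [v₁ 0 hd] at b₂ x₂
    simp only [Polynomial.eval_add, Polynomial.eval_ofNat]
    by_cases hc : c.eval (s.var 0) s.table env = 0
    · refine ⟨s₁, _, r₁.seq (Runs.ite_false (by simp [Expr.eval, x₁, hc]) (Runs.skip s₁)), ?_,
        v₁, ?_⟩
      · simp only [Expr.cost]; omega
      · simp [Stmt.exec, hc, e₁]
    · refine ⟨s₂, _, r₁.seq (Runs.ite_true (by simp [Expr.eval, x₁, hc]) r₂), ?_,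
        fun i hi => (v₂ i hi).trans (v₁ i hi), ?_⟩
      · simp only [Expr.cost]; omega
      · simp [Stmt.exec, hc, x₂, e₁]
  | loop i P ihP =>
    obtain ⟨p, hp⟩ := ihP
    refine ⟨Polynomial.X * (p + 4 + 4) + 6, fun ρ d s env hd hρ hs => ?_⟩
    obtain ⟨s', t, r, b, ⟨i1, i2⟩, -⟩ := runs_while (n := s.var 0) (c := d)
      (B := p.eval (s.var 0) + 4)
      (body := .seq (P.compile (Function.update ρ i d) (d + 1))
        (.assign d (.add (.var d) (.lit 1))))
      (fun j s' => (∀ i < d, s'.var i = s.var i) ∧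
        s'.table = iter (fun j => P.exec (s.var 0) (Function.update env i j)) j s.table) (by
        rintro j hj s' ⟨h1, h2⟩ h3 h4
        obtain ⟨s₁, t₁, r₁, b₁, v₁, x₁⟩ := hp (Function.update ρ i d) (d + 1) s'
          (Function.update env i j) (by omega) (fun k => by
            rw [Function.update_apply]
            have := hρ k
            split_ifs <;> omega)
          (invariant_update hρ hs h1 h4)
        refine ⟨_, _, r₁.seq (Runs.assign _ _ _), ?_, ⟨?_, ?_⟩, ?_, ?_⟩
        · rw [h3] at b₁
          simp only [Expr.cost]; omega
        · intro i hi
          simp only [Memory.setVar]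
          rw [Function.update_of_ne (by omega), v₁ i (by omega), h1 i hi]
        · simp only [Memory.setVar]
          rw [x₁, h2, h3]
          rfl
        · simp only [Memory.setVar]
          rw [Function.update_of_ne (by omega), v₁ 0 (by omega), h3]
        · simp only [Memory.setVar, Function.update_self, Expr.eval]
          rw [v₁ d (by omega), h4])
      (s.setVar d 0) ⟨fun i hi => by simp [Memory.setVar, Function.update_of_ne hi.ne], rfl⟩
      (by simp only [Memory.setVar]; rw [Function.update_of_ne (by omega)])
      (by simp [Memory.setVar])
    refine ⟨s', _, (Runs.assign d (.lit 0) s).seq r, ?_, i1, i2⟩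
    simp only [Expr.cost, Polynomial.eval_add, Polynomial.eval_mul, Polynomial.eval_X,
      Polynomial.eval_ofNat]
    omega

end Stmt

end RAM

namespace RAM

/-! ### Terms and statements with variables ranging over the vertices -/

namespace Term

variable {n : ℕ}

/-- The value of a term if the variables range over `0, …, n - 1`. -/
def val (t : Term) (T : Tables) (env : ℕ → Fin n) : ℕ := t.eval n T fun i => env i

def Holds (t : Term) (T : Tables) (env : ℕ → Fin n) : Prop := t.val T env ≠ 0

instance (t : Term) (T : Tables) (env : ℕ → Fin n) : Decidable (t.Holds T env) := by
  unfold Holds; infer_instance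

variable (T : Tables) (env : ℕ → Fin n)

lemma coe_update (i : ℕ) (j : Fin n) : (fun k => (Function.update env i j k : ℕ)) =
    Function.update (fun k => (env k : ℕ)) i (j : ℕ) := by
  ext k
  by_cases h : k = i
  · subst h; simp
  · simp [h]

@[simp] lemma val_lit (c : ℕ) : (lit c).val T env = c := rfl
@[simp] lemma val_var (i : ℕ) : (var i).val T env = env i := rfl
@[simp] lemma val_entry (k : ℕ) (a b : Term) :
    (entry k a b).val T env = T k (a.val T env) (b.val T env) := rfl
@[simp] lemma val_add (a b : Term) : (add a b).val T env = a.val T env + b.val T env := rfl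
@[simp] lemma val_sub (a b : Term) : (sub a b).val T env = a.val T env - b.val T env := rfl
@[simp] lemma val_ite (c a b : Term) :
    (ite c a b).val T env = if c.Holds T env then a.val T env else b.val T env := rfl
@[simp] lemma val_sum (i : ℕ) (a : Term) :
    (sum i a).val T env = ∑ j : Fin n, a.val T (Function.update env i j) := by
  simp only [val, eval, Finset.sum_range, coe_update]
@[simp] lemma val_sup (i : ℕ) (a : Term) :
    (sup i a).val T env = Finset.univ.sup fun j : Fin n => a.val T (Function.update env i j) := by
  simp only [val, eval, coe_update]
  apply le_antisymm
  · refine Finset.sup_le fun j hj => ?_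
    exact Finset.le_sup (f := fun j : Fin n => a.eval n T
      (Function.update (fun k => (env k : ℕ)) i j)) (Finset.mem_univ ⟨j, Finset.mem_range.1 hj⟩)
  · refine Finset.sup_le fun j _ => ?_
    exact Finset.le_sup (f := fun j : ℕ => a.eval n T
      (Function.update (fun k => (env k : ℕ)) i j)) (Finset.mem_range.2 j.2)

def and (a b : Term) : Term := ite a b (lit 0)
def or (a b : Term) : Term := add a b
def not (a : Term) : Term := ite a (lit 0) (lit 1)
def lt (a b : Term) : Term := sub b a
def eq (a b : Term) : Term := not (add (sub a b) (sub b a))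
def ex (i : ℕ) (a : Term) : Term := sup i a
def all (i : ℕ) (a : Term) : Term := not (ex i (not a))
def imp (a b : Term) : Term := or (not a) b
def max (a b : Term) : Term := add a (sub b a)

@[simp] lemma holds_and (a b : Term) : (and a b).Holds T env ↔ a.Holds T env ∧ b.Holds T env := by
  rw [and, Holds, val_ite]; split_ifs with h <;> simp only [Holds, val_lit] at * <;> tauto
@[simp] lemma holds_or (a b : Term) : (or a b).Holds T env ↔ a.Holds T env ∨ b.Holds T env := by
  simp only [or, Holds, val_add]; omega
@[simp] lemma holds_not (a : Term) : (not a).Holds T env ↔ ¬ a.Holds T env := by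
  rw [not, Holds, val_ite]; split_ifs with h <;> simp [h]
@[simp] lemma holds_lt (a b : Term) : (lt a b).Holds T env ↔ a.val T env < b.val T env := by
  simp only [lt, Holds, val_sub]; omega
@[simp] lemma holds_eq (a b : Term) : (eq a b).Holds T env ↔ a.val T env = b.val T env := by
  rw [eq, holds_not, Holds, val_add, val_sub, val_sub]; omega
@[simp] lemma holds_ex (i : ℕ) (a : Term) :
    (ex i a).Holds T env ↔ ∃ j : Fin n, a.Holds T (Function.update env i j) := by
  rw [ex, Holds, val_sup, ← bot_eq_zero, Ne, Finset.sup_eq_bot_iff]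
  simp [Holds]
@[simp] lemma holds_all (i : ℕ) (a : Term) :
    (all i a).Holds T env ↔ ∀ j : Fin n, a.Holds T (Function.update env i j) := by
  simp [all]
@[simp] lemma holds_imp (a b : Term) :
    (imp a b).Holds T env ↔ (a.Holds T env → b.Holds T env) := by
  simp only [imp, holds_or, holds_not]; tauto
@[simp] lemma val_max (a b : Term) :
    (max a b).val T env = Max.max (a.val T env) (b.val T env) := by
  simp only [max, val_add, val_sub]; omega

/-- The term does not refer to the table `k`. -/
def avoids (k : ℕ) : Term → Bool
  | lit _ => true
  | var _ => true
  | entry k' a b => k' != k && a.avoids k && b.avoids k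
  | add a b => a.avoids k && b.avoids k
  | sub a b => a.avoids k && b.avoids k
  | ite c a b => c.avoids k && a.avoids k && b.avoids k
  | sum _ a => a.avoids k
  | sup _ a => a.avoids k

/-- This makes tabulation independent of the order of writing: a partly filled table `k` does not
affect the values still to be computed. -/
lemma eval_congr_tables {k : ℕ} {T T' : Tables} (hT : ∀ k' ≠ k, T' k' = T k') (t : Term)
    (h : t.avoids k = true) (env : ℕ → ℕ) : t.eval n T' env = t.eval n T env := by
  induction t generalizing env with
  | lit => rfl
  | var => rfl
  | entry k' a b iha ihb =>
    simp only [avoids, Bool.and_eq_true, bne_iff_ne] at h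
    simp only [eval, iha h.1.2, ihb h.2, hT _ h.1.1]
  | add a b iha ihb | sub a b iha ihb =>
    simp only [avoids, Bool.and_eq_true] at h
    simp only [eval, iha h.1, ihb h.2]
  | ite c a b ihc iha ihb =>
    simp only [avoids, Bool.and_eq_true] at h
    simp only [eval, ihc h.1.1, iha h.1.2, ihb h.2]
  | sum i a ih | sup i a ih => simp only [eval, ih h]

end Term

namespace Stmt

variable {n : ℕ}

def run (P : Stmt) (env : ℕ → Fin n) (T : Tables) : Tables := P.exec n (fun i => env i) T

lemma run_seq (P Q : Stmt) (env : ℕ → Fin n) (T : Tables) :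
    (seq P Q).run env T = Q.run env (P.run env T) := rfl

lemma run_ite (c : Term) (P : Stmt) (env : ℕ → Fin n) (T : Tables) :
    (ite c P).run env T = if c.Holds T env then P.run env T else T := rfl

lemma run_loop (Inv : ℕ → Tables → Prop) {i : ℕ} {P : Stmt} {env : ℕ → Fin n} {T : Tables}
    (h0 : Inv 0 T)
    (hs : ∀ (j : Fin n) T, Inv j T → Inv (j + 1) (P.run (Function.update env i j) T)) :
    Inv n ((loop i P).run env T) := by
  have key : ∀ m ≤ n, Inv m
      (iter (fun j => P.exec n (Function.update (fun k => (env k : ℕ)) i j)) m T) := by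
    intro m
    induction m with
    | zero => exact fun _ => h0
    | succ m ih =>
      intro hm
      have := hs ⟨m, hm⟩ _ (ih (by omega))
      rwa [run, Term.coe_update] at this
  exact key n le_rfl

/-- Fill the table `k` with the values of a term in the variables `x₇` and `x₈`. -/
def tabulate (k : ℕ) (t : Term) : Stmt := loop 7 (loop 8 (store k (.var 7) (.var 8) t))

lemma run_tabulate {k : ℕ} {t : Term} (ht : t.avoids k = true) (env : ℕ → Fin n) (T : Tables) :
    (∀ k' ≠ k, (tabulate k t).run env T k' = T k') ∧
      ∀ u v : Fin n, (tabulate k t).run env T k u v =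
        t.val T (Function.update (Function.update env 7 u) 8 v) := by
  have := run_loop (i := 7) (P := loop 8 (store k (.var 7) (.var 8) t)) (env := env) (T := T)
    (fun m T' => (∀ k' ≠ k, T' k' = T k') ∧ ∀ u v : Fin n, (u : ℕ) < m →
      T' k u v = t.val T (Function.update (Function.update env 7 u) 8 v)) (by simp) (by
    rintro x T₁ ⟨h1, h2⟩
    -- Inside row `x`, the completed cells are the earlier rows and the first `m` cells of row `x`.
    have := run_loop (i := 8) (P := store k (.var 7) (.var 8) t)
      (env := Function.update env 7 x) (T := T₁)
      (fun m T' => (∀ k' ≠ k, T' k' = T k') ∧ ∀ u v : Fin n, (u : ℕ) < x ∨ (u = x ∧ (v : ℕ) < m) →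
        T' k u v = t.val T (Function.update (Function.update env 7 u) 8 v))
      ⟨h1, fun u v huv => h2 u v (by simpa using huv)⟩ (by
      rintro y T₂ ⟨h3, h4⟩
      constructor
      · intro k' hk'
        funext a b
        simp [run, exec, hk', h3 k' hk']
      · intro u v huv
        have ht' := Term.eval_congr_tables (n := n) h3 t ht
        simp only [run, exec, Term.eval]
        simp only [Function.update_self, ne_eq, show ¬ (7 = 8) by decide, not_false_eq_true,
          Function.update_of_ne, true_and, Fin.val_inj]
        split_ifs with h
        · rw [h.1, h.2]; exact ht' _
        · refine h4 u v ?_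
          rcases huv with huv | ⟨rfl, huv⟩
          · exact Or.inl huv
          · refine Or.inr ⟨rfl, ?_⟩
            have : (v : ℕ) ≠ y := fun hv => h ⟨rfl, Fin.ext hv⟩
            omega)
    refine ⟨this.1, fun u v huv => this.2 u v ?_⟩
    rcases Nat.lt_succ_iff_lt_or_eq.1 huv with h | h
    · exact Or.inl h
    · exact Or.inr ⟨Fin.ext h, v.2⟩)
  exact ⟨this.1, fun u v => this.2 u v u.2⟩

end Stmt

end RAM

namespace SubcubicMatching

open Finset RAM

/-! ### The quantities of the local search as terms -/

variable {n : ℕ}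

/-- The table `0` holds the adjacency matrix of `G`, and the rows of the table `k` hold the
indicator of `S`. -/
structure Encodes (G : SimpleGraph (Fin n)) [DecidableRel G.Adj] (k : ℕ) (S : Finset (Fin n))
    (T : Tables) : Prop where
  adj : ∀ u v : Fin n, T 0 u v = if G.Adj u v then 1 else 0
  mem : ∀ u v : Fin n, T k u v = if u ∈ S then 1 else 0

lemma sup_filter_eq {α : Type*} [Fintype α] (p : α → Prop) [DecidablePred p] (f : α → ℕ) :
    ({x | p x} : Finset α).sup f = univ.sup fun x => if p x then f x else 0 := by
  apply le_antisymm
  · refine Finset.sup_le fun x hx => ?_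
    have := Finset.le_sup (f := fun x => if p x then f x else 0) (mem_univ x)
    simpa [(mem_filter.1 hx).2] using this
  · refine Finset.sup_le fun x _ => ?_
    split_ifs with h
    · exact Finset.le_sup (mem_filter.2 ⟨mem_univ x, h⟩)
    · exact Nat.zero_le _

namespace Code

open Term

/-- A set is stored as a matrix whose row `u` is constant, so any column would do; the diagonal
needs no further variable. -/
def isMem (k x : ℕ) : Term := entry k (var x) (var x)
def adj (x y : ℕ) : Term := entry 0 (var x) (var y)
def same (x y : ℕ) : Term := Term.eq (var x) (var y)
-- Bound variables are numbered from 10 on. The inequalities assumed in the evaluation lemmas below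
-- say that an argument is not captured by a variable bound inside the term.
def deg (x : ℕ) : Term := sum 10 (adj x 10)
def nbrCount (k x : ℕ) : Term := sum 11 (ite (Term.and (adj x 11) (isMem k 11)) (lit 1) (lit 0))
def good (k : ℕ) : Term := all 12 (imp (isMem k 12) (Term.eq (nbrCount k 12) (lit 1)))
def size (k : ℕ) : Term := sum 10 (isMem k 10)
def degSum (k : ℕ) : Term := sum 12 (ite (isMem k 12) (deg 12) (lit 0))
def isRemote (k x : ℕ) : Term := Term.eq (nbrCount k x) (lit 0)
def remoteCount (k : ℕ) : Term := sum 12 (ite (isRemote k 12) (lit 1) (lit 0))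
def better (k l : ℕ) : Term :=
  Term.or (lt (size l) (size k)) (Term.and (Term.eq (size l) (size k))
    (Term.or (lt (degSum k) (degSum l)) (Term.and (Term.eq (degSum k) (degSum l))
      (lt (remoteCount k) (remoteCount l)))))

def remoteNbrCount (k x : ℕ) : Term :=
  sum 13 (ite (Term.and (adj x 13) (isRemote k 13)) (lit 1) (lit 0))
def closed (k r : ℕ) : Term :=
  Term.and (lt (lit 1) (deg r))
    (Term.and (all 14 (imp (adj r 14) (Term.and (Term.eq (nbrCount k 14) (lit 1))
        (Term.eq (remoteNbrCount k 14) (lit 1)))))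
      (ex 15 (Term.and (isMem k 15) (ex 16 (Term.and (isMem k 16) (Term.and (adj 15 16)
        (all 14 (imp (adj r 14) (Term.or (adj 14 15) (adj 14 16))))))))))
def remoteWeight (k x r : ℕ) : Term :=
  ite (closed k r) (ite (Term.eq (deg r) (lit 3)) (lit 6) (lit 8))
    (ite (Term.eq (deg r) (lit 1)) (ite (Term.eq (nbrCount k x) (lit 1)) (lit 12) (lit 0))
      (ite (Term.eq (deg r) (lit 2)) (lit 6) (lit 4)))
def toRemote (k x : ℕ) : Term :=
  sum 17 (ite (Term.and (adj x 17) (isRemote k 17)) (remoteWeight k x 17) (lit 0))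
def atRemote (k r : ℕ) : Term := sum 18 (ite (adj r 18) (remoteWeight k 18 r) (lit 0))
def toMatched (k x : ℕ) : Term :=
  ite (Term.eq (nbrCount k x) (lit 1))
    (Term.max (sub (lit 12) (toRemote k x))
      (sup 19 (ite (Term.and (adj x 19) (isRemote k 19))
        (sub (add (lit 24) (remoteWeight k x 19)) (add (toRemote k x) (atRemote k 19))) (lit 0))))
    (sub (lit 12) (ite (Term.eq (toRemote k x) (lit 4)) (lit 2)
      (ite (Term.eq (toRemote k x) (lit 6)) (lit 3) (lit 0))))
def matchedLoad (k u : ℕ) : Term :=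
  sum 20 (ite (Term.and (adj u 20) (Term.not (isMem k 20))) (toMatched k 20) (lit 0))
def matchedNeed (k u : ℕ) : Term :=
  sup 21 (ite (Term.and (Term.and (adj u 21) (Term.not (isMem k 21)))
      (Term.eq (nbrCount k 21) (lit 1)))
    (sub (lit 24) (add (matchedLoad k u) (toRemote k 21))) (lit 0))
def matchingWeight (k u v : ℕ) : Term :=
  Term.max (sub (lit 24) (add (matchedLoad k u) (matchedLoad k v)))
    (Term.max (matchedNeed k u) (matchedNeed k v))
def edgeWeight (k u v : ℕ) : Term :=
  ite (isMem k u) (ite (isMem k v) (matchingWeight k u v) (toMatched k v))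
    (ite (isMem k v) (toMatched k u)
      (ite (isRemote k u) (ite (isRemote k v) (lit 0) (remoteWeight k v u))
        (ite (isRemote k v) (remoteWeight k u v) (lit 0))))

end Code

/-! ### The terms compute the intended quantities -/

namespace Encodes

variable {G : SimpleGraph (Fin n)} [DecidableRel G.Adj] {k : ℕ} {S : Finset (Fin n)} {T : Tables}
  (h : Encodes G k S T) (env : ℕ → Fin n)

section
include h

open Term

lemma holds_adj (x y : ℕ) : (Code.adj x y).Holds T env ↔ G.Adj (env x) (env y) := by
  simp [Code.adj, Term.Holds, h.adj]

lemma val_adj (x y : ℕ) :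
    (Code.adj x y).val T env = if G.Adj (env x) (env y) then 1 else 0 := by
  simp [Code.adj, h.adj]

lemma holds_isMem (x : ℕ) : (Code.isMem k x).Holds T env ↔ env x ∈ S := by
  simp [Code.isMem, Term.Holds, h.mem]

lemma val_isMem (x : ℕ) : (Code.isMem k x).val T env = if env x ∈ S then 1 else 0 := by
  simp [Code.isMem, h.mem]

lemma val_deg {x : ℕ} (hx : x ≠ 10) : (Code.deg x).val T env = G.degree (env x) := by
  simp [Code.deg, h.val_adj, hx, ← SimpleGraph.card_neighborFinset_eq_degree,
    SimpleGraph.neighborFinset_eq_filter]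

lemma val_nbrCount {x : ℕ} (hx : x ≠ 11) :
    (Code.nbrCount k x).val T env = nbrCount G S (env x) := by
  simp [Code.nbrCount, h.holds_adj, h.holds_isMem, hx, nbrCount,
    SimpleGraph.neighborFinset_eq_filter, filter_filter]

lemma holds_good : (Code.good k).Holds T env ↔ Good G S := by
  simp [Code.good, h.holds_isMem, h.val_nbrCount, Good]

lemma val_size : (Code.size k).val T env = #S := by
  simp [Code.size, h.val_isMem]

lemma val_degSum : (Code.degSum k).val T env = degSum G S := by
  simp only [Code.degSum, val_sum, val_ite, h.holds_isMem, ne_eq, show ¬ 12 = 10 by decide,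
    not_false_eq_true, h.val_deg, Function.update_self, val_lit, sum_ite_mem, univ_inter, degSum]
  exact sum_congr rfl fun x _ => by rw [Function.update_self]

lemma holds_isRemote {x : ℕ} (hx : x ≠ 11) :
    (Code.isRemote k x).Holds T env ↔ nbrCount G S (env x) = 0 := by
  simp [Code.isRemote, h.val_nbrCount, hx]

lemma val_remoteCount : (Code.remoteCount k).val T env = #(remote G S) := by
  simp [Code.remoteCount, h.holds_isRemote, remote]

lemma val_remoteNbrCount {x : ℕ} (hx : x ≠ 13) :
    (Code.remoteNbrCount k x).val T env = #(remoteNbrs G S (env x)) := by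
  simp [Code.remoteNbrCount, h.holds_adj, h.holds_isRemote, hx, remoteNbrs,
    SimpleGraph.neighborFinset_eq_filter, filter_filter]

lemma holds_closed {r : ℕ} (h10 : r ≠ 10) (h14 : r ≠ 14) (h15 : r ≠ 15) (h16 : r ≠ 16) :
    (Code.closed k r).Holds T env ↔ Closed G S (env r) := by
  simp [Code.closed, h.holds_adj, h.holds_isMem, h.val_deg, h.val_nbrCount, h.val_remoteNbrCount,
    h10, h14, h15, h16, Closed, Nat.succ_le_iff]

lemma val_remoteWeight {x r : ℕ} (h11 : x ≠ 11) (h10 : r ≠ 10) (h14 : r ≠ 14) (h15 : r ≠ 15)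
    (h16 : r ≠ 16) :
    (Code.remoteWeight k x r).val T env = remoteWeight G S (env x) (env r) := by
  simp [Code.remoteWeight, h.holds_closed, h.val_deg, h.val_nbrCount, h10, h11, h14, h15, h16,
    remoteWeight]

lemma val_toRemote {x : ℕ} (h11 : x ≠ 11) (h17 : x ≠ 17) :
    (Code.toRemote k x).val T env = toRemote G S (env x) := by
  simp [Code.toRemote, h.holds_adj, h.holds_isRemote, h.val_remoteWeight, h11, h17, toRemote,
    remoteNbrs, SimpleGraph.neighborFinset_eq_filter, filter_filter, sum_filter]

lemma val_atRemote {r : ℕ} (h10 : r ≠ 10) (h14 : r ≠ 14) (h15 : r ≠ 15) (h16 : r ≠ 16)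
    (h18 : r ≠ 18) : (Code.atRemote k r).val T env = atRemote G S (env r) := by
  simp [Code.atRemote, h.holds_adj, h.val_remoteWeight, h10, h14, h15, h16, h18, atRemote,
    SimpleGraph.neighborFinset_eq_filter, sum_filter]

lemma val_toMatched {x : ℕ} (h11 : x ≠ 11) (h17 : x ≠ 17) (h19 : x ≠ 19) :
    (Code.toMatched k x).val T env = toMatched G S (env x) := by
  simp [Code.toMatched, h.holds_adj, h.holds_isRemote, h.val_remoteWeight, h.val_toRemote,
    h.val_atRemote, h.val_nbrCount, h11, h17, h19, toMatched,
    remoteNbrs, SimpleGraph.neighborFinset_eq_filter, filter_filter, sup_filter_eq]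

lemma val_matchedLoad {u : ℕ} (h20 : u ≠ 20) :
    (Code.matchedLoad k u).val T env = matchedLoad G S (env u) := by
  simp [Code.matchedLoad, h.holds_adj, h.holds_isMem, h.val_toMatched, h20, matchedLoad,
    outerNbrs, SimpleGraph.neighborFinset_eq_filter, filter_filter, sum_filter]

lemma val_matchedNeed {u : ℕ} (h20 : u ≠ 20) (h21 : u ≠ 21) :
    (Code.matchedNeed k u).val T env = matchedNeed G S (env u) := by
  simp [Code.matchedNeed, h.holds_adj, h.holds_isMem, h.val_matchedLoad, h.val_toRemote,
    h.val_nbrCount, h20, h21, matchedNeed,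
    outerNbrs, SimpleGraph.neighborFinset_eq_filter, filter_filter, sup_filter_eq]

lemma val_edgeWeight {u v : ℕ} (hu : u < 10) (hv : v < 10) :
    (Code.edgeWeight k u v).val T env = edgeWeight G S (env u) (env v) := by
  have hu' : ∀ i, 10 ≤ i → u ≠ i := fun i hi => by omega
  have hv' : ∀ i, 10 ≤ i → v ≠ i := fun i hi => by omega
  simp [Code.edgeWeight, Code.matchingWeight, h.holds_isMem, h.holds_isRemote, h.val_matchedLoad,
    h.val_matchedNeed, h.val_toMatched, h.val_remoteWeight, hu', hv', edgeWeight, matchingWeight]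

end

lemma holds_better {l : ℕ} {S' : Finset (Fin n)} (h' : Encodes G l S' T) (h : Encodes G k S T) :
    (Code.better l k).Holds T env ↔ Better G S' S := by
  simp [Code.better, h.val_size, h'.val_size, h.val_degSum, h'.val_degSum, h.val_remoteCount,
    h'.val_remoteCount, Better]

end Encodes

end SubcubicMatching

namespace SubcubicMatching

open Finset RAM

/-! ### The algorithm -/

namespace Code

open Term

/-- Membership of the vertex `x₇` in the exchange of the set in table `5` given by `x₁, …, x₆`. -/
def exchange : Term :=
  Term.or (Term.and (isMem 5 7) (Term.not (Term.or (same 7 1) (same 7 2))))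
    (Term.or (same 7 3) (Term.or (same 7 4) (Term.or (same 7 5) (same 7 6))))

def indicator (t : Term) : Term := ite t (lit 1) (lit 0)

/-- Table 5 holds the current set and table 4 the candidate, which replaces it only if it is good
and better. -/
def tryExchange : Stmt :=
  .seq (.tabulate 4 (indicator exchange))
    (.ite (Term.and (good 4) (better 4 5)) (.tabulate 5 (entry 4 (var 7) (var 8))))

/-- One pass over all exchanges. -/
def pass : Stmt :=
  .loop 1 (.loop 2 (.loop 3 (.loop 4 (.loop 5 (.loop 6 tryExchange)))))

def twice (P : Stmt) : Stmt := .seq P P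

/-- Three loops and four doublings give `16 * n ^ 3` passes. The three loops may share the variable
9 because it is never read. -/
def localSearch : Stmt := .loop 9 (.loop 9 (.loop 9 (twice (twice (twice (twice pass))))))

def output : Stmt :=
  .seq (.tabulate 1 (indicator (Term.and (adj 7 8) (Term.and (isMem 5 7) (isMem 5 8)))))
    (.seq (.tabulate 3 (lit 24)) (.tabulate 2 (edgeWeight 5 7 8)))

def algorithm : Stmt := .seq localSearch output

end Code

variable {n : ℕ} {G : SimpleGraph (Fin n)} [DecidableRel G.Adj] {S : Finset (Fin n)}

variable (G) in
/-- The statement replaces each good set `S` by itself if `φ S` holds and by a better good set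
otherwise. -/
def Improves (P : Stmt) (env : ℕ → Fin n) (φ : Finset (Fin n) → Prop) : Prop :=
  ∀ T S, Encodes G 5 S T → Good G S → ∃ S', Encodes G 5 S' (P.run env T) ∧ Good G S' ∧
    ((S' = S ∧ φ S) ∨ (Better G S' S ∧ ¬ φ S))

lemma Better.trans {S₁ S₂ S₃ : Finset (Fin n)} (h : Better G S₁ S₂) (h' : Better G S₂ S₃) :
    Better G S₁ S₃ := by
  unfold Better at *; omega

/-- Until the first improvement every round sees the original `S`. So either all conditions hold for
`S` and nothing changes, or the first round that changes the set shows that one of them fails for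
`S`. -/
lemma Improves.loop {i : ℕ} {P : Stmt} {env : ℕ → Fin n} {φ : Fin n → Finset (Fin n) → Prop}
    (h : ∀ j, Improves G P (Function.update env i j) (φ j)) :
    Improves G (.loop i P) env fun S => ∀ j, φ j S := by
  intro T S hT hS
  obtain ⟨S', h1, h2, h3⟩ := Stmt.run_loop (i := i) (P := P) (env := env) (T := T)
    (fun m T' => ∃ S', Encodes G 5 S' T' ∧ Good G S' ∧
      ((S' = S ∧ ∀ j : Fin n, (j : ℕ) < m → φ j S) ∨ (Better G S' S ∧ ∃ j, ¬ φ j S)))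
    ⟨S, hT, hS, Or.inl ⟨rfl, by simp⟩⟩ (by
      rintro j T₁ ⟨S₁, h1, h2, h3⟩
      obtain ⟨S₂, h4, h5, h6⟩ := h j T₁ S₁ h1 h2
      refine ⟨S₂, h4, h5, ?_⟩
      rcases h3 with ⟨rfl, h3⟩ | ⟨h3, h3'⟩
      · rcases h6 with ⟨rfl, h6⟩ | ⟨h6, h6'⟩
        · refine Or.inl ⟨rfl, fun i hi => ?_⟩
          rcases Nat.lt_succ_iff_lt_or_eq.1 hi with hi | hi
          · exact h3 i hi
          · rwa [Fin.ext hi]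
        · exact Or.inr ⟨h6, j, h6'⟩
      · rcases h6 with ⟨rfl, -⟩ | ⟨h6, -⟩
        · exact Or.inr ⟨h3, h3'⟩
        · exact Or.inr ⟨h6.trans h3, h3'⟩)
  refine ⟨S', h1, h2, ?_⟩
  rcases h3 with ⟨h3, h4⟩ | ⟨h3, h4⟩
  · exact Or.inl ⟨h3, fun j => h4 j j.2⟩
  · exact Or.inr ⟨h3, fun h => h4.elim fun j hj => hj (h j)⟩

lemma improves_tryExchange (env : ℕ → Fin n) : Improves G Code.tryExchange env fun S =>
    Good G (exchange S (env 1) (env 2) (env 3) (env 4) (env 5) (env 6)) →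
      ¬ Better G (exchange S (env 1) (env 2) (env 3) (env 4) (env 5) (env 6)) S := by
  intro T S hT hS
  set S₁ := exchange S (env 1) (env 2) (env 3) (env 4) (env 5) (env 6) with hS₁
  obtain ⟨h1, h2⟩ := Stmt.run_tabulate (k := 4) (t := Code.indicator Code.exchange) (by decide) env T
  rw [Code.tryExchange, Stmt.run_seq, Stmt.run_ite]
  set T₁ := (Stmt.tabulate 4 (Code.indicator Code.exchange)).run env T
  have hT₁ : Encodes G 5 S T₁ := ⟨by simpa [h1] using hT.adj, by simpa [h1] using hT.mem⟩
  have hT₁' : Encodes G 4 S₁ T₁ := by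
    refine ⟨hT₁.adj, fun u v => ?_⟩
    rw [h2]
    simp [Code.indicator, Code.exchange, hT.holds_isMem, Code.same, Fin.val_inj, hS₁, exchange]
    exact if_congr (by tauto) rfl rfl
  have hiff : (Term.and (Code.good 4) (Code.better 4 5)).Holds T₁ env ↔
      Good G S₁ ∧ Better G S₁ S := by
    rw [Term.holds_and, hT₁'.holds_good, hT₁'.holds_better _ hT₁]
  split_ifs with hc
  · rw [hiff] at hc
    obtain ⟨h3, h4⟩ := Stmt.run_tabulate (k := 5) (t := .entry 4 (.var 7) (.var 8)) (by decide)
      env T₁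
    refine ⟨S₁, ⟨?_, ?_⟩, hc.1, Or.inr ⟨hc.2, fun h => h hc.1 hc.2⟩⟩
    · rw [h3 0 (by decide)]; exact hT₁.adj
    · intro u v
      rw [h4]
      simpa using hT₁'.mem u v
  · rw [hiff] at hc
    exact ⟨S, hT₁, hS, Or.inl ⟨rfl, fun h h' => hc ⟨h, h'⟩⟩⟩

lemma improves_pass (env : ℕ → Fin n) : Improves G Code.pass env fun S =>
    ∀ a b c d e f, Good G (exchange S a b c d e f) → ¬ Better G (exchange S a b c d e f) S := by
  refine Improves.loop fun a => Improves.loop fun b => Improves.loop fun c => Improves.loop fun d =>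
    Improves.loop fun e => Improves.loop fun f => ?_
  simpa using improves_tryExchange (G := G) (Function.update (Function.update (Function.update
    (Function.update (Function.update (Function.update env 1 a) 2 b) 3 c) 4 d) 5 e) 6 f)

/-! ### Bounding the number of passes -/

variable (G S) in
/-- A measure of progress of the local search. -/
def potential : ℕ :=
  (#S * (3 * n + 1) + (3 * n - degSum G S)) * (n + 1) + (n - #(remote G S))

lemma degSum_le (hd : ∀ v, G.degree v ≤ 3) : degSum G S ≤ 3 * #S := by
  rw [degSum, mul_comm, ← smul_eq_mul]
  exact sum_le_card_nsmul _ _ _ fun v _ => hd v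

lemma card_le_order (S : Finset (Fin n)) : #S ≤ n := (card_le_univ S).trans_eq (Fintype.card_fin n)

/-- The potential is a mixed-radix numeral with digits `#S`, `3 * n - degSum` and `n - #remote`. The
last two are at most `3 * n` and `n`, so the numerical order is the lexicographic order of the
criteria. -/
lemma Better.potential_lt (hd : ∀ v, G.degree v ≤ 3) {S' : Finset (Fin n)} (h : Better G S' S) :
    potential G S + 1 ≤ potential G S' := by
  have h1 := card_le_order S
  have h2 := card_le_order S'
  have h3 := card_le_order (remote G S)
  have h4 := card_le_order (remote G S')
  have h5 := degSum_le (S := S) hd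
  have h6 := degSum_le (S := S') hd
  have key : ∀ x y a b : ℕ, a ≤ n → (x < y ∨ (x = y ∧ a < b)) →
      x * (n + 1) + a + 1 ≤ y * (n + 1) + b := by
    rintro x y a b ha (hxy | ⟨rfl, hab⟩)
    · have := Nat.mul_le_mul_right (n + 1) (Nat.succ_le_of_lt hxy)
      rw [Nat.succ_mul] at this
      omega
    · omega
  have key' : ∀ x y a b : ℕ, a ≤ 3 * n → x < y → x * (3 * n + 1) + a < y * (3 * n + 1) + b := by
    intro x y a b ha hxy
    have := Nat.mul_le_mul_right (3 * n + 1) (Nat.succ_le_of_lt hxy)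
    rw [Nat.succ_mul] at this
    omega
  apply key _ _ _ _ (by omega)
  rcases h with h | ⟨h, h' | ⟨h', h''⟩⟩
  · exact Or.inl (key' _ _ _ _ (by omega) h)
  · rw [h]; omega
  · rw [h, h']; omega

lemma potential_lt (hn : 0 < n) : potential G S < 16 * n ^ 3 := by
  have h1 := card_le_order S
  have h2 : potential G S ≤ (n * (3 * n + 1) + 3 * n) * (n + 1) + n := by
    unfold potential
    gcongr <;> omega
  have h3 : n ≤ n ^ 2 := Nat.le_self_pow (by decide) n
  have h4 : n ^ 2 ≤ n ^ 3 := Nat.pow_le_pow_right hn (by decide)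
  -- The coefficients 3, 7, 5 add up to 15, which leaves room for the strict bound by `16 * n ^ 3`.
  have h5 : (n * (3 * n + 1) + 3 * n) * (n + 1) + n = 3 * n ^ 3 + 7 * n ^ 2 + 5 * n := by ring
  have h6 : 0 < n ^ 3 := by positivity
  omega

variable (G) in
/-- The statement preserves local optimality and gains at least `m` otherwise. -/
def Gains (P : Stmt) (m : ℕ) : Prop :=
  ∀ (env : ℕ → Fin n) T S, Encodes G 5 S T → Good G S →
    ∃ S', Encodes G 5 S' (P.run env T) ∧ Good G S' ∧ (LocalOpt G S → LocalOpt G S') ∧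
      (LocalOpt G S' ∨ potential G S + m ≤ potential G S')

lemma gains_pass (hd : ∀ v, G.degree v ≤ 3) : Gains G Code.pass 1 := by
  intro env T S hT hS
  obtain ⟨S', h1, h2, ⟨rfl, h3⟩ | ⟨h3, h4⟩⟩ := improves_pass env T S hT hS
  · exact ⟨S', h1, h2, id, Or.inl ⟨hS, h3⟩⟩
  · exact ⟨S', h1, h2, fun h => absurd h.2 h4, Or.inr (h3.potential_lt hd)⟩

lemma Gains.twice {P : Stmt} {m : ℕ} (h : Gains G P m) : Gains G (Code.twice P) (2 * m) := by
  intro env T S hT hS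
  obtain ⟨S₁, h1, h2, h3, h4⟩ := h env T S hT hS
  obtain ⟨S₂, h5, h6, h7, h8⟩ := h env _ S₁ h1 h2
  refine ⟨S₂, h5, h6, h7 ∘ h3, ?_⟩
  rcases h4 with h4 | h4
  · exact Or.inl (h7 h4)
  · exact h8.imp_right fun h8 => by omega

/-- A local optimum, once reached, survives all later rounds; as long as none is reached, the gains
of the rounds add up. -/
lemma Gains.loop {P : Stmt} {m : ℕ} (h : Gains G P m) (i : ℕ) : Gains G (.loop i P) (n * m) := by
  intro env T S hT hS
  exact Stmt.run_loop (i := i) (P := P) (env := env) (T := T)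
    (fun l T' => ∃ S', Encodes G 5 S' T' ∧ Good G S' ∧ (LocalOpt G S → LocalOpt G S') ∧
      (LocalOpt G S' ∨ potential G S + l * m ≤ potential G S'))
    ⟨S, hT, hS, id, Or.inr (by simp)⟩ (by
      rintro j T₁ ⟨S₁, h1, h2, h3, h4⟩
      obtain ⟨S₂, h5, h6, h7, h8⟩ := h (Function.update env i j) T₁ S₁ h1 h2
      refine ⟨S₂, h5, h6, h7 ∘ h3, ?_⟩
      rcases h4 with h4 | h4
      · exact Or.inl (h7 h4)
      · refine h8.imp_right fun h8 => ?_
        rw [Nat.succ_mul]; omega)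

lemma localOpt_localSearch (hd : ∀ v, G.degree v ≤ 3) (env : ℕ → Fin n) {T : Tables}
    (hT : Encodes G 5 ∅ T) :
    ∃ S, Encodes G 5 S (Code.localSearch.run env T) ∧ LocalOpt G S := by
  obtain ⟨S, h1, -, -, h2⟩ := ((((((((gains_pass hd).twice).twice).twice).twice).loop 9).loop
    9).loop 9) env T ∅ hT (by simp [Good])
  refine ⟨S, h1, h2.resolve_right fun h3 => ?_⟩
  have := potential_lt (G := G) (S := S) (Fin.pos (env 0))
  have h4 : n * (n * (n * (2 * (2 * (2 * (2 * 1)))))) = 16 * n ^ 3 := by ring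
  omega

/-! ### The output and the main theorem -/

lemma run_output (env : ℕ → Fin n) {T : Tables} (hT : Encodes G 5 S T) (u v : Fin n) :
    (Code.output.run env T 1 u v = if G.Adj u v ∧ u ∈ S ∧ v ∈ S then 1 else 0) ∧
      Code.output.run env T 2 u v = edgeWeight G S u v ∧ Code.output.run env T 3 u v = 24 := by
  rw [Code.output, Stmt.run_seq, Stmt.run_seq]
  obtain ⟨h1, h2⟩ := Stmt.run_tabulate (k := 1)
    (t := Code.indicator (Term.and (Code.adj 7 8) (Term.and (Code.isMem 5 7) (Code.isMem 5 8))))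
    (by decide) env T
  set T₁ := (Stmt.tabulate 1 (Code.indicator
    (Term.and (Code.adj 7 8) (Term.and (Code.isMem 5 7) (Code.isMem 5 8))))).run env T
  obtain ⟨h3, h4⟩ := Stmt.run_tabulate (k := 3) (t := .lit 24) (by decide) env T₁
  set T₂ := (Stmt.tabulate 3 (.lit 24)).run env T₁
  have hT₂ : Encodes G 5 S T₂ :=
    ⟨by simpa [h1, h3] using hT.adj, by simpa [h1, h3] using hT.mem⟩
  obtain ⟨h5, h6⟩ := Stmt.run_tabulate (k := 2) (t := Code.edgeWeight 5 7 8) (by decide) env T₂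
  refine ⟨?_, ?_, ?_⟩
  · rw [h5 1 (by decide), h3 1 (by decide), h2]
    simp [Code.indicator, hT.holds_adj, hT.holds_isMem]
  · rw [h6, hT₂.val_edgeWeight _ (by decide) (by decide)]
    simp
  · rw [h5 3 (by decide), h4]
    rfl

end SubcubicMatching

open SubcubicMatching in
theorem theorem2 :
    ∃ (P : RAM.Program) (p : Polynomial ℕ),
      ∀ (n : ℕ) (G : SimpleGraph (Fin n)) [DecidableRel G.Adj], (∀ v, G.degree v ≤ 3) →
        ∃ (s : RAM.Memory) (t : ℕ) (M : Finset (Sym2 (Fin n))) (y : Sym2 (Fin n) → ℝ),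
          RAM.Runs P (RAM.graphInput G) s t ∧ t ≤ p.eval n ∧
          RAM.OutputsEdgeSet s M ∧ RAM.OutputsEdgeWeights s G y ∧
          InducedMatching.IsInducedMatching G M ∧
          InducedMatching.IsDualFeasible G y ∧
          (3 / 7 : ℝ) * ∑ e ∈ G.edgeFinset, y e ≤ (M.card : ℝ) ∧
          (InducedMatching.inducedMatchingNumber G : ℝ) ≤ (7 / 3 : ℝ) * (M.card : ℝ) := by
  obtain ⟨p, hp⟩ := RAM.Stmt.runs_compile Code.algorithm
  -- The algorithm has no free variables that matter: all names initially refer to `x₁`, which holds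
  -- 0. The variable `x₀` keeps `n`, and scratch space starts at `x₂`.
  refine ⟨Code.algorithm.compile (fun _ => 1) 2, p, fun n G _ hd => ?_⟩
  obtain ⟨s, t, hr, ht, -, hs⟩ := hp (fun _ => 1) 2 (RAM.graphInput G) (fun _ => 0) two_pos
    (fun _ => one_lt_two) (fun _ => rfl)
  suffices h : ∃ S, LocalOpt G S ∧ ∀ u v : Fin n,
      (s.table 1 u v = if G.Adj u v ∧ u ∈ S ∧ v ∈ S then 1 else 0) ∧
        s.table 2 u v = edgeWeight G S u v ∧ s.table 3 u v = 24 by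
    obtain ⟨S, hS, hout⟩ := h
    have hsum := hS.sum_dualValue_le hd
    have hfeas := hS.isDualFeasible hd
    refine ⟨s, t, edgesWithin G S, dualValue G S, hr, ht, fun u v => ?_, fun u v _ => ⟨?_, ?_⟩,
      hS.1.isInducedMatching, hfeas, by linarith, (inducedMatchingNumber_le hfeas).trans hsum⟩
    · simp only [(hout u v).1, mem_edgesWithin]
    · rw [(hout u v).2.2]; decide
    · rw [(hout u v).2.1, (hout u v).2.2, dualValue_mk]; rfl
  -- For `n = 0` there is no assignment of vertices to the variables, so the analysis of the code
  -- does not apply, but the claim is trivial.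
  obtain rfl | hn := Nat.eq_zero_or_pos n
  · exact ⟨∅, ⟨by simp [Good], fun a => a.elim0⟩, fun u => u.elim0⟩
  · have hT : Encodes G 5 ∅ (RAM.graphInput G).table :=
      ⟨fun u v => by simp [RAM.graphInput], fun u v => by simp [RAM.graphInput]⟩
    obtain ⟨S, h1, h2⟩ := localOpt_localSearch hd (fun _ => ⟨0, hn⟩) hT
    refine ⟨S, h2, fun u v => ?_⟩
    rw [hs]
    exact run_output (fun _ => ⟨0, hn⟩) h1 u v
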